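/- **Setting.** A *gentle bound quiver* $(Q,I)$ is a finite quiver with an ideal $I$ generated by paths of length two such that every vertex has at most two incoming and at most two outgoing arrows; for each arrow $\alpha$ there is at most one arrow $\beta$ with $\alpha\beta$ a path, $\alpha\beta\notin I$, at most one $\gamma$ with $\gamma\alpha$ a path, $\gamma\alpha\notin I$, at most one $\beta$ with $\alpha\beta\in I$, and at most one $\gamma$ with $\gamma\alpha\in I$ (where $\alpha\beta$, $\gamma\alpha$ denote paths of length two); and all sufficiently long paths lie in $I$. Its *fringed quiver* $\tilde\Lambda$ is the gentle bound quiver obtained by adding at each vertex arrows from and to new vertices (*fringe* arrows and *fringe* vertices, each fringe vertex being incident to exactly one arrow) so that each original (*internal*) vertex gets in-degree and out-degree $2$, and by adding relations at the internal vertices that keep the quiver gentle. Thus at each internal vertex $v$ there are exactly two relations $\alpha_1\alpha_2,\beta_1\beta_2\in I$. Let $E$ be the set of arrows of $\tilde\Lambda$. **Flows.** The *turbulence polyhedron* $\mathcal F_1=\mathcal F_1(\tilde\Lambda)\subset\mathbb R^E$ is the set of $F\ge 0$ with $F(\alpha_1)+F(\alpha_2)=F(\beta_1)+F(\beta_2)$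 for each internal vertex with relations $\alpha_1\alpha_2,\beta_1\beta_2$, and $\frac12\sum_{\alpha\text{ fringe}}F(\alpha)=1$. Its recession cone is $\{x\in\mathbb R^E: y+x\in\mathcal F_1\ \text{for all}\ y\in\mathcal F_1\}$. **Trails.** A *string* is a walk $\alpha_1^{\varepsilon_1}\cdots\alpha_m^{\varepsilon_m}$ in arrows and formal inverses of arrows of $\tilde\Lambda$ containing no $\alpha\alpha^{-1}$, no $\alpha^{-1}\alpha$, and neither $\beta\gamma$ nor $\gamma^{-1}\beta^{-1}$ for any relation $\beta\gamma$; there is also a lazy string $e_v=e_v^{-1}$ of length $0$ at each vertex $v$. We write $t(p)$ and $h(p)$ for the first and the last vertex of a string $p$. A *route* is a maximal string; routes are considered up to $p\sim p^{-1}$. A *band* is a string $B$ of positive length such that $B^2$ is a string and $B$ is not a proper power; bands are considered up to cyclic rotation and inversion, and substrings of $B$ are substrings of powers of $B$. The indicator vector $\mathcal I(p)\in\mathbb R^E$ of a route or band $p$ counts the occurrences of each arrow, with either sign, in the word $p$. A route or band $p$ is *self-compatible* if there is no (possibly lazy) string $\sigma$ and arrows $\alpha,\beta,\gamma,\delta$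 such that $\alpha^{-1}\sigma\beta$ and $\gamma\sigma\delta^{-1}$ are both substrings of $p$ or $p^{-1}$. **Elementary routes.** A route is *elementary* if it is self-compatible and either it uses no vertex more than once, or it has the form $R\sigma R^{-1}$ where $R$ uses no vertex twice, $\sigma$ uses only the vertex $t(\sigma)=h(\sigma)$ twice, and $R$ and $\sigma$ share no vertex except $h(R)=t(\sigma)=h(\sigma)$ (a "lollipop"). **Elementary bands.** Let $B$ be a band. A string $\sigma$ of positive length is *boosted* in $B$ if it occurs in $B$ at two different positions (modulo the length of $B$), and *criss-crossed* in $B$ if $\sigma$ and $\sigma^{-1}$ are both substrings of $B$. For an internal vertex $v$ with relations $\alpha_1\alpha_2,\beta_1\beta_2$ let $S=\{\alpha_1\beta_2,\alpha_1\beta_1^{-1},\alpha_2^{-1}\beta_2,\alpha_2^{-1}\beta_1^{-1}\}$ and let $T$ be the set of inverses of the elements of $S$; the lazy string $e_v$ is *boosted* in $B$ if elements of $S$, or elements of $T$, occur in $B$ at more than one position (modulo the length of $B$), and *criss-crossed* if an element of $S$ and an element of $T$ both occur in $B$. A criss-crossed substring is maximal if it is not properly contained in another one. The band $B$ is *elementary*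 if it is self-compatible, has no boosted substring (lazy or not), and has, up to inversion, at most one maximal criss-crossed substring (lazy or not). (These are the self-compatible "simple" and "barbell" bands.) **Theorem.** Let $\tilde\Lambda$ be the fringed quiver of a gentle bound quiver. The map $p\mapsto\mathcal I(p)$ is a bijection from the set of elementary routes of $\tilde\Lambda$ to the set of vertices of $\mathcal F_1(\tilde\Lambda)$. The map $B\mapsto\mathcal I(B)$ is a bijection from the set of elementary bands of $\tilde\Lambda$ onto a minimal generating set of the recession cone of $\mathcal F_1(\tilde\Lambda)$: the recession cone is the set of finite nonnegative linear combinations of the vectors $\mathcal I(B)$, and no proper subset of these vectors generates it in this way. -/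

import Mathlib

open Set

/-- A quiver with vertices `V` and arrows `E`, together with a set of length-two monomial relations:
`rel α β` means that the path `αβ` (first `α`, then `β`) is one of the generators of the ideal. -/
structure BoundQuiver (V E : Type*) where
  src : E → V
  tgt : E → V
  rel : E → E → Prop
  rel_comp : ∀ α β, rel α β → tgt α = src β

namespace BoundQuiver

variable {V E : Type*}

/-- `(Q, I)` is a gentle bound quiver, where `I` is the ideal generated by the relations.
As `I` is spanned by the paths which contain a relation, `finite_dim` says that all sufficiently
long paths lie in `I`, i.e. that `I` is admissible and the algebra is finite-dimensional. -/
structure IsGentle (Q : BoundQuiver V E) : Prop where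
  out_le : ∀ v, {α | Q.src α = v}.encard ≤ 2
  in_le : ∀ v, {α | Q.tgt α = v}.encard ≤ 2
  next_nonrel : ∀ α, {β | Q.tgt α = Q.src β ∧ ¬ Q.rel α β}.Subsingleton
  prev_nonrel : ∀ α, {γ | Q.tgt γ = Q.src α ∧ ¬ Q.rel γ α}.Subsingleton
  next_rel : ∀ α, {β | Q.rel α β}.Subsingleton
  prev_rel : ∀ α, {γ | Q.rel γ α}.Subsingleton
  finite_dim : ∃ N : ℕ, ∀ w : List E,
    w.IsChain (fun α β => Q.tgt α = Q.src β ∧ ¬ Q.rel α β) → w.length ≤ N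

/-- `Q'` is the fringed quiver of `Q`: it is a gentle bound quiver which is obtained from `Q` by
adding, at each vertex, arrows from and to new (fringe) vertices, so that every old (internal)
vertex gets in-degree and out-degree two, and relations at the old vertices. Every new vertex is
incident to precisely one arrow. -/
structure Fringing {V E V' E' : Type*} (Q : BoundQuiver V E) (Q' : BoundQuiver V' E') where
  vert : V ↪ V'
  arr : E ↪ E'
  src_arr : ∀ α, Q'.src (arr α) = vert (Q.src α)
  tgt_arr : ∀ α, Q'.tgt (arr α) = vert (Q.tgt α)
  rel_arr : ∀ α β, Q'.rel (arr α) (arr β) ↔ Q.rel α β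
  gentle : Q'.IsGentle
  out_deg : ∀ v, {α | Q'.src α = vert v}.encard = 2
  in_deg : ∀ v, {α | Q'.tgt α = vert v}.encard = 2
  fringe_arrow : ∀ α, α ∉ range arr →
    (Q'.src α ∈ range vert ∧ Q'.tgt α ∉ range vert) ∨
    (Q'.src α ∉ range vert ∧ Q'.tgt α ∈ range vert)
  fringe_vert : ∀ x, x ∉ range vert → ∃! α, Q'.src α = x ∨ Q'.tgt α = x

/-! ### Signed arrows and strings -/

/-- A signed arrow: `(α, true)` is `α` and `(α, false)` is the formal inverse of `α`. -/
abbrev SArrow (E : Type*) := E × Bool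

/-- The tail (start point) of a signed arrow. -/
def tail (Q : BoundQuiver V E) (a : SArrow E) : V := if a.2 then Q.src a.1 else Q.tgt a.1

/-- The head (end point) of a signed arrow. -/
def head (Q : BoundQuiver V E) (a : SArrow E) : V := if a.2 then Q.tgt a.1 else Q.src a.1

/-- The inverse of a signed arrow. -/
def flip (a : SArrow E) : SArrow E := (a.1, !a.2)

/-- The inverse of a word in signed arrows. -/
def inv (w : List (SArrow E)) : List (SArrow E) := (w.map flip).reverse

/-- The two-letter word `ab` is a string. -/
def Step (Q : BoundQuiver V E) (a b : SArrow E) : Prop :=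
  Q.head a = Q.tail b ∧ b ≠ flip a ∧
  ¬ (a.2 = true ∧ b.2 = true ∧ Q.rel a.1 b.1) ∧
  ¬ (a.2 = false ∧ b.2 = false ∧ Q.rel b.1 a.1)

/-- Strings of positive length, as words in signed arrows. Lazy strings `e_v` are not represented
by words; where they matter, a string is given by its start vertex and its word, and `e_v` is
`(v, [])`. -/
def IsString (Q : BoundQuiver V E) (w : List (SArrow E)) : Prop := w ≠ [] ∧ w.IsChain Q.Step

/-- The sequence of all vertices through which a string of positive length passes. -/
def vertexSeq (Q : BoundQuiver V E) : List (SArrow E) → List V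
  | [] => []
  | a :: w => Q.tail a :: (a :: w).map Q.head

/-- The indicator vector of a word: how often each arrow is used, with either sign. -/
noncomputable def wordIndicator (w : List (SArrow E)) : E → ℝ := by
  classical exact fun α => ((w.map Prod.fst).count α : ℝ)

/-! ### Routes and bands -/

/-- A route is a maximal string. -/
def IsRoute (Q : BoundQuiver V E) (w : List (SArrow E)) : Prop :=
  Q.IsString w ∧ (∀ a, ¬ Q.IsString (a :: w)) ∧ (∀ a, ¬ Q.IsString (w ++ [a]))

/-- The power `w ^ n` of a word. -/
def pow (w : List (SArrow E)) (n : ℕ) : List (SArrow E) := (List.replicate n w).flatten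

/-- A band is a string `w` such that `w ^ 2` is a string (that is, `h(w) = t(w)` and the last letter
of `w` followed by the first one is a string), and which is not a proper power. -/
def IsBand (Q : BoundQuiver V E) (w : List (SArrow E)) : Prop :=
  Q.IsString w ∧ Q.IsString (w ++ w) ∧ ∀ (u : List (SArrow E)) (n : ℕ), 2 ≤ n → w ≠ pow u n

/-- The subwords of a route. -/
def routeFactors (w : List (SArrow E)) : Set (List (SArrow E)) := {f | f <:+: w}

/-- The subwords of a band: these are the subwords of its powers. -/
def bandFactors (w : List (SArrow E)) : Set (List (SArrow E)) := {f | ∃ n, f <:+: pow w n}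

/-! ### Compatibility -/

/-- The string with start vertex `v` and word `σ` (lazy if `σ = []`) is a top substring of
`p` or of `p⁻¹`, where `P` is the set of subwords of `p`: there, `σ` is preceded by an inverse
arrow and followed by an arrow. -/
def IsTop (Q : BoundQuiver V E) (P : Set (List (SArrow E))) (v : V) (σ : List (SArrow E)) : Prop :=
  ∃ a b : SArrow E, Q.head a = v ∧ a.2 = false ∧ b.2 = true ∧
    (a :: σ ++ [b] ∈ P ∨ inv (a :: σ ++ [b]) ∈ P)

/-- Dually, bottom substrings: `σ` is preceded by an arrow and followed by an inverse arrow. -/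
def IsBottom (Q : BoundQuiver V E) (P : Set (List (SArrow E))) (v : V) (σ : List (SArrow E)) :
    Prop :=
  ∃ a b : SArrow E, Q.head a = v ∧ a.2 = true ∧ b.2 = false ∧
    (a :: σ ++ [b] ∈ P ∨ inv (a :: σ ++ [b]) ∈ P)

/-- Two trails, given by their sets of subwords, kiss. -/
def Kiss (Q : BoundQuiver V E) (P P' : Set (List (SArrow E))) : Prop :=
  ∃ (v : V) (σ : List (SArrow E)),
    (Q.IsTop P v σ ∧ Q.IsBottom P' v σ) ∨ (Q.IsTop P' v σ ∧ Q.IsBottom P v σ)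

/-- A trail is self-compatible if it does not kiss itself. -/
def SelfCompatible (Q : BoundQuiver V E) (P : Set (List (SArrow E))) : Prop := ¬ Q.Kiss P P

/-! ### Elementary routes -/

/-- The word `w` is simple as a path. -/
def IsSimple (Q : BoundQuiver V E) (w : List (SArrow E)) : Prop := (Q.vertexSeq w).Nodup

/-- The word `w` has the form `R σ R⁻¹`, where `R` does not use a vertex twice, `σ` uses only its
start vertex `t(σ) = h(σ)` twice, and `R` and `σ` share only the vertex `h(R) = t(σ)`. -/
def IsLollipop (Q : BoundQuiver V E) (w : List (SArrow E)) : Prop :=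
  ∃ R σ : List (SArrow E), R ≠ [] ∧ σ ≠ [] ∧ w = R ++ σ ++ inv R ∧
    (Q.vertexSeq R).Nodup ∧
    (Q.vertexSeq σ).head? = (Q.vertexSeq σ).getLast? ∧ (Q.vertexSeq σ).tail.Nodup ∧
    ∀ v, v ∈ Q.vertexSeq R → v ∈ Q.vertexSeq σ → (Q.vertexSeq R).getLast? = some v

/-- Elementary routes. -/
def IsElementaryRoute (Q : BoundQuiver V E) (w : List (SArrow E)) : Prop :=
  Q.IsRoute w ∧ Q.SelfCompatible (routeFactors w) ∧ (Q.IsSimple w ∨ Q.IsLollipop w)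

/-! ### Elementary bands -/

/-- The set `{α₁β₂, α₁β₁⁻¹, α₂⁻¹β₂, α₂⁻¹β₁⁻¹}` of the length-two strings which pass from the side
of the relation `α₁α₂` to the side of the relation `β₁β₂`. -/
def passages (α₁ α₂ β₁ β₂ : E) : Set (SArrow E × SArrow E) :=
  {((α₁, true), (β₂, true)), ((α₁, true), (β₁, false)),
    ((α₂, false), (β₂, true)), ((α₂, false), (β₁, false))}

/-- `α₁α₂` and `β₁β₂` are the two relations at the vertex `v`. -/
def RelationsAt (Q : BoundQuiver V E) (v : V) (α₁ α₂ β₁ β₂ : E) : Prop :=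
  Q.tgt α₁ = v ∧ Q.tgt β₁ = v ∧ α₁ ≠ β₁ ∧ Q.rel α₁ α₂ ∧ Q.rel β₁ β₂

/-- The word `f` occurs in the band `w` starting at the position `i` (taken modulo the length). -/
def OccursAt (w f : List (SArrow E)) (i : ℕ) : Prop :=
  i < w.length ∧ ∃ n, f <+: (pow w n).drop i

/-- The string with start vertex `v` and word `σ` is a boosted substring of the band `w`. -/
def IsBoosted (Q : BoundQuiver V E) (w : List (SArrow E)) (v : V) (σ : List (SArrow E)) : Prop :=
  (σ ≠ [] ∧ (Q.vertexSeq σ).head? = some v ∧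
    ∃ i j, i ≠ j ∧ OccursAt w σ i ∧ OccursAt w σ j) ∨
  (σ = [] ∧ ∃ α₁ α₂ β₁ β₂, Q.RelationsAt v α₁ α₂ β₁ β₂ ∧
    ∃ s ∈ passages α₁ α₂ β₁ β₂, ∃ t ∈ passages α₁ α₂ β₁ β₂,
    ∃ i j, i ≠ j ∧ OccursAt w [s.1, s.2] i ∧ OccursAt w [t.1, t.2] j)

/-- The string with start vertex `v` and word `σ` is a criss-crossed substring of the band `w`.
The inverses of the elements of `passages α₁ α₂ β₁ β₂` are those of `passages β₁ β₂ α₁ α₂`. -/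
def IsCrissCrossed (Q : BoundQuiver V E) (w : List (SArrow E)) (v : V) (σ : List (SArrow E)) :
    Prop :=
  (σ ≠ [] ∧ (Q.vertexSeq σ).head? = some v ∧ σ ∈ bandFactors w ∧ inv σ ∈ bandFactors w) ∨
  (σ = [] ∧ ∃ α₁ α₂ β₁ β₂, Q.RelationsAt v α₁ α₂ β₁ β₂ ∧
    (∃ s ∈ passages α₁ α₂ β₁ β₂, [s.1, s.2] ∈ bandFactors w) ∧
    (∃ t ∈ passages β₁ β₂ α₁ α₂, [t.1, t.2] ∈ bandFactors w))

/-- The string `(v, σ)` is a substring of the string `(u, τ)`. -/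
def IsSub (Q : BoundQuiver V E) (v : V) (σ : List (SArrow E)) (u : V) (τ : List (SArrow E)) :
    Prop :=
  (σ = [] ∧ v ∈ u :: τ.map Q.head) ∨ (σ ≠ [] ∧ σ <:+: τ)

/-- Maximal criss-crossed substrings of the band `w`. -/
def IsMaxCrissCrossed (Q : BoundQuiver V E) (w : List (SArrow E)) (v : V) (σ : List (SArrow E)) :
    Prop :=
  Q.IsCrissCrossed w v σ ∧
    ∀ u τ, Q.IsCrissCrossed w u τ → Q.IsSub v σ u τ → u = v ∧ τ = σ

/-- Elementary bands. Mutually inverse criss-crossed substrings count as one; lazy strings are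
their own inverses. -/
def IsElementaryBand (Q : BoundQuiver V E) (w : List (SArrow E)) : Prop :=
  Q.IsBand w ∧ Q.SelfCompatible (bandFactors w) ∧ (∀ v σ, ¬ Q.IsBoosted w v σ) ∧
    ∀ v σ u τ, Q.IsMaxCrissCrossed w v σ → Q.IsMaxCrissCrossed w u τ →
      (u = v ∧ τ = σ) ∨ (σ ≠ [] ∧ τ = inv σ)

/-! ### Equivalence classes of routes and bands -/

theorem flip_flip (a : SArrow E) : flip (flip a) = a := by
  simp [flip]

theorem inv_inv (w : List (SArrow E)) : inv (inv w) = w := by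
  simp [inv, List.map_reverse, Function.comp_def, flip_flip]

theorem inv_isRotated {w w' : List (SArrow E)} (h : w ~r w') : inv w ~r inv w' :=
  (h.map flip).reverse

theorem wordIndicator_inv (w : List (SArrow E)) : wordIndicator (inv w) = wordIndicator w := by
  funext α
  simp [wordIndicator, inv, List.map_reverse, Function.comp_def, flip]

theorem wordIndicator_isRotated {w w' : List (SArrow E)} (h : w ~r w') :
    wordIndicator w = wordIndicator w' := by
  classical
  funext α
  simp only [wordIndicator]
  congr 1
  convert (h.perm.map Prod.fst).count_eq α

/-- Routes are considered up to inversion. -/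
def routeSetoid (Q : BoundQuiver V E) : Setoid {w : List (SArrow E) // Q.IsRoute w} where
  r p q := p.1 = q.1 ∨ p.1 = inv q.1
  iseqv :=
    { refl := fun _ => Or.inl rfl
      symm := by
        rintro p q (h | h)
        · exact Or.inl h.symm
        · exact Or.inr (by rw [h, inv_inv])
      trans := by
        rintro p q r (h | h) (h' | h')
        · exact Or.inl (h.trans h')
        · exact Or.inr (h.trans h')
        · exact Or.inr (by rw [h, h'])
        · exact Or.inl (by rw [h, h', inv_inv]) }

/-- Bands are considered up to cyclic rotation and inversion. -/
def bandSetoid (Q : BoundQuiver V E) : Setoid {w : List (SArrow E) // Q.IsBand w} where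
  r p q := p.1 ~r q.1 ∨ p.1 ~r inv q.1
  iseqv :=
    { refl := fun p => Or.inl (List.IsRotated.refl p.1)
      symm := by
        rintro p q (h | h)
        · exact Or.inl h.symm
        · have := inv_isRotated h.symm
          rw [inv_inv] at this
          exact Or.inr this
      trans := by
        rintro p q r (h | h) (h' | h')
        · exact Or.inl (h.trans h')
        · exact Or.inr (h.trans h')
        · exact Or.inr (h.trans (inv_isRotated h'))
        · have := inv_isRotated h'
          rw [inv_inv] at this
          exact Or.inl (h.trans this) }

/-- Routes up to equivalence. -/
def RouteClass (Q : BoundQuiver V E) := Quotient Q.routeSetoid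

/-- Bands up to equivalence. -/
def BandClass (Q : BoundQuiver V E) := Quotient Q.bandSetoid

/-- The indicator vector of a route. -/
noncomputable def routeIndicator (Q : BoundQuiver V E) : Q.RouteClass → (E → ℝ) :=
  Quotient.lift (fun p => wordIndicator p.1) (by
    rintro p q (h | h)
    · simp only [h]
    · simp only [h, wordIndicator_inv])

/-- The indicator vector of a band. -/
noncomputable def bandIndicator (Q : BoundQuiver V E) : Q.BandClass → (E → ℝ) :=
  Quotient.lift (fun p => wordIndicator p.1) (by
    rintro p q (h | h)
    · exact wordIndicator_isRotated h
    · exact (wordIndicator_isRotated h).trans (wordIndicator_inv _))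

/-- The elementary routes, up to equivalence. -/
def elementaryRoutes (Q : BoundQuiver V E) : Set Q.RouteClass :=
  {c | ∃ p : {w : List (SArrow E) // Q.IsRoute w},
    Q.IsElementaryRoute p.1 ∧ Quotient.mk Q.routeSetoid p = c}

/-- The elementary bands, up to equivalence. -/
def elementaryBands (Q : BoundQuiver V E) : Set Q.BandClass :=
  {c | ∃ p : {w : List (SArrow E) // Q.IsBand w},
    Q.IsElementaryBand p.1 ∧ Quotient.mk Q.bandSetoid p = c}

end BoundQuiver

/-! ### Flows -/

namespace BoundQuiver.Fringing

variable {V E V' E' : Type*} {Q : BoundQuiver V E} {Q' : BoundQuiver V' E'}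

/-- Half of the total value on the fringe arrows. -/
noncomputable def strength [Fintype E'] (h : Fringing Q Q') (F : E' → ℝ) : ℝ := by
  classical exact (1 / 2) * ∑ α : E', if α ∈ range h.arr then 0 else F α

/-- `F` is a nonnegative flow on the fringed quiver. -/
structure IsFlow (_h : Fringing Q Q') (F : E' → ℝ) : Prop where
  nonneg : ∀ α, 0 ≤ F α
  conservation : ∀ v α₁ α₂ β₁ β₂, Q'.RelationsAt v α₁ α₂ β₁ β₂ → F α₁ + F α₂ = F β₁ + F β₂

/-- The turbulence polyhedron: the nonnegative flows of strength one. -/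
def turbulencePolyhedron [Fintype E'] (h : Fringing Q Q') : Set (E' → ℝ) :=
  {F | h.IsFlow F ∧ h.strength F = 1}

end BoundQuiver.Fringing

/-- The recession cone of a subset of a real vector space. -/
def recessionCone {W : Type*} [AddCommGroup W] (P : Set W) : Set W :=
  {x | ∀ y ∈ P, y + x ∈ P}

/-- The set of all finite nonnegative linear combinations of elements of `G`. -/
def conicalHull {W : Type*} [AddCommGroup W] [Module ℝ W] (G : Set W) : Set W :=
  (Submodule.span {c : ℝ // 0 ≤ c} G : Set W)

/-- `G` generates the cone `C`, and no proper subset of `G` does. -/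
def IsMinimalGeneratingSet {W : Type*} [AddCommGroup W] [Module ℝ W] (G C : Set W) : Prop :=
  conicalHull G = C ∧ ∀ H, H ⊆ G → conicalHull H = C → H = G

namespace BoundQuiver

variable {V E : Type*}

/-! ### The two sides of a vertex -/

/-! At an internal vertex, divide the four arrow ends between two sides, two ends that meet in a
relation lying on the same side. Strings are then exactly the walks that enter a vertex by one side
and leave it by the other, and the flow equation says that the two sides carry the same total value
(`exists_sides`, `step_iff_node`, `conserved_iff`). The rest is about walks on a finite graph with
two-sided vertices.

In these terms an elementary route is a simple path or a lollipop between fringe vertices, and an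
elementary band is a simple cycle or a barbell: two loops joined by a bridge that is run through
once in each direction and may have length zero. A criss-crossed substring is a "fold" of the
periodic walk, and self-compatibility is a sign condition at the two ends of its maximal folds.

Rigidity: a conserved function supported on an elementary trail is determined by one value, being
constant on loops and twice as large on sticks and bridges; so it is a multiple of the indicator
(`eq_smul_of_isElementaryRoute`, `eq_smul_of_isElementaryBand`). The support also determines the
trail. The only freedom is the direction in which a loop is run. For a lollipop this just inverts
the route. For a barbell, reversing one loop changes the sign at one end of the bridge, so exactly
one relative orientation is self-compatible.

Existence: in the support of a nonzero nonnegative flow every walk that reaches an internal vertex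
can be continued, the opposite side having positive total. A walk that is prolonged until it repeats
a vertex or leaves yields an elementary trail in the support (`exists_elementary_trail`).

Convexity: subtracting the largest possible multiple of such an indicator shrinks the support
(`IsFlow.exists_sub`). Routes have strength one and bands strength zero. Hence flows of strength
zero, which form the recession cone, are nonnegative combinations of bands, and an extreme point
must be a route. Conversely, nonnegative vectors do not cancel, so rigidity of supports makes routes
extreme and no band redundant. -/

@[simp] theorem flip_fst (a : SArrow E) : (flip a).1 = a.1 := rfl

@[simp] theorem flip_snd (a : SArrow E) : (flip a).2 = !a.2 := rfl

theorem flip_ne (a : SArrow E) : flip a ≠ a := fun h => by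
  have := congrArg Prod.snd h
  simp at this

theorem fst_eq_iff {a b : SArrow E} : a.1 = b.1 ↔ a = b ∨ a = flip b := by
  obtain ⟨α, s⟩ := a
  obtain ⟨β, t⟩ := b
  cases s <;> cases t <;> simp [flip]

@[simp] theorem tail_flip (Q : BoundQuiver V E) (a : SArrow E) : Q.tail (flip a) = Q.head a := by
  obtain ⟨α, s⟩ := a
  cases s <;> rfl

@[simp] theorem head_flip (Q : BoundQuiver V E) (a : SArrow E) : Q.head (flip a) = Q.tail a := by
  obtain ⟨α, s⟩ := a
  cases s <;> rfl

/-- The opposite side of a vertex. -/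
def opp (ν : V × Bool) : V × Bool := (ν.1, !ν.2)

@[simp] theorem opp_opp (ν : V × Bool) : opp (opp ν) = ν := by simp [opp]

theorem opp_ne (ν : V × Bool) : opp ν ≠ ν := fun h => by
  have := congrArg Prod.snd h
  simp [opp] at this

theorem eq_or_eq_opp {μ ν : V × Bool} (h : μ.1 = ν.1) : μ = ν ∨ μ = opp ν := by
  obtain ⟨v, s⟩ := μ
  obtain ⟨w, t⟩ := ν
  obtain rfl : v = w := h
  cases s <;> cases t <;> simp [opp]

theorem opp_eq_comm {μ ν : V × Bool} : μ = opp ν ↔ ν = opp μ :=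
  ⟨fun h => by rw [h, opp_opp], fun h => by rw [h, opp_opp]⟩

/-- A distribution of the ends of the arrows at each vertex to two sides, such that strings are the
walks which pass through each vertex from one side to the other one. The vertices in `inner` have
one incoming and one outgoing arrow on each side; the other vertices are incident to at most one
arrow. -/
structure Sides (Q : BoundQuiver V E) where
  side : SArrow E → Bool
  inner : Set V
  step_iff : ∀ a b, Q.Step a b ↔ Q.head a = Q.tail b ∧ side b = !side (flip a)
  letter_ext : ∀ a b, Q.tail a = Q.tail b → side a = side b → a.2 = b.2 → a = b
  exists_letter : ∀ v ∈ inner, ∀ s ε, ∃ a, Q.tail a = v ∧ side a = s ∧ a.2 = ε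
  outer_unique : ∀ a b, Q.tail a ∉ inner → Q.tail a = Q.tail b → a = b

namespace Sides

variable {Q : BoundQuiver V E} (S : Q.Sides)

/-- The side of a vertex by which a letter leaves its tail. -/
def node (a : SArrow E) : V × Bool := (Q.tail a, S.side a)

@[simp] theorem node_fst (a : SArrow E) : (S.node a).1 = Q.tail a := rfl

theorem step_iff_node {a b : SArrow E} : Q.Step a b ↔ S.node b = opp (S.node (flip a)) := by
  rw [S.step_iff]
  simp [node, opp, Prod.ext_iff, eq_comm]

theorem node_ext {a b : SArrow E} (h : S.node a = S.node b) (h' : a.2 = b.2) : a = b :=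
  S.letter_ext a b (congrArg Prod.fst h) (congrArg Prod.snd h) h'

theorem exists_node {ν : V × Bool} (h : ν.1 ∈ S.inner) (ε : Bool) :
    ∃ a, S.node a = ν ∧ a.2 = ε := by
  obtain ⟨a, h1, h2, h3⟩ := S.exists_letter ν.1 h ν.2 ε
  exact ⟨a, Prod.ext h1 h2, h3⟩

theorem step_flip (S : Q.Sides) {a b : SArrow E} (h : Q.Step a b) : Q.Step (flip b) (flip a) := by
  rw [S.step_iff_node] at h ⊢
  rw [flip_flip, h, opp_opp]

/-- At an outer vertex only one letter starts, so the next letter would be `flip a`, which leaves by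
the side just used. -/
theorem tail_mem_inner_of_step {a b : SArrow E} (h : Q.Step a b) : Q.tail b ∈ S.inner := by
  by_contra hb
  have h1 := S.step_iff_node.1 h
  have h2 : b = flip a := S.outer_unique b (flip a) hb (congrArg Prod.fst h1)
  rw [h2] at h1
  exact opp_ne _ h1.symm

theorem exists_step {a : SArrow E} (h : Q.head a ∈ S.inner) (ε : Bool) :
    ∃ b, Q.Step a b ∧ b.2 = ε := by
  obtain ⟨b, hb, h'⟩ := S.exists_node (ν := opp (S.node (flip a))) (by simpa [opp] using h) ε
  exact ⟨b, S.step_iff_node.2 hb, h'⟩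

/-- For two direct letters that compose, only a relation can prevent a `Step`, and by `step_iff` a
`Step` fails precisely when both ends are on one side. -/
theorem rel_iff (S : Q.Sides) {α β : E} (h : Q.tgt α = Q.src β) :
    Q.rel α β ↔ S.node (α, false) = S.node (β, true) := by
  have := S.step_iff (α, true) (β, true)
  simp only [Step, head, tail, flip, h] at this
  have h2 : ((β, true) : SArrow E) ≠ (α, !true) := by simp
  simp only [node, tail, Prod.ext_iff, h]
  simp only [if_true, true_and, Bool.not_true, ne_eq] at this
  cases h3 : S.side (α, false) <;> cases h4 : S.side (β, true) <;> simp_all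

/-- The two relations occupy different sides: on a common side the incoming arrows `α₁` and `β₁`
would coincide by `node_ext`. -/
theorem relationsAt_node {v : V} {α₁ α₂ β₁ β₂ : E} (h : Q.RelationsAt v α₁ α₂ β₁ β₂) :
    S.node (α₁, false) = S.node (α₂, true) ∧ S.node (β₁, false) = S.node (β₂, true) ∧
      S.node (β₁, false) = opp (S.node (α₁, false)) ∧ Q.tail (α₁, false) = v := by
  obtain ⟨h1, h2, h3, h4, h5⟩ := h
  have h6 := (S.rel_iff (Q.rel_comp _ _ h4)).1 h4
  have h7 := (S.rel_iff (Q.rel_comp _ _ h5)).1 h5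
  refine ⟨h6, h7, ?_, h1⟩
  rcases eq_or_eq_opp (μ := S.node (β₁, false)) (ν := S.node (α₁, false))
    (by simp [tail, h1, h2]) with h | h
  · exact absurd (congrArg Prod.fst (S.node_ext h rfl)).symm h3
  · exact h

theorem exists_relationsAt {ν : V × Bool} (h : ν.1 ∈ S.inner) :
    ∃ α₁ α₂ β₁ β₂, Q.RelationsAt ν.1 α₁ α₂ β₁ β₂ ∧ S.node (α₁, false) = ν := by
  obtain ⟨⟨α₁, _⟩, h1, rfl⟩ := S.exists_node h false
  obtain ⟨⟨α₂, _⟩, h2, rfl⟩ := S.exists_node h true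
  obtain ⟨⟨β₁, _⟩, h3, rfl⟩ := S.exists_node (ν := opp ν) h false
  obtain ⟨⟨β₂, _⟩, h4, rfl⟩ := S.exists_node (ν := opp ν) h true
  have e1 : Q.tgt α₁ = ν.1 := congrArg Prod.fst h1
  have e2 : Q.src α₂ = ν.1 := congrArg Prod.fst h2
  have e3 : Q.tgt β₁ = ν.1 := congrArg Prod.fst h3
  have e4 : Q.src β₂ = ν.1 := congrArg Prod.fst h4
  refine ⟨α₁, α₂, β₁, β₂, ⟨e1, e3, ?_, ?_, ?_⟩, h1⟩
  · rintro rfl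
    exact opp_ne ν (h3.symm.trans h1)
  · exact (S.rel_iff (e1.trans e2.symm)).2 (h1.trans h2.symm)
  · exact (S.rel_iff (e3.trans e4.symm)).2 (h3.trans h4.symm)

/-- Each side offers one letter of each sign, so the four listed words exhaust the ways of arriving
by the side of `α₁α₂` and leaving by the other. -/
theorem mem_passages_iff {v : V} {α₁ α₂ β₁ β₂ : E} (h : Q.RelationsAt v α₁ α₂ β₁ β₂)
    (s : SArrow E × SArrow E) :
    s ∈ passages α₁ α₂ β₁ β₂ ↔
      S.node (flip s.1) = S.node (α₁, false) ∧ S.node s.2 = opp (S.node (α₁, false)) := by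
  obtain ⟨h1, h2, h3, h4⟩ := S.relationsAt_node h
  constructor
  · rintro (rfl | rfl | rfl | rfl) <;> simp [flip, ← h1, ← h2, h3]
  · obtain ⟨⟨x, ε⟩, ⟨y, δ⟩⟩ := s
    rintro ⟨e1, e2⟩
    have hx : ((x, ε) : SArrow E) = (α₁, true) ∨ ((x, ε) : SArrow E) = (α₂, false) := by
      cases ε
      · right
        have := S.node_ext (e1.trans h1) rfl
        simpa [flip] using this
      · left
        have := S.node_ext e1 rfl
        simpa [flip] using this
    have hy : ((y, δ) : SArrow E) = (β₂, true) ∨ ((y, δ) : SArrow E) = (β₁, false) := by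
      cases δ
      · right
        exact S.node_ext (e2.trans h3.symm) rfl
      · left
        exact S.node_ext (e2.trans (h3.symm.trans h2)) rfl
    rcases hx with hx | hx <;> rcases hy with hy | hy <;> rw [hx, hy] <;> simp [passages]

end Sides

theorem RelationsAt.symm {Q : BoundQuiver V E} {v : V} {α₁ α₂ β₁ β₂ : E}
    (h : Q.RelationsAt v α₁ α₂ β₁ β₂) : Q.RelationsAt v β₁ β₂ α₁ α₂ :=
  ⟨h.2.1, h.1, h.2.2.1.symm, h.2.2.2.2, h.2.2.2.1⟩

/-! ### Construction of the sides of a fringed quiver -/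

namespace Fringing

variable {V' E' : Type*} {Q : BoundQuiver V E} {Q' : BoundQuiver V' E'}

theorem src_ne_tgt_of_fringe (h : Fringing Q Q') {α : E'} (hv : Q'.src α ∉ range h.vert) :
    Q'.src α ≠ Q'.tgt α := by
  intro he
  by_cases ha : α ∈ range h.arr
  · obtain ⟨α, rfl⟩ := ha
    exact hv ⟨_, (h.src_arr α).symm⟩
  · rcases h.fringe_arrow α ha with h1 | h1
    · exact hv h1.1
    · exact hv (he ▸ h1.2)

theorem fringe_letter_unique (h : Fringing Q Q') {a b : SArrow E'} (hv : Q'.tail a ∉ range h.vert)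
    (hab : Q'.tail a = Q'.tail b) : a = b := by
  obtain ⟨γ, hγ, hu⟩ := h.fringe_vert _ hv
  obtain ⟨α, s⟩ := a
  obtain ⟨β, t⟩ := b
  have h1 : α = γ := hu α (by cases s <;> simp [tail])
  have h2 : β = γ := hu β (by rw [hab]; cases t <;> simp [tail])
  subst h1 h2
  cases s <;> cases t <;> simp only [tail] at hab hv ⊢
  · exact absurd hab.symm (h.src_ne_tgt_of_fringe (by rw [← show Q'.tgt β = Q'.src β from hab]; exact hv))
  · exact absurd hab (h.src_ne_tgt_of_fringe hv)

/-- The vertices of a fringed quiver have two sides. -/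
theorem exists_sides (h : Fringing Q Q') : ∃ S : Q'.Sides, S.inner = range h.vert := by
  classical
  have h1 : ∀ u, ∃ x y, x ≠ y ∧ {α | Q'.src α = h.vert u} = {x, y} := fun u =>
    Set.encard_eq_two.1 (h.out_deg u)
  choose x y hxy hout using h1
  have hx : ∀ u, Q'.src (x u) = h.vert u := fun u => by
    have : x u ∈ {α | Q'.src α = h.vert u} := by rw [hout]; simp
    exact this
  have hy : ∀ u, Q'.src (y u) = h.vert u := fun u => by
    have : y u ∈ {α | Q'.src α = h.vert u} := by rw [hout]; simp
    exact this
  have hxy' : ∀ u α, Q'.src α = h.vert u → α = x u ∨ α = y u := fun u α hα => by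
    have : α ∈ {α | Q'.src α = h.vert u} := hα
    rw [hout] at this
    exact this
  have hrel : ∀ u α, Q'.tgt α = h.vert u → (Q'.rel α (y u) ↔ ¬ Q'.rel α (x u)) := by
    intro u α hα
    constructor
    · intro h1 h2
      exact hxy u (h.gentle.next_rel α h2 h1)
    · intro h1
      by_contra h2
      exact hxy u (h.gentle.next_nonrel α ⟨hα.trans (hx u).symm, h1⟩ ⟨hα.trans (hy u).symm, h2⟩)
  -- The side `true` at `u` is that of the outgoing arrow `x u`; an incoming arrow ends there if its
  -- composite with `x u` is a relation. At fringe vertices the value does not matter.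
  let side : SArrow E' → Bool := fun a =>
    decide (if a.2 then a.1 ∈ range x else ∃ u, Q'.rel a.1 (x u))
  have side_x : ∀ u, side (x u, true) = true := fun u => by simp [side]
  have side_y : ∀ u, side (y u, true) = false := fun u => by
    simp only [side, if_true, decide_eq_false_iff_not]
    rintro ⟨w, hw⟩
    have : w = u := h.vert.injective (by rw [← hx w, hw, hy u])
    subst this
    exact hxy _ hw
  have side_in : ∀ u α, Q'.tgt α = h.vert u → (side (α, false) = true ↔ Q'.rel α (x u)) := by
    intro u α hα
    simp only [side, Bool.false_eq_true, if_false, decide_eq_true_eq]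
    constructor
    · rintro ⟨w, hw⟩
      have : w = u := h.vert.injective (by rw [← hx w, ← Q'.rel_comp _ _ hw, hα])
      exact this ▸ hw
    · exact fun hw => ⟨u, hw⟩
  have ext_out : ∀ α β, Q'.src α = Q'.src β → side (α, true) = side (β, true) → α = β := by
    intro α β he hs
    by_cases hv : Q'.src α ∈ range h.vert
    · obtain ⟨u, hu⟩ := hv
      rcases hxy' u α hu.symm with rfl | rfl <;> rcases hxy' u β (he.symm.trans hu.symm) with rfl | rfl <;>
        simp_all
    · exact congrArg Prod.fst (h.fringe_letter_unique (a := (α, true)) (b := (β, true)) hv he)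
  -- Incoming arrows on one side are both in relation with `x u`, or both with `y u`; gentleness
  -- allows only one such predecessor.
  have ext_in : ∀ α β, Q'.tgt α = Q'.tgt β → side (α, false) = side (β, false) → α = β := by
    intro α β he hs
    by_cases hv : Q'.tgt α ∈ range h.vert
    · obtain ⟨u, hu⟩ := hv
      have ha := side_in u α hu.symm
      have hb := side_in u β (he.symm.trans hu.symm)
      rw [hs] at ha
      by_cases hr : Q'.rel α (x u)
      · exact h.gentle.prev_rel (x u) hr (hb.1 (ha.2 hr))
      · have hr' : ¬ Q'.rel β (x u) := fun h' => hr (ha.1 (hb.2 h'))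
        exact h.gentle.prev_rel (y u) ((hrel u α hu.symm).2 hr)
          ((hrel u β (he.symm.trans hu.symm)).2 hr')
    · exact congrArg Prod.fst (h.fringe_letter_unique (a := (α, false)) (b := (β, false)) hv he)
  have key : ∀ α β, Q'.tgt α = Q'.src β →
      (¬ Q'.rel α β ↔ side (β, true) = !side (α, false)) := by
    intro α β he
    by_cases hv : Q'.src β ∈ range h.vert
    · obtain ⟨u, hu⟩ := hv
      have ha := side_in u α (he.trans hu.symm)
      rcases hxy' u β hu.symm with rfl | rfl
      · rw [side_x, ← ha]
        simp
      · rw [side_y, hrel u α (he.trans hu.symm), ← ha]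
        simp
    · exact absurd (h.fringe_letter_unique (a := (β, true)) (b := (α, false)) hv he.symm) (by simp)
  refine ⟨⟨side, range h.vert, ?_, ?_, ?_, fun a b => h.fringe_letter_unique⟩, rfl⟩
  · rintro ⟨α, s⟩ ⟨β, t⟩
    cases s <;> cases t <;> simp [Step, flip, head, tail]
    · intro he
      rw [key β α he.symm]
      cases side (α, true) <;> cases side (β, false) <;> simp
    · intro he
      constructor
      · intro hne
        by_contra hs
        exact hne (ext_out β α he.symm (by simpa using hs))
      · rintro hs rfl
        simp at hs
    · intro he
      constructor
      · intro hne
        by_contra hs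
        exact hne (ext_in β α he.symm (by simpa using hs))
      · rintro hs rfl
        simp at hs
    · intro he
      exact key α β he
  · rintro ⟨α, s⟩ ⟨β, t⟩ he hs hst
    obtain rfl : s = t := hst
    cases s
    · rw [ext_in α β he hs]
    · rw [ext_out α β he hs]
  · rintro _ ⟨u, rfl⟩ s ε
    obtain ⟨α, β, hαβ, hin⟩ := Set.encard_eq_two.1 (h.in_deg u)
    have hα : Q'.tgt α = h.vert u := by
      have : α ∈ {α | Q'.tgt α = h.vert u} := by rw [hin]; simp
      exact this
    have hβ : Q'.tgt β = h.vert u := by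
      have : β ∈ {α | Q'.tgt α = h.vert u} := by rw [hin]; simp
      exact this
    have hne : side (α, false) ≠ side (β, false) := fun hs =>
      hαβ (ext_in α β (hα.trans hβ.symm) hs)
    cases ε
    · by_cases hs : side (α, false) = s
      · exact ⟨(α, false), hα, hs, rfl⟩
      · refine ⟨(β, false), hβ, ?_, rfl⟩
        revert hs hne
        cases side (α, false) <;> cases side (β, false) <;> cases s <;> simp
    · cases s
      · exact ⟨(y u, true), hy u, side_y u, rfl⟩
      · exact ⟨(x u, true), hx u, side_x u, rfl⟩

end Fringing
end BoundQuiver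

namespace BoundQuiver

/-! ### Words as sequences -/

section Words

variable {A : Type*}

/-- The word of length `m` which starts at the position `k` of a sequence. -/
def seg (a : ℤ → A) (k : ℤ) (m : ℕ) : List A := (List.range m).map fun t : ℕ => a (k + t)

@[simp] theorem length_seg (a : ℤ → A) (k : ℤ) (m : ℕ) : (seg a k m).length = m := by simp [seg]

@[simp] theorem getElem_seg (a : ℤ → A) (k : ℤ) (m : ℕ) (t : ℕ) (h : t < (seg a k m).length) :
    (seg a k m)[t] = a (k + t) := by simp [seg]

theorem eq_seg_iff {a : ℤ → A} {k : ℤ} {f : List A} :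
    f = seg a k f.length ↔ ∀ (t : ℕ) (h : t < f.length), f[t] = a (k + t) := by
  constructor
  · intro h t ht
    have : (seg a k f.length)[t]'(by simpa using ht) = a (k + t) := getElem_seg ..
    rw [← this]
    congr 1
  · intro h
    exact List.ext_getElem (by simp) fun t h1 h2 => by rw [h t h1, getElem_seg]

theorem eq_seg_of {a : ℤ → A} {k : ℤ} {m : ℕ} {f : List A} (hm : f.length = m)
    (h : ∀ (t : ℕ) (h : t < f.length), f[t] = a (k + t)) : f = seg a k m := by
  subst hm
  exact eq_seg_iff.2 h

/-- The periodic sequence given by a nonempty word. -/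
def cyc (w : List A) (hw : w ≠ []) (k : ℤ) : A :=
  w[(k % w.length).toNat]'(by
    have h0 : (0 : ℤ) < w.length := by exact_mod_cast List.length_pos_iff.2 hw
    have h1 := Int.emod_nonneg k h0.ne'
    have h2 := Int.emod_lt_of_pos k h0
    omega)

theorem cyc_natCast (w : List A) (hw : w ≠ []) (k : ℕ) (hk : k < w.length) :
    cyc w hw k = w[k] := by
  have : ((k : ℤ) % w.length).toNat = k := by
    rw [Int.emod_eq_of_lt (by omega) (by exact_mod_cast hk)]
    simp
  simp [cyc, this]

theorem cyc_congr (w : List A) (hw : w ≠ []) {k l : ℤ} (h : (w.length : ℤ) ∣ k - l) :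
    cyc w hw k = cyc w hw l := by
  have : k % w.length = l % w.length :=
    Int.emod_eq_emod_iff_emod_sub_eq_zero.2 (Int.emod_eq_zero_of_dvd h)
  simp [cyc, this]

theorem cyc_add_length (w : List A) (hw : w ≠ []) (k : ℤ) :
    cyc w hw (k + w.length) = cyc w hw k := cyc_congr w hw (by simp)

theorem eq_seg_cyc (w : List A) (hw : w ≠ []) : w = seg (cyc w hw) 0 w.length :=
  eq_seg_iff.2 fun t ht => by rw [zero_add, cyc_natCast w hw t ht]

theorem cyc_mem (w : List A) (hw : w ≠ []) (k : ℤ) : cyc w hw k ∈ w := by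
  simp [cyc]

theorem exists_cyc_eq {w : List A} (hw : w ≠ []) {x : A} (hx : x ∈ w) :
    ∃ k : ℕ, k < w.length ∧ cyc w hw k = x := by
  obtain ⟨k, hk, rfl⟩ := List.getElem_of_mem hx
  exact ⟨k, hk, cyc_natCast w hw k hk⟩

theorem length_pow (w : List (SArrow A)) (n : ℕ) : (pow w n).length = n * w.length := by
  simp [pow]

theorem getElem_pow (w : List (SArrow A)) (hw : w ≠ []) (n k : ℕ) (hk : k < (pow w n).length) :
    (pow w n)[k] = cyc w hw k := by
  induction n generalizing k with
  | zero => simp [pow] at hk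
  | succ n ih =>
    have h1 : pow w (n + 1) = w ++ pow w n := by simp [pow, List.replicate_succ]
    simp only [h1, List.getElem_append]
    split_ifs with h
    · rw [cyc_natCast w hw k h]
    · rw [ih]
      apply cyc_congr
      push Not at h
      push_cast [h]
      simp

theorem seg_infix {a : ℤ → A} {k l : ℤ} {m n : ℕ} (h1 : l ≤ k) (h2 : k + m ≤ l + n) :
    seg a k m <:+: seg a l n := by
  obtain ⟨o, rfl⟩ : ∃ o : ℕ, k = l + o := ⟨(k - l).toNat, by omega⟩
  have : seg a (l + o) m = ((seg a l n).drop o).take m := by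
    apply List.ext_getElem
    · simp
      omega
    · intro t h3 h4
      simp [add_assoc]
  rw [this]
  exact (List.take_prefix _ _).isInfix.trans (List.drop_suffix _ _).isInfix

theorem exists_eq_seg_of_infix {a : ℤ → A} {l : ℤ} {n : ℕ} {f : List A} (h : f <:+: seg a l n) :
    ∃ o : ℕ, o + f.length ≤ n ∧ f = seg a (l + o) f.length := by
  obtain ⟨s, t, hst⟩ := h
  have hl := congrArg List.length hst
  simp at hl
  refine ⟨s.length, by omega, eq_seg_iff.2 fun i hi => ?_⟩
  have h1 : (s ++ f ++ t)[s.length + i]'(by simp; omega) = f[i] := by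
    simp [hi]
  rw [← h1]
  simp only [hst, getElem_seg]
  congr 1
  push_cast
  ring

theorem pow_eq_seg (w : List (SArrow A)) (hw : w ≠ []) (n : ℕ) :
    pow w n = seg (cyc w hw) 0 (n * w.length) :=
  eq_seg_of (length_pow w n) fun t ht => by rw [getElem_pow w hw n t ht, zero_add]

theorem seg_congr_start {w : List A} (hw : w ≠ []) {k l : ℤ} (h : (w.length : ℤ) ∣ k - l) (m : ℕ) :
    seg (cyc w hw) k m = seg (cyc w hw) l m :=
  eq_seg_of (by simp) fun t ht => by
    rw [getElem_seg]
    exact cyc_congr w hw (by simpa using h)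

/-- Subwords of powers are windows of the periodic sequence, with any integer as start. Bands are
handled in this form from here on. -/
theorem mem_bandFactors_iff {w : List (SArrow A)} (hw : w ≠ []) {f : List (SArrow A)} :
    f ∈ bandFactors w ↔ ∃ k, f = seg (cyc w hw) k f.length := by
  have h0 : 0 < w.length := List.length_pos_iff.2 hw
  constructor
  · rintro ⟨n, hn⟩
    rw [pow_eq_seg w hw] at hn
    obtain ⟨o, -, ho⟩ := exists_eq_seg_of_infix hn
    exact ⟨_, ho⟩
  · rintro ⟨k, hk⟩
    have h0' : (0 : ℤ) < w.length := by exact_mod_cast h0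
    have h1 : 0 ≤ k % w.length := Int.emod_nonneg k h0'.ne'
    rw [seg_congr_start hw (l := k % w.length) (Int.dvd_self_sub_emod)] at hk
    rw [hk]
    -- Every copy of `w` has at least one letter, so this many copies reach beyond the end of a
    -- window starting in the first copy.
    refine ⟨(k % w.length).toNat + f.length, ?_⟩
    rw [pow_eq_seg w hw]
    refine seg_infix h1 ?_
    push_cast
    have : (0 : ℤ) ≤ f.length := by positivity
    rw [Int.toNat_of_nonneg h1]
    nlinarith

theorem occursAt_iff {w : List (SArrow A)} (hw : w ≠ []) {f : List (SArrow A)} {i : ℕ} :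
    OccursAt w f i ↔ i < w.length ∧ f = seg (cyc w hw) i f.length := by
  have h0 : 0 < w.length := List.length_pos_iff.2 hw
  refine and_congr_right fun hi => ⟨?_, ?_⟩
  · rintro ⟨n, t, ht⟩
    refine eq_seg_iff.2 fun j hj => ?_
    have hl := congrArg List.length ht
    simp at hl
    have h1 : (f ++ t)[j]'(by simp; omega) = f[j] := by simp [hj]
    rw [← h1]
    simp only [ht, List.getElem_drop]
    rw [getElem_pow w hw]
    push_cast
    rfl
  · intro hf
    refine ⟨i + f.length, ?_⟩
    have h1 : f = ((pow w (i + f.length)).drop i).take f.length := by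
      have h2 : i + f.length ≤ (pow w (i + f.length)).length := by
        rw [length_pow]
        nlinarith
      apply List.ext_getElem
      · simp
        omega
      · intro t h3 h4
        rw [List.getElem_take, List.getElem_drop, getElem_pow w hw, eq_seg_iff.1 hf]
        push_cast
        rfl
    have := List.take_prefix f.length ((pow w (i + f.length)).drop i)
    rwa [← h1] at this

theorem mem_routeFactors {w : List (SArrow A)} (hw : w ≠ []) {f : List (SArrow A)}
    (h : f ∈ routeFactors w) : ∃ k : ℤ, 0 ≤ k ∧ k + f.length ≤ w.length ∧
      f = seg (cyc w hw) k f.length := by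
  have h' : f <:+: w := h
  rw [eq_seg_cyc w hw] at h'
  obtain ⟨o, h1, h2⟩ := exists_eq_seg_of_infix h'
  exact ⟨o, by positivity, by omega, by simpa using h2⟩

theorem isRotated_of_cyc {w w' : List A} (hw : w ≠ []) (hw' : w' ≠ [])
    (hl : w.length = w'.length) (r : ℤ) (h : ∀ k, cyc w' hw' k = cyc w hw (k + r)) : w' ~r w := by
  have h0 : (0 : ℤ) < w.length := by exact_mod_cast List.length_pos_iff.2 hw
  have h1 := Int.emod_nonneg r h0.ne'
  have h2 := Int.emod_lt_of_pos r h0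
  refine List.IsRotated.symm ⟨(r % w.length).toNat, ?_⟩
  apply List.ext_getElem
  · simp [hl]
  · intro t h3 h4
    rw [List.getElem_rotate, ← cyc_natCast w' hw' t h4, h,
      ← cyc_natCast w hw _ (Nat.mod_lt _ (List.length_pos_iff.2 hw))]
    apply cyc_congr
    push_cast
    rw [Int.toNat_of_nonneg h1]
    have e1 : (w.length : ℤ) ∣ (t + r % w.length) - (t + r % w.length) % w.length :=
      Int.dvd_self_sub_emod
    have e2 : (w.length : ℤ) ∣ r - r % w.length := Int.dvd_self_sub_emod
    have := dvd_neg.2 (dvd_add e1 e2)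
    rwa [show -((t + r % w.length) - (t + r % w.length) % w.length + (r - r % w.length)) =
      (t + r % w.length) % w.length - (t + r) by ring] at this

@[simp] theorem length_inv (w : List (SArrow A)) : (inv w).length = w.length := by simp [inv]

@[simp] theorem inv_eq_nil {w : List (SArrow A)} : inv w = [] ↔ w = [] := by simp [inv]

theorem getElem_inv (w : List (SArrow A)) (t : ℕ) (h : t < (inv w).length) :
    (inv w)[t] = flip (w[w.length - 1 - t]'(by simp at h; omega)) := by
  simp [inv]

theorem inv_seg (a : ℤ → SArrow A) (k : ℤ) (m : ℕ) (t : ℕ) (h : t < (inv (seg a k m)).length) :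
    (inv (seg a k m))[t] = flip (a (k + m - 1 - t)) := by
  simp only [length_inv, length_seg] at h
  rw [getElem_inv, getElem_seg]
  simp only [length_seg]
  congr 2
  omega

/-- Inversion reverses positions, and the last letter of `w`, at position `-1`, becomes the letter
at position `0`. -/
theorem cyc_inv (w : List (SArrow A)) (hw : w ≠ []) (hw' : inv w ≠ []) (k : ℤ) :
    cyc (inv w) hw' k = flip (cyc w hw (-1 - k)) := by
  have h0 : (0 : ℤ) < w.length := by exact_mod_cast List.length_pos_iff.2 hw
  have h1 := Int.emod_nonneg k h0.ne'
  have h2 := Int.emod_lt_of_pos k h0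
  have e0 : (w.length : ℤ) ∣ k - k % w.length := Int.dvd_self_sub_emod
  obtain ⟨t, ht⟩ : ∃ t : ℕ, k % w.length = t := ⟨(k % w.length).toNat, by omega⟩
  rw [ht] at e0 h1 h2
  rw [cyc_congr (inv w) hw' (k := k) (l := t) (by simpa using e0),
    cyc_natCast (inv w) hw' t (by simp; omega), getElem_inv,
    ← cyc_natCast w hw _ (by omega)]
  congr 1
  apply cyc_congr
  have e1 : (((w.length - 1 - t : ℕ) : ℤ)) = w.length - 1 - t := by omega
  rw [e1, show (w.length : ℤ) - 1 - t - (-1 - k) = w.length + (k - t) by ring]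
  exact dvd_add (dvd_refl _) e0

end Words
end BoundQuiver

namespace BoundQuiver

variable {V E : Type*} {Q : BoundQuiver V E}

/-! ### Closed walks and their folds -/

/-- Closed walks of length `n`, as periodic sequences. -/
structure IsClosedWalk (Q : BoundQuiver V E) (a : ℤ → SArrow E) (n : ℤ) : Prop where
  pos : 0 < n
  per : ∀ k, a (k + n) = a k
  step : ∀ k, Q.Step (a k) (a (k + 1))

theorem IsClosedWalk.congr {a : ℤ → SArrow E} {n : ℤ} (h : Q.IsClosedWalk a n) {k l : ℤ}
    (hkl : n ∣ k - l) : a k = a l := by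
  have h1 : ∀ (c : ℕ) (k : ℤ), a (k + n * c) = a k := by
    intro c
    induction c with
    | zero => simp
    | succ c ih =>
      intro k
      rw [← ih k, ← h.per (k + n * c)]
      congr 1
      push_cast
      ring
  obtain ⟨c, hc⟩ := hkl
  obtain ⟨d, rfl | rfl⟩ := c.eq_nat_or_neg
  · rw [← h1 d l]
    congr 1
    linarith
  · rw [← h1 d k]
    congr 1
    linarith

theorem eq_zero_of_dvd_of_lt {n d : ℤ} (h : n ∣ d) (h1 : -n < d) (h2 : d < n) : d = 0 := by
  obtain ⟨c, rfl⟩ := h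
  have hn : 0 < n := by linarith
  have h3 : c < 1 := by nlinarith
  have h4 : -1 < c := by nlinarith
  have : c = 0 := by omega
  simp [this]

namespace Sides

variable (S : Q.Sides)

theorem node_succ {a : ℤ → SArrow E} {n : ℤ} (h : Q.IsClosedWalk a n) (k : ℤ) :
    S.node (a (k + 1)) = opp (S.node (flip (a k))) := S.step_iff_node.1 (h.step k)

theorem node_flip_pred {a : ℤ → SArrow E} {n : ℤ} (h : Q.IsClosedWalk a n) (k : ℤ) :
    S.node (flip (a (k - 1))) = opp (S.node (a k)) := by
  have := S.node_succ h (k - 1)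
  rw [sub_add_cancel] at this
  rw [this, opp_opp]

/-- A closed walk of length `n` which passes at most once through each vertex in each of the two
directions. -/
def Unboosted (a : ℤ → SArrow E) (n : ℤ) : Prop := ∀ i j, S.node (a i) = S.node (a j) → n ∣ i - j

/-- The walk passes along the word of length `m` at `i` and backwards along the same word, ending
at `j`. -/
structure Fold (a : ℤ → SArrow E) (i j : ℤ) (m : ℕ) : Prop where
  node_eq : S.node (a i) = opp (S.node (a j))
  -- Position `k` stands for the vertex between the letters `k - 1` and `k`; thus the letter after
  -- the vertex `i` is matched with the letter before the vertex `j`.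
  refl : ∀ t : ℤ, 0 ≤ t → t < m → a (i + t) = flip (a (j - 1 - t))

/-- Folds which cannot be extended. -/
structure MaxFold (a : ℤ → SArrow E) (i j : ℤ) (m : ℕ) : Prop extends S.Fold a i j m where
  left_ne : a (i - 1) ≠ flip (a j)
  right_ne : a (i + m) ≠ flip (a (j - 1 - m))

/-- The maximal fold at `i`, `j` is the only one. -/
structure OneFold (a : ℤ → SArrow E) (n i j : ℤ) (m : ℕ) : Prop extends S.MaxFold a i j m where
  lt : j < i
  -- One period consists of a loop from `j` to `i`, the bridge from `i` to `i + m`, a loop from `i +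
  -- m` to `j + n - m`, and the bridge back to `j + n`. The inequality says that the second loop is
  -- not empty.
  add_lt : i + 2 * m < j + n
  cover : ∀ x y, S.node (a x) = opp (S.node (a y)) → ∃ t : ℤ, 0 ≤ t ∧ t ≤ m ∧
    ((n ∣ x - (i + t) ∧ n ∣ y - (j - t)) ∨ (n ∣ x - (j - t) ∧ n ∣ y - (i + t)))

variable {S} {a : ℤ → SArrow E} {n i j : ℤ} {m : ℕ}

/-- A letter and its inverse have exchanged ends, so opposite passages at `i + t` and `j - t`
persist along the fold, up to and including its far end `t = m`. -/
theorem Fold.node_add (hc : Q.IsClosedWalk a n) (h : S.Fold a i j m) (t : ℤ) (h0 : 0 ≤ t)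
    (ht : t ≤ m) : S.node (a (i + t)) = opp (S.node (a (j - t))) := by
  obtain ⟨t, rfl⟩ := Int.eq_ofNat_of_zero_le h0
  induction t with
  | zero => simpa using h.node_eq
  | succ t ih =>
    have h1 := h.refl t (by omega) (by push_cast at ht; omega)
    push_cast
    rw [← add_assoc, S.node_succ hc, h1, flip_flip]
    congr 3
    ring

/-- The same fold seen from its backward pass, which starts at `j - m`; its mirror image ends at `i
+ m`. -/
theorem Fold.symm (hc : Q.IsClosedWalk a n) (h : S.Fold a i j m) : S.Fold a (j - m) (i + m) m where
  node_eq := by rw [h.node_add hc m (by omega) le_rfl, opp_opp]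
  refl t h0 ht := by
    have := h.refl (m - 1 - t) (by omega) (by omega)
    rw [show i + (m : ℤ) - 1 - t = i + (m - 1 - t) by ring, this, flip_flip]
    congr 1
    ring

theorem MaxFold.symm (hc : Q.IsClosedWalk a n) (h : S.MaxFold a i j m) :
    S.MaxFold a (j - m) (i + m) m where
  toFold := h.toFold.symm hc
  left_ne h' := h.right_ne (by rw [show j - 1 - (m : ℤ) = j - m - 1 by ring, h', flip_flip])
  right_ne h' := h.left_ne (by
    rw [show i - 1 = i + (m : ℤ) - 1 - m by ring, ← flip_flip (a (i + (m : ℤ) - 1 - m)), ← h']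
    congr 2
    ring)

theorem Fold.congr (hc : Q.IsClosedWalk a n) (h : S.Fold a i j m) {i' j' : ℤ} (hi : n ∣ i' - i)
    (hj : n ∣ j' - j) : S.Fold a i' j' m where
  node_eq := by rw [hc.congr hi, hc.congr hj, h.node_eq]
  refl t h0 ht := by
    rw [hc.congr (k := i' + t) (l := i + t) (by simpa using hi), h.refl t h0 ht,
      hc.congr (k := j' - 1 - t) (l := j - 1 - t) (by simpa using hj)]

theorem MaxFold.congr (hc : Q.IsClosedWalk a n) (h : S.MaxFold a i j m) {i' j' : ℤ}
    (hi : n ∣ i' - i) (hj : n ∣ j' - j) : S.MaxFold a i' j' m where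
  toFold := h.toFold.congr hc hi hj
  left_ne := by
    rw [hc.congr (k := i' - 1) (l := i - 1) (by simpa using hi), hc.congr hj]
    exact h.left_ne
  right_ne := by
    rw [hc.congr (k := i' + m) (l := i + m) (by simpa using hi),
      hc.congr (k := j' - 1 - m) (l := j - 1 - m) (by simpa using hj)]
    exact h.right_ne

/-- A closed walk is not its own inverse. -/
theorem exists_not_fold (hc : Q.IsClosedWalk a n) (S : Q.Sides) (i j : ℤ) :
    ∃ t, a (i + t) ≠ flip (a (j - 1 - t)) := by
  -- The reflection of positions fixes one position or exchanges two neighbours: a letter would be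
  -- its own inverse, or would be followed by its inverse.
  rcases Int.even_or_odd' (j - 1 - i) with ⟨t, ht | ht⟩
  · refine ⟨t, fun h => ?_⟩
    rw [show j - 1 - t = i + t by linarith] at h
    exact flip_ne _ h.symm
  · refine ⟨t, fun h => ?_⟩
    rw [show j - 1 - t = i + t + 1 by linarith] at h
    have := S.node_succ hc (i + t)
    rw [h, flip_flip] at this
    exact opp_ne _ this.symm

/-- A coincidence is a fold of length zero. By `exists_not_fold` the mirroring fails somewhere, and
by periodicity it then fails on both sides of `x`; `p` and `q` count the mirrored letters before and
after. -/
theorem exists_maxFold (hc : Q.IsClosedWalk a n) {x y : ℤ}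
    (h : S.node (a x) = opp (S.node (a y))) :
    ∃ p q : ℕ, S.MaxFold a (x - p) (y + p) (p + q) := by
  obtain ⟨t, ht⟩ := exists_not_fold hc S x y
  have key : ∀ s, n ∣ s - t → a (x + s) ≠ flip (a (y - 1 - s)) := by
    intro s hs
    rw [hc.congr (k := x + s) (l := x + t) (by simpa using hs),
      hc.congr (k := y - 1 - s) (l := y - 1 - t) (by
        rw [show y - 1 - s - (y - 1 - t) = -(s - t) by ring]
        exact hs.neg_right)]
    exact ht
  have h1 : ∃ q : ℕ, a (x + q) ≠ flip (a (y - 1 - q)) := by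
    have h0 := Int.emod_nonneg t hc.pos.ne'
    refine ⟨(t % n).toNat, key _ ?_⟩
    rw [Int.toNat_of_nonneg h0]
    rw [← neg_sub]
    exact (Int.dvd_self_sub_emod).neg_right
  have h2 : ∃ p : ℕ, a (x - 1 - p) ≠ flip (a (y + p)) := by
    have h0 := Int.emod_nonneg (-1 - t) hc.pos.ne'
    refine ⟨((-1 - t) % n).toNat, ?_⟩
    have := key (-1 - ((-1 - t) % n).toNat) (by
      rw [Int.toNat_of_nonneg h0, show -1 - (-1 - t) % n - t = (-1 - t) - (-1 - t) % n by ring]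
      exact Int.dvd_self_sub_emod)
    convert this using 2
    · ring
    · congr 1
      ring
  classical
  refine ⟨Nat.find h2, Nat.find h1, ⟨⟨?_, ?_⟩, ?_, ?_⟩⟩
  -- To reach the left end of the fold, run along it in the other direction, starting from `y`.
  · have : S.Fold a (y) (x) (Nat.find h2) := by
      refine ⟨opp_eq_comm.1 h, fun t h0 ht => ?_⟩
      have h3 := Nat.find_min h2 (m := t.toNat) (by omega)
      rw [not_not, Int.toNat_of_nonneg h0] at h3
      rw [h3, flip_flip]
    have := this.node_add hc (Nat.find h2) (by omega) le_rfl
    exact opp_eq_comm.1 this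
  · intro t h0 ht
    push_cast at ht
    by_cases h3 : t < Nat.find h2
    · have h4 := Nat.find_min h2 (m := (Nat.find h2 - 1 - t).toNat) (by omega)
      rw [not_not, Int.toNat_of_nonneg (by omega)] at h4
      convert h4 using 2
      · ring
      · congr 1
        ring
    · have h4 := Nat.find_min h1 (m := (t - Nat.find h2).toNat) (by omega)
      rw [not_not, Int.toNat_of_nonneg (by omega)] at h4
      convert h4 using 2
      · ring
      · congr 1
        ring
  · have := Nat.find_spec h2
    convert this using 2
    ring
  · have := Nat.find_spec h1
    convert this using 2
    · push_cast
      ring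
    · congr 1
      push_cast
      ring

/-- If the containing fold went on at either end, it would mirror the letters that `left_ne` and
`right_ne` declare not to be mirrored. -/
theorem MaxFold.eq_of_le (hc : Q.IsClosedWalk a n) (h : S.MaxFold a i j m) {k l o : ℤ} {m' : ℕ}
    (h' : S.Fold a k l m') (h0 : 0 ≤ o) (hm : o + m ≤ m') (hi : n ∣ i - (k + o))
    (hj : n ∣ j - (l - o)) : o = 0 ∧ m = m' := by
  have h1 : o = 0 := by
    by_contra ho
    apply h.left_ne
    rw [hc.congr hj, hc.congr (k := i - 1) (l := k + (o - 1)) (by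
      rwa [show i - 1 - (k + (o - 1)) = i - (k + o) by ring]), h'.refl (o - 1) (by omega) (by omega)]
    congr 2
    ring
  subst h1
  refine ⟨rfl, ?_⟩
  by_contra hne
  apply h.right_ne
  rw [hc.congr (k := i + m) (l := k + m) (by
      rwa [show i + (m : ℤ) - (k + m) = i - (k + 0) by ring]),
    h'.refl m (by omega) (by omega),
    hc.congr (k := j - 1 - m) (l := l - 1 - m) (by
      rwa [show j - 1 - (m : ℤ) - (l - 1 - m) = j - (l - 0) by ring])]

/-- The start of a fold fixes the node at `j`, and in an unboosted walk a node fixes the position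
modulo `n`. -/
theorem Fold.right_dvd (hu : S.Unboosted a n) (h : S.Fold a i j m) {i' j' : ℤ}
    {m' : ℕ} (h' : S.Fold a i' j' m') (hc : Q.IsClosedWalk a n) (hi : n ∣ i - i') : n ∣ j - j' := by
  apply hu
  have h1 := h.node_eq
  rw [hc.congr hi, h'.node_eq] at h1
  rw [← opp_opp (S.node (a j)), ← h1, opp_opp]

end Sides

theorem vertexSeq_head?_eq (σ : List (SArrow E)) (hσ : 0 < σ.length) :
    (Q.vertexSeq σ).head? = some (Q.tail σ[0]) := by
  cases σ with
  | nil => simp at hσ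
  | cons x σ => simp [vertexSeq]

theorem isClosedWalk_cyc {w : List (SArrow E)} (hw : w ≠ []) (h : Q.IsString (w ++ w)) :
    Q.IsClosedWalk (cyc w hw) w.length where
  pos := by exact_mod_cast List.length_pos_iff.2 hw
  per := cyc_add_length w hw
  step k := by
    have h0 : (0 : ℤ) < w.length := by exact_mod_cast List.length_pos_iff.2 hw
    have h1 := Int.emod_nonneg k h0.ne'
    have h2 := Int.emod_lt_of_pos k h0
    have e0 : (w.length : ℤ) ∣ k - k % w.length := Int.dvd_self_sub_emod
    obtain ⟨t, ht⟩ : ∃ t : ℕ, k % w.length = t := ⟨(k % w.length).toNat, by omega⟩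
    rw [ht] at e0 h1 h2
    have e1 : pow w 2 = w ++ w := by simp [pow, List.replicate_succ]
    have h3 := h.2
    rw [← e1] at h3
    have h4 := List.isChain_iff_getElem.1 h3 t (by rw [length_pow]; omega)
    rw [getElem_pow w hw, getElem_pow w hw] at h4
    rw [cyc_congr w hw e0, cyc_congr w hw (k := k + 1) (l := (t + 1 : ℕ)) (by
      push_cast
      simpa using e0)]
    exact h4

/-! ### Boosted and criss-crossed substrings as coincidences in a periodic walk -/

namespace Sides

variable (S : Q.Sides) {w : List (SArrow E)} (hw : w ≠ [])

/-- Lazy strings suffice: two passages through a vertex in the same direction are two occurrences of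
elements of one set `passages`. -/
theorem unboosted_of_forall_not_isBoosted (hc : Q.IsClosedWalk (cyc w hw) w.length)
    (h : ∀ v σ, ¬ Q.IsBoosted w v σ) : S.Unboosted (cyc w hw) w.length := by
  have h0 : (0 : ℤ) < w.length := hc.pos
  intro i j hij
  have hv : Q.tail (cyc w hw i) ∈ S.inner := by
    have := S.tail_mem_inner_of_step (hc.step (i - 1))
    rwa [sub_add_cancel] at this
  obtain ⟨α₁, α₂, β₁, β₂, hr, hν⟩ := S.exists_relationsAt (ν := opp (S.node (cyc w hw i))) hv
  by_contra hne
  have occ : ∀ k : ℤ, OccursAt w [cyc w hw (k - 1), cyc w hw k] ((k - 1) % w.length).toNat := by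
    intro k
    have h1 := Int.emod_nonneg (k - 1) h0.ne'
    have h2 := Int.emod_lt_of_pos (k - 1) h0
    rw [occursAt_iff hw]
    refine ⟨by omega, ?_⟩
    rw [Int.toNat_of_nonneg h1, ← seg_congr_start hw (k := k - 1) Int.dvd_self_sub_emod]
    simp [seg, List.range_succ]
  have pass : ∀ k : ℤ, S.node (cyc w hw k) = S.node (cyc w hw i) →
      (cyc w hw (k - 1), cyc w hw k) ∈ passages α₁ α₂ β₁ β₂ := by
    intro k hk
    rw [S.mem_passages_iff hr, hν, opp_opp]
    exact ⟨by rw [S.node_flip_pred hc, hk], hk⟩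
  refine h _ [] (Or.inr ⟨rfl, α₁, α₂, β₁, β₂, hr, _, pass i rfl, _, pass j hij.symm, _, _, ?_,
    occ i, occ j⟩)
  intro he
  have h1 := Int.emod_nonneg (i - 1) h0.ne'
  have h2 := Int.emod_nonneg (j - 1) h0.ne'
  have h3 : (i - 1) % w.length = (j - 1) % w.length := by omega
  have h4 := Int.dvd_of_emod_eq_zero (Int.emod_eq_emod_iff_emod_sub_eq_zero.1 h3)
  exact hne (by simpa using h4)

theorem not_isBoosted (h : S.Unboosted (cyc w hw) w.length) (v : V)
    (σ : List (SArrow E)) : ¬ Q.IsBoosted w v σ := by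
  have key : ∀ i j : ℕ, i < w.length → j < w.length → ∀ d : ℤ,
      S.node (cyc w hw (i + d)) = S.node (cyc w hw (j + d)) → i = j := by
    intro i j hi hj d he
    have := eq_zero_of_dvd_of_lt (h _ _ he) (by omega) (by omega)
    omega
  rintro (⟨h1, -, i, j, hij, hi, hj⟩ | ⟨-, α₁, α₂, β₁, β₂, hr, s, hs, t, ht, i, j, hij, hi, hj⟩)
  · rw [occursAt_iff hw] at hi hj
    have h0 := List.length_pos_iff.2 h1
    have e1 := eq_seg_iff.1 hi.2 0 h0
    have e2 := eq_seg_iff.1 hj.2 0 h0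
    exact hij (key i j hi.1 hj.1 0 (by simpa using congrArg S.node (e1.symm.trans e2)))
  · rw [occursAt_iff hw] at hi hj
    have e1 := eq_seg_iff.1 hi.2 1 (by simp)
    have e2 := eq_seg_iff.1 hj.2 1 (by simp)
    rw [S.mem_passages_iff hr] at hs ht
    refine hij (key i j hi.1 hj.1 1 ?_)
    have e3 := hs.2.trans ht.2.symm
    simp only [List.getElem_cons_succ, List.getElem_cons_zero] at e1 e2
    rw [e1, e2] at e3
    exact_mod_cast e3

/-- An occurrence of `σ` at `k` and one of its inverse at `l` form a fold with `i = k` and `j = l +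
σ.length`. For a lazy string only the opposite passages remain, at the second letters of two-letter
words. -/
theorem isCrissCrossed_iff (hc : Q.IsClosedWalk (cyc w hw) w.length) (v : V)
    (σ : List (SArrow E)) : Q.IsCrissCrossed w v σ ↔ ∃ i j : ℤ, Q.tail (cyc w hw i) = v ∧
      S.Fold (cyc w hw) i j σ.length ∧ σ = seg (cyc w hw) i σ.length := by
  constructor
  · rintro (⟨h1, h2, h3, h4⟩ | ⟨rfl, α₁, α₂, β₁, β₂, hr, ⟨s, hs, hs'⟩, ⟨t, ht, ht'⟩⟩)
    · rw [mem_bandFactors_iff hw] at h3 h4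
      obtain ⟨k, hk⟩ := h3
      obtain ⟨l, hl⟩ := h4
      have h0 := List.length_pos_iff.2 h1
      have key : ∀ t : ℤ, 0 ≤ t → t < σ.length →
          cyc w hw (k + t) = flip (cyc w hw (l + σ.length - 1 - t)) := by
        intro t h5 h6
        obtain ⟨t, rfl⟩ := Int.eq_ofNat_of_zero_le h5
        have e1 := eq_seg_iff.1 hk t (by omega)
        have e2 := eq_seg_iff.1 hl (σ.length - 1 - t) (by simp; omega)
        rw [← e1, show l + σ.length - 1 - (t : ℤ) = l + (σ.length - 1 - t : ℕ) by omega, ← e2,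
          getElem_inv, flip_flip]
        congr 1
        omega
      have e1 := eq_seg_iff.1 hk 0 h0
      refine ⟨k, l + σ.length, ?_, ⟨?_, key⟩, hk⟩
      · rw [vertexSeq_head?_eq σ h0, e1] at h2
        simpa using h2
      · have := key 0 le_rfl (by omega)
        rw [add_zero, sub_zero] at this
        rw [this, S.node_flip_pred hc]
    · rw [mem_bandFactors_iff hw] at hs' ht'
      obtain ⟨k, hk⟩ := hs'
      obtain ⟨l, hl⟩ := ht'
      have e1 := eq_seg_iff.1 hk 1 (by simp)
      have e2 := eq_seg_iff.1 hl 1 (by simp)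
      simp only [List.getElem_cons_succ, List.getElem_cons_zero] at e1 e2
      rw [S.mem_passages_iff hr] at hs
      rw [S.mem_passages_iff hr.symm] at ht
      obtain ⟨h1, h2, h3, h4⟩ := S.relationsAt_node hr
      refine ⟨k + 1, l + 1, ?_, ⟨?_, ?_⟩, ?_⟩
      · rw [← h4]
        have := congrArg Prod.fst hs.2
        rw [e1] at this
        simpa [opp] using this
      · have e3 := hs.2
        have e4 := ht.2
        rw [h3, opp_opp] at e4
        rw [← e4, e1, e2] at e3
        exact_mod_cast e3
      · intro t h5 h6
        simp at h6
        omega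
      · simp [seg]
  · rintro ⟨i, j, rfl, hf, hσ⟩
    by_cases h1 : σ = []
    · subst h1
      refine Or.inr ⟨rfl, ?_⟩
      have hv : Q.tail (cyc w hw i) ∈ S.inner := by
        have := S.tail_mem_inner_of_step (hc.step (i - 1))
        rwa [sub_add_cancel] at this
      obtain ⟨α₁, α₂, β₁, β₂, hr, hν⟩ := S.exists_relationsAt (ν := opp (S.node (cyc w hw i))) hv
      have occ : ∀ k : ℤ, [cyc w hw (k - 1), cyc w hw k] ∈ bandFactors w := by
        intro k
        rw [mem_bandFactors_iff hw]
        exact ⟨k - 1, by simp [seg, List.range_succ]⟩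
      refine ⟨α₁, α₂, β₁, β₂, hr, ⟨(cyc w hw (i - 1), cyc w hw i), ?_, occ i⟩,
        ⟨(cyc w hw (j - 1), cyc w hw j), ?_, occ j⟩⟩
      · rw [S.mem_passages_iff hr, hν, opp_opp]
        exact ⟨by rw [S.node_flip_pred hc], rfl⟩
      · rw [S.mem_passages_iff hr.symm, (S.relationsAt_node hr).2.2.1, hν, opp_opp, hf.node_eq,
          opp_opp]
        exact ⟨by rw [S.node_flip_pred hc], rfl⟩
    · have h0 := List.length_pos_iff.2 h1
      refine Or.inl ⟨h1, ?_, (mem_bandFactors_iff hw).2 ⟨i, hσ⟩,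
        (mem_bandFactors_iff hw).2 ⟨j - σ.length, ?_⟩⟩
      · rw [vertexSeq_head?_eq σ h0, eq_seg_iff.1 hσ 0 h0]
        simp
      · rw [eq_seg_iff]
        intro t ht
        simp at ht
        rw [getElem_inv, eq_seg_iff.1 hσ, hf.refl _ (by omega) (by omega), flip_flip]
        congr 1
        omega

/-- A larger criss-crossed string is again a fold. As the walk is unboosted, the shorter string sits
in it at the positions of the given fold, and `MaxFold.eq_of_le` applies. -/
theorem isMaxCrissCrossed_of_maxFold (hc : Q.IsClosedWalk (cyc w hw) w.length)
    (hu : S.Unboosted (cyc w hw) w.length) {i j : ℤ} {m : ℕ} (h : S.MaxFold (cyc w hw) i j m) :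
    Q.IsMaxCrissCrossed w (Q.tail (cyc w hw i)) (seg (cyc w hw) i m) := by
  refine ⟨(S.isCrissCrossed_iff hw hc _ _).2 ⟨i, j, rfl, by simpa using h.toFold, by simp⟩, ?_⟩
  intro u τ hτ hsub
  obtain ⟨k, l, rfl, hf, hk⟩ := (S.isCrissCrossed_iff hw hc _ _).1 hτ
  have fin : ∀ i j o : ℤ, S.MaxFold (cyc w hw) i j m → 0 ≤ o → o + m ≤ τ.length →
      (w.length : ℤ) ∣ i - (k + o) → o = 0 ∧ m = τ.length ∧ (w.length : ℤ) ∣ i - k := by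
    intro i j o h h0 ho hi
    have hf' : S.Fold (cyc w hw) (k + o) (l - o) 0 :=
      ⟨hf.node_add hc o h0 (by omega), fun t h1 h2 => by simp at h2; omega⟩
    obtain ⟨h1, h2⟩ := h.eq_of_le hc hf h0 ho hi (h.right_dvd hu hf' hc hi)
    refine ⟨h1, h2, ?_⟩
    simpa [h1] using hi
  rcases hsub with ⟨h1, h2⟩ | ⟨h1, h2⟩
  · have hm : m = 0 := by simpa using congrArg List.length h1
    subst hm
    have h3 : ∃ o : ℤ, 0 ≤ o ∧ o ≤ τ.length ∧ Q.tail (cyc w hw i) = Q.tail (cyc w hw (k + o)) := by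
      rcases List.mem_cons.1 h2 with h2 | h2
      · exact ⟨0, le_rfl, by omega, by simpa using h2⟩
      · obtain ⟨x, hx, hx'⟩ := List.mem_map.1 h2
        obtain ⟨t, ht, rfl⟩ := List.getElem_of_mem hx
        refine ⟨t + 1, by omega, by omega, ?_⟩
        rw [← hx', eq_seg_iff.1 hk, ← add_assoc]
        exact ((S.step_iff _ _).1 (hc.step _)).1
    obtain ⟨o, h4, h5, h6⟩ := h3
    rcases eq_or_eq_opp (μ := S.node (cyc w hw i)) (ν := S.node (cyc w hw (k + o))) h6 with h7 | h7
    · obtain ⟨-, h8, h9⟩ := fin i j o h h4 (by simpa using h5) (hu _ _ h7)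
      have : τ = [] := List.length_eq_zero_iff.1 h8.symm
      subst this
      exact ⟨by rw [cyc_congr w hw h9], by simp [seg]⟩
    -- Here `τ` passes the vertex of the lazy string in the other direction, so the roles of `i` and
    -- `j` are exchanged.
    · have h' : S.MaxFold (cyc w hw) j i 0 := by simpa using h.symm hc
      have h9 : S.node (cyc w hw j) = S.node (cyc w hw (k + o)) := by
        rw [h'.node_eq, h7, opp_opp]
      obtain ⟨h10, h8, -⟩ := fin j i o h' h4 (by simpa using h5) (hu _ _ h9)
      have : τ = [] := List.length_eq_zero_iff.1 h8.symm
      subst this h10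
      exact ⟨by rw [h6, add_zero], by simp [seg]⟩
  · rw [hk] at h2
    obtain ⟨o, h3, h4⟩ := exists_eq_seg_of_infix h2
    simp only [length_seg] at h3 h4
    have hm : 0 < m := by
      rcases Nat.eq_zero_or_pos m with rfl | h5
      · simp [seg] at h1
      · exact h5
    have h5 := eq_seg_iff.1 (show seg (cyc w hw) i m = seg (cyc w hw) (k + o) (seg (cyc w hw) i m).length
      by simpa using h4) 0 (by simpa using hm)
    obtain ⟨rfl', h8, h9⟩ := fin i j o h (by omega) (by omega) (hu _ _ (by
      simpa using congrArg S.node h5))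
    refine ⟨by rw [cyc_congr w hw h9], ?_⟩
    rw [hk, ← h8, seg_congr_start hw h9]

end Sides
end BoundQuiver

namespace BoundQuiver

variable {V E : Type*} {Q : BoundQuiver V E}

/-! ### Self-compatibility -/

/-- A subword of the inverse is read backwards in the sequence, with all letters flipped. The
predicate `dom` keeps the positions inside the word in the case of routes; for bands it is trivial.
-/
theorem exists_occurrence {a : ℤ → SArrow E} {dom : ℤ → Prop} {P : Set (List (SArrow E))}
    (hP : ∀ f ∈ P, ∃ k, f = seg a k f.length ∧ ∀ t : ℤ, 0 ≤ t → t < f.length → dom (k + t))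
    {x y : SArrow E} {σ : List (SArrow E)}
    (h : x :: σ ++ [y] ∈ P ∨ inv (x :: σ ++ [y]) ∈ P) :
    ∃ k : ℤ, (∀ t : ℤ, 0 ≤ t → t < σ.length + 2 → dom (k - 1 + t)) ∧
      ((a (k - 1) = x ∧ a (k + σ.length) = y ∧
          ∀ (t : ℕ) (ht : t < σ.length), a (k + t) = σ[t]) ∨
        (a (k - 1) = flip y ∧ a (k + σ.length) = flip x ∧
          ∀ (t : ℕ) (ht : t < σ.length), a (k + σ.length - 1 - t) = flip σ[t])) := by
  rcases h with h | h
  · obtain ⟨k, hk, hd⟩ := hP _ h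
    refine ⟨k + 1, ?_, Or.inl ⟨?_, ?_, ?_⟩⟩
    · intro t h0 ht
      have := hd t h0 (by simp; omega)
      simpa using this
    · have := eq_seg_iff.1 hk 0 (by simp)
      simpa using this.symm
    · have := eq_seg_iff.1 hk (σ.length + 1) (by simp)
      simp at this
      rw [this]
      congr 1
      ring
    · intro t ht
      have := eq_seg_iff.1 hk (t + 1) (by simp; omega)
      simp [ht] at this
      rw [this]
      congr 1
      ring
  · obtain ⟨k, hk, hd⟩ := hP _ h
    refine ⟨k + 1, ?_, Or.inr ⟨?_, ?_, ?_⟩⟩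
    · intro t h0 ht
      have := hd t h0 (by simp; omega)
      simpa using this
    · have := eq_seg_iff.1 hk 0 (by simp)
      rw [getElem_inv] at this
      simpa using this.symm
    · have := eq_seg_iff.1 hk (σ.length + 1) (by simp)
      rw [getElem_inv] at this
      simp at this
      rw [this]
      congr 1
      ring
    · intro t ht
      have := eq_seg_iff.1 hk (σ.length - t) (by simp; omega)
      rw [getElem_inv] at this
      have e : (x :: σ ++ [y]).length - 1 - (σ.length - t) = t + 1 := by simp; omega
      simp only [e] at this
      simp [ht] at this
      rw [this]
      congr 1
      omega

/-- Top and bottom occurrences that are read in the same direction pass through one node after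
letters of different sign. Read in opposite directions, they form a fold at both ends of which the
passes part. For lazy `σ` the direction of reading carries no information, and the nodes decide
between the alternatives. -/
theorem exists_of_kiss (S : Q.Sides) {a : ℤ → SArrow E} {dom : ℤ → Prop}
    {P : Set (List (SArrow E))}
    (hP : ∀ f ∈ P, ∃ k, f = seg a k f.length ∧ ∀ t : ℤ, 0 ≤ t → t < f.length → dom (k + t))
    (hs : ∀ k, dom k → dom (k + 1) → Q.Step (a k) (a (k + 1))) (h : Q.Kiss P P) :
    ∃ (i j : ℤ) (m : ℕ), (∀ t : ℤ, 0 ≤ t → t < m + 2 → dom (i - 1 + t)) ∧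
      ((dom (j - 1) ∧ dom j ∧ S.node (a i) = S.node (a j) ∧ (a (i - 1)).2 = false ∧
          (a (j - 1)).2 = true) ∨
        (S.Fold a i j m ∧ (∀ t : ℤ, 0 ≤ t → t < m + 2 → dom (j - t)) ∧
          (a (i - 1)).2 = false ∧ (a (i + m)).2 = true ∧ (a j).2 = false ∧
          (a (j - 1 - m)).2 = true)) := by
  have h' : ∃ v σ, Q.IsTop P v σ ∧ Q.IsBottom P v σ := by
    obtain ⟨v, σ, h | h⟩ := h
    · exact ⟨v, σ, h⟩
    · exact ⟨v, σ, h⟩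
  obtain ⟨v, σ, ⟨x, y, hx, hx2, hy2, hxy⟩, ⟨x', y', hx', hx2', hy2', hxy'⟩⟩ := h'
  obtain ⟨k, hk, hka⟩ := exists_occurrence hP hxy
  obtain ⟨l, hl, hla⟩ := exists_occurrence hP hxy'
  have tl : ∀ k, (∀ t : ℤ, 0 ≤ t → t < σ.length + 2 → dom (k - 1 + t)) →
      Q.tail (a k) = Q.head (a (k - 1)) ∧ Q.tail (a (k + σ.length)) = Q.head (a (k + σ.length - 1)) ∧
      S.node (a k) = opp (S.node (flip (a (k - 1)))) ∧
      S.node (a (k + σ.length)) = opp (S.node (flip (a (k + σ.length - 1)))) := by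
    intro k hk
    have h1 := hs (k - 1) (by simpa using hk 0 le_rfl (by omega)) (hk 1 (by omega) (by omega))
    have h2 := hs (k + σ.length - 1) (by
      have := hk σ.length (by omega) (by omega)
      rwa [show k - 1 + (σ.length : ℤ) = k + σ.length - 1 by ring] at this) (by
      have := hk (σ.length + 1) (by omega) (by omega)
      rwa [show k - 1 + ((σ.length : ℤ) + 1) = k + σ.length - 1 + 1 by ring] at this)
    rw [sub_add_cancel] at h1 h2
    exact ⟨((S.step_iff _ _).1 h1).1.symm, ((S.step_iff _ _).1 h2).1.symm, S.step_iff_node.1 h1,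
      S.step_iff_node.1 h2⟩
  have hk' := tl k hk
  have hl' := tl l hl
  have hdl : ∀ t : ℤ, 0 ≤ t → t < σ.length + 2 → dom (l + σ.length - t) := by
    intro t h0 ht
    have := hl (σ.length + 1 - t) (by omega) (by omega)
    rwa [show l - 1 + ((σ.length : ℤ) + 1 - t) = l + σ.length - t by ring] at this
  have hd1 : dom (l - 1) := by simpa using hl 0 le_rfl (by omega)
  have hd2 : dom l := by simpa using hl 1 (by omega) (by omega)
  have neg : ∀ z : SArrow E, z.2 = false → (flip z).2 = true := fun z hz => by simp [hz]
  have neg' : ∀ z : SArrow E, z.2 = true → (flip z).2 = false := fun z hz => by simp [hz]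
  rcases hka with ⟨k1, k2, k3⟩ | ⟨k1, k2, k3⟩ <;> rcases hla with ⟨l1, l2, l3⟩ | ⟨l1, l2, l3⟩
  · by_cases h0 : 0 < σ.length
    · refine ⟨k, l, σ.length, hk, Or.inl ⟨hd1, hd2, ?_, by rw [k1, hx2], by rw [l1, hx2']⟩⟩
      have e1 := k3 0 h0
      have e2 := l3 0 h0
      simp only [Nat.cast_zero, add_zero] at e1 e2
      rw [e1, e2]
    · have h1 : σ.length = 0 := by omega
      simp only [h1, Nat.cast_zero, add_zero] at *
      rcases eq_or_eq_opp (μ := S.node (a k)) (ν := S.node (a l))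
        (by simp [hk'.1, hl'.1, k1, l1, hx, hx']) with h2 | h2
      · exact ⟨k, l, 0, by simpa using hk, Or.inl ⟨hd1, hd2, h2, by rw [k1, hx2], by rw [l1, hx2']⟩⟩
      · refine ⟨k, l, 0, by simpa using hk, Or.inr ⟨⟨h2, fun t h3 h4 => by simp at h4; omega⟩,
          by simpa using hdl, by rw [k1, hx2], by simp [k2, hy2], by rw [l2, hy2'],
          by simp [l1, hx2']⟩⟩
  · have refl : ∀ t : ℤ, 0 ≤ t → t < σ.length → a (k + t) = flip (a (l + σ.length - 1 - t)) := by
      intro t h0 ht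
      obtain ⟨t, rfl⟩ := Int.eq_ofNat_of_zero_le h0
      rw [k3 t (by omega), l3 t (by omega), flip_flip]
    rcases eq_or_eq_opp (μ := S.node (a k)) (ν := S.node (a (l + σ.length)))
        (by simp [hk'.1, k1, hx, l2, hx']) with h2 | h2
    · by_cases h0 : 0 < σ.length
      · have := refl 0 le_rfl (by omega)
        rw [add_zero, sub_zero] at this
        rw [this, hl'.2.2.2] at h2
        exact absurd h2.symm (opp_ne _)
      · have h1 : σ.length = 0 := by omega
        simp only [h1, Nat.cast_zero, add_zero] at *
        exact ⟨k, l, 0, by simpa using hk,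
          Or.inl ⟨hd1, hd2, h2, by rw [k1, hx2], by rw [l1, neg _ hy2']⟩⟩
    · refine ⟨k, l + σ.length, σ.length, hk, Or.inr ⟨⟨h2, refl⟩, hdl, by rw [k1, hx2],
        by rw [k2, hy2], by rw [l2, neg' _ hx2'], ?_⟩⟩
      rw [show l + (σ.length : ℤ) - 1 - σ.length = l - 1 by ring, l1, neg _ hy2']
  · have refl : ∀ t : ℤ, 0 ≤ t → t < σ.length → a (k + t) = flip (a (l + σ.length - 1 - t)) := by
      intro t h0 ht
      obtain ⟨t, rfl⟩ := Int.eq_ofNat_of_zero_le h0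
      have e1 := k3 (σ.length - 1 - t) (by omega)
      have e2 := l3 (σ.length - 1 - t) (by omega)
      rw [← e2] at e1
      convert e1 using 2
      · omega
      · congr 1
        omega
    by_cases h0 : 0 < σ.length
    · have h2 : S.node (a k) = opp (S.node (a (l + σ.length))) := by
        have := refl 0 le_rfl (by omega)
        rw [add_zero, sub_zero] at this
        rw [this, hl'.2.2.2, opp_opp]
      refine ⟨k, l + σ.length, σ.length, hk, Or.inr ⟨⟨h2, refl⟩, hdl, by rw [k1, neg' _ hy2],
        by rw [k2, neg _ hx2], by rw [l2, hy2'], ?_⟩⟩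
      rw [show l + (σ.length : ℤ) - 1 - σ.length = l - 1 by ring, l1, hx2']
    · have h1 : σ.length = 0 := by omega
      simp only [h1, Nat.cast_zero, add_zero] at *
      rcases eq_or_eq_opp (μ := S.node (a k)) (ν := S.node (a l))
        (by simp [k2, hl'.1, l1, hx, hx']) with h2 | h2
      · exact ⟨k, l, 0, by simpa using hk,
          Or.inl ⟨hd1, hd2, h2, by rw [k1, neg' _ hy2], by rw [l1, hx2']⟩⟩
      · refine ⟨k, l, 0, by simpa using hk, Or.inr ⟨⟨h2, fun t h3 h4 => by simp at h4; omega⟩,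
          by simpa using hdl, by rw [k1, neg' _ hy2], by simp [k2, hx2], by rw [l2, hy2'],
          by simp [l1, hx2']⟩⟩
  · by_cases h0 : 0 < σ.length
    · refine ⟨k, l, σ.length, hk,
        Or.inl ⟨hd1, hd2, ?_, by rw [k1, neg' _ hy2], by rw [l1, neg _ hy2']⟩⟩
      have e1 := k3 (σ.length - 1) (by omega)
      have e2 := l3 (σ.length - 1) (by omega)
      rw [← e2] at e1
      have e3 : ((σ.length - 1 : ℕ) : ℤ) = σ.length - 1 := by omega
      rw [e3] at e1
      ring_nf at e1
      rw [e1]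
    · have h1 : σ.length = 0 := by omega
      simp only [h1, Nat.cast_zero, add_zero] at *
      rcases eq_or_eq_opp (μ := S.node (a k)) (ν := S.node (a l))
        (by simp [k2, l2, hx, hx']) with h2 | h2
      · exact ⟨k, l, 0, by simpa using hk,
          Or.inl ⟨hd1, hd2, h2, by rw [k1, neg' _ hy2], by rw [l1, neg _ hy2']⟩⟩
      · refine ⟨k, l, 0, by simpa using hk, Or.inr ⟨⟨h2, fun t h3 h4 => by simp at h4; omega⟩,
          by simpa using hdl, by rw [k1, neg' _ hy2], by simp [k2, hx2],
          by rw [l2, neg' _ hx2'], by simp [l1, hy2']⟩⟩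

namespace Sides

variable (S : Q.Sides)

/-- The maximal folds of the walk do not give rise to kisses. -/
def Balanced (a : ℤ → SArrow E) : Prop :=
  ∀ (i j : ℤ) (m : ℕ), S.MaxFold a i j m → (a (i - 1)).2 = (a (i + m)).2

variable {S} {a : ℤ → SArrow E} {n i j : ℤ} {m : ℕ}

/-- A node has at most one letter of each sign, so the two distinct letters `x` and `flip y` have
opposite signs. -/
theorem snd_eq_of_node_eq {x y : SArrow E} (h : S.node x = S.node (flip y)) (hne : x ≠ flip y) :
    x.2 = y.2 := by
  by_contra h'
  apply hne
  apply S.node_ext h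
  revert h'
  simp only [flip_snd]
  cases x.2 <;> cases y.2 <;> simp

/-- At each end of a maximal fold the two passes diverge with a common sign, so that one sign per
end tells whether the fold is a kiss; this is why `Balanced` looks at a single pass. -/
theorem MaxFold.left_snd (hc : Q.IsClosedWalk a n) (h : S.MaxFold a i j m) :
    (a (i - 1)).2 = (a j).2 := by
  refine (snd_eq_of_node_eq (S := S) ?_ fun h' => h.left_ne ?_).symm
  · rw [S.node_flip_pred hc, h.node_eq, opp_opp]
  · rw [h', flip_flip]

theorem MaxFold.right_snd (hc : Q.IsClosedWalk a n) (h : S.MaxFold a i j m) :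
    (a (i + m)).2 = (a (j - 1 - m)).2 := by
  refine snd_eq_of_node_eq (S := S) ?_ h.right_ne
  rw [h.node_add hc m (by omega) le_rfl, show j - 1 - (m : ℤ) = j - m - 1 by ring,
    S.node_flip_pred hc]

/-- If the signs at the ends of a maximal fold differ, the forward pass and the inverted backward
pass, each with its two neighbours, are a top and a bottom occurrence of the same string. -/
theorem balanced_of_selfCompatible {w : List (SArrow E)} (hw : w ≠ [])
    (hc : Q.IsClosedWalk (cyc w hw) w.length) (h : Q.SelfCompatible (bandFactors w)) :
    S.Balanced (cyc w hw) := by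
  intro i j m hf
  by_contra hne
  apply h
  have hl := hf.left_snd hc
  have hr := hf.right_snd hc
  have f1 : cyc w hw (i - 1) :: seg (cyc w hw) i m ++ [cyc w hw (i + m)] ∈ bandFactors w := by
    rw [mem_bandFactors_iff hw]
    refine ⟨i - 1, eq_seg_iff.2 fun t ht => ?_⟩
    rcases t with _ | t
    · simp
    · simp only [List.cons_append, List.getElem_cons_succ, List.getElem_append]
      split_ifs with h1
      · rw [getElem_seg]
        congr 1
        push_cast
        ring
      · simp at h1 ht
        simp
        congr 1
        omega
  have f2 : inv (flip (cyc w hw j) :: seg (cyc w hw) i m ++ [flip (cyc w hw (j - 1 - m))]) ∈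
      bandFactors w := by
    rw [mem_bandFactors_iff hw]
    refine ⟨j - 1 - m, eq_seg_iff.2 fun t ht => ?_⟩
    simp at ht
    rw [getElem_inv]
    rcases Nat.eq_zero_or_pos t with rfl | h0
    · simp [flip_flip]
    · rcases Nat.lt_or_ge m t with h1 | h1
      · have e1 : (flip (cyc w hw j) :: seg (cyc w hw) i m ++
          [flip (cyc w hw (j - 1 - m))]).length - 1 - t = 0 := by simp; omega
        simp only [e1]
        simp only [List.cons_append, List.getElem_cons_zero, flip_flip]
        congr 1
        omega
      · have e1 : (flip (cyc w hw j) :: seg (cyc w hw) i m ++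
          [flip (cyc w hw (j - 1 - m))]).length - 1 - t = (m - t) + 1 := by simp; omega
        simp only [e1]
        rw [List.getElem_append_left (by simp; omega)]
        rw [List.getElem_cons_succ, getElem_seg, hf.refl _ (by omega) (by omega), flip_flip]
        congr 1
        omega
  have hv : Q.head (cyc w hw (i - 1)) = Q.tail (cyc w hw i) := by
    have := ((S.step_iff _ _).1 (hc.step (i - 1))).1
    rwa [sub_add_cancel] at this
  have hv' : Q.head (flip (cyc w hw j)) = Q.tail (cyc w hw i) := by
    rw [head_flip]
    exact (congrArg Prod.fst hf.node_eq).symm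
  refine ⟨Q.tail (cyc w hw i), seg (cyc w hw) i m, ?_⟩
  cases h1 : (cyc w hw (i - 1)).2 <;> cases h2 : (cyc w hw (i + m)).2
  · simp [h1, h2] at hne
  · exact Or.inl ⟨⟨_, _, hv, h1, h2, Or.inl f1⟩,
      ⟨_, _, hv', by simp [← hl, h1], by simp [← hr, h2], Or.inr f2⟩⟩
  · exact Or.inl ⟨⟨_, _, hv', by simp [← hl, h1], by simp [← hr, h2], Or.inr f2⟩,
      ⟨_, _, hv, h1, h2, Or.inl f1⟩⟩
  · simp [h1, h2] at hne

/-- In an unboosted walk equal nodes have equal predecessors, so a kiss can only be a fold; its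
diverging ends make it maximal, and its signs contradict balance. -/
theorem selfCompatible_of_balanced {w : List (SArrow E)} (hw : w ≠ [])
    (hc : Q.IsClosedWalk (cyc w hw) w.length) (hu : S.Unboosted (cyc w hw) w.length)
    (h : S.Balanced (cyc w hw)) : Q.SelfCompatible (bandFactors w) := by
  intro hk
  obtain ⟨i, j, m, -, ⟨-, -, h1, h2, h3⟩ | ⟨hf, -, h1, h2, h3, h4⟩⟩ :=
    exists_of_kiss S (a := cyc w hw) (dom := fun _ => True) (fun f hf => by
      obtain ⟨k, hk⟩ := (mem_bandFactors_iff hw).1 hf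
      exact ⟨k, hk, fun _ _ _ => trivial⟩) (fun k _ _ => hc.step k) hk
  · have := hu _ _ h1
    rw [hc.congr (k := i - 1) (l := j - 1) (by simpa using this), h3] at h2
    simp at h2
  · have hm : S.MaxFold (cyc w hw) i j m := by
      refine ⟨hf, fun h' => ?_, fun h' => ?_⟩
      · rw [h'] at h1
        simp [h3] at h1
      · rw [h'] at h2
        simp [h4] at h2
    have := h _ _ _ hm
    rw [h1, h2] at this
    simp at this

end Sides
end BoundQuiver

namespace BoundQuiver

variable {V E : Type*} {Q : BoundQuiver V E}

/-! ### Elementary bands as closed walks -/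

namespace Sides

variable {S : Q.Sides}

/-- In a proper power the first letter recurs after `u.length` positions, before one period is over.
-/
theorem not_eq_pow_of_unboosted {w : List (SArrow E)} (hw : w ≠ [])
    (hu : S.Unboosted (cyc w hw) w.length) (u : List (SArrow E)) (k : ℕ) (hk : 2 ≤ k) :
    w ≠ pow u k := by
  intro h
  have hl := congrArg List.length h
  rw [length_pow] at hl
  have h0 : 0 < w.length := List.length_pos_iff.2 hw
  have hu0 : 0 < u.length := by
    rcases Nat.eq_zero_or_pos u.length with h1 | h1
    · simp [h1] at hl
      exact absurd hl hw
    · exact h1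
  have hu' : u ≠ [] := List.length_pos_iff.1 hu0
  have hlt : u.length < w.length := by nlinarith
  have e1 := cyc_natCast w hw 0 h0
  have e2 := cyc_natCast w hw u.length hlt
  have e3 := getElem_pow u hu' k 0 (by rw [← h]; exact h0)
  have e4 := getElem_pow u hu' k u.length (by rw [← h]; exact hlt)
  have e5 : cyc w hw ((0 : ℕ) : ℤ) = cyc w hw u.length := by
    rw [e1, e2]
    simp only [h]
    rw [e3, e4]
    exact cyc_congr u hu' (by simp)
  have := eq_zero_of_dvd_of_lt (hu _ _ (congrArg S.node e5)) (by push_cast; omega) (by push_cast; omega)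
  push_cast at this
  omega

theorem isBand_of_unboosted {w : List (SArrow E)} (hw : w ≠ []) (h : Q.IsString (w ++ w))
    (hu : S.Unboosted (cyc w hw) w.length) : Q.IsBand w :=
  ⟨⟨hw, h.2.prefix (List.prefix_append w w)⟩, h, fun u k hk => not_eq_pow_of_unboosted hw hu u k hk⟩

/-- The closed walks of the elementary bands. -/
structure ElementaryWalk (S : Q.Sides) (a : ℤ → SArrow E) (n : ℤ) : Prop extends
    Q.IsClosedWalk a n where
  unboosted : S.Unboosted a n
  balanced : S.Balanced a
  simple_or_oneFold : (∀ x y, S.node (a x) ≠ opp (S.node (a y))) ∨ ∃ i j m, S.OneFold a n i j m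

/-- The first letter of a nonempty string, or the node of a lazy one, fixes the position modulo the
length. Equal strings thus give the same fold, and inverse strings give its other pass. -/
theorem MaxFold.congr_of_isMaxCrissCrossed_unique {w : List (SArrow E)} (hw : w ≠ [])
    (hc : Q.IsClosedWalk (cyc w hw) w.length) (hu : S.Unboosted (cyc w hw) w.length)
    (hm : ∀ v σ u τ, Q.IsMaxCrissCrossed w v σ → Q.IsMaxCrissCrossed w u τ →
      (u = v ∧ τ = σ) ∨ (σ ≠ [] ∧ τ = inv σ)) {i j k l : ℤ} {m m' : ℕ}
    (h : S.MaxFold (cyc w hw) i j m) (h' : S.MaxFold (cyc w hw) k l m') :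
    m = m' ∧ (((w.length : ℤ) ∣ k - i ∧ (w.length : ℤ) ∣ l - j) ∨
      ((w.length : ℤ) ∣ k - (j - m) ∧ (w.length : ℤ) ∣ l - (i + m))) := by
  have h1 := hm _ _ _ _ (S.isMaxCrissCrossed_of_maxFold hw hc hu h)
    (S.isMaxCrissCrossed_of_maxFold hw hc hu h')
  have hmm : m = m' := by
    rcases h1 with h1 | h1
    · simpa using congrArg List.length h1.2.symm
    · simpa using congrArg List.length h1.2.symm
  subst hmm
  refine ⟨rfl, ?_⟩
  have key : (w.length : ℤ) ∣ k - i ∨ (w.length : ℤ) ∣ k - (j - m) := by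
    rcases h1 with ⟨h1, h2⟩ | ⟨h1, h2⟩
    · rcases Nat.eq_zero_or_pos m with rfl | h0
      · rcases eq_or_eq_opp (μ := S.node (cyc w hw k)) (ν := S.node (cyc w hw i)) h1 with h3 | h3
        · exact Or.inl (hu _ _ h3)
        · right
          apply hu
          rw [h3, h.node_eq]
          simp
      · left
        apply hu
        have h3 : (seg (cyc w hw) k m)[0]'(by simpa using h0) =
          (seg (cyc w hw) i m)[0]'(by simpa using h0) := by simp only [h2]
        simpa using congrArg S.node h3
    · right
      rcases Nat.eq_zero_or_pos m with rfl | h0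
      · simp [seg] at h1
      · apply hu
        have h3 : (seg (cyc w hw) k m)[0]'(by simpa using h0) =
          (inv (seg (cyc w hw) i m))[0]'(by simpa using h0) := by simp only [h2]
        rw [inv_seg] at h3
        have h4 := h.refl (m - 1) (by omega) (by omega)
        rw [show i + ((m : ℤ) - 1) = i + m - 1 - (0 : ℕ) by push_cast; ring] at h4
        rw [h4, flip_flip] at h3
        simp at h3
        rw [h3]
  rcases key with h2 | h2
  · exact Or.inl ⟨h2, h'.toFold.right_dvd hu h.toFold hc h2⟩
  · exact Or.inr ⟨h2, h'.toFold.right_dvd hu (h.toFold.symm hc) hc h2⟩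

/-- Any coincidence extends to a maximal fold, and by uniqueness every other coincidence lies on the
same one. The start `i` is moved by periods so that `j < i < j + n`. -/
theorem exists_oneFold {w : List (SArrow E)} (hw : w ≠ [])
    (hc : Q.IsClosedWalk (cyc w hw) w.length) (hu : S.Unboosted (cyc w hw) w.length)
    (hm : ∀ v σ u τ, Q.IsMaxCrissCrossed w v σ → Q.IsMaxCrissCrossed w u τ →
      (u = v ∧ τ = σ) ∨ (σ ≠ [] ∧ τ = inv σ)) {x y : ℤ}
    (hxy : S.node (cyc w hw x) = opp (S.node (cyc w hw y))) :
    ∃ i j m, S.OneFold (cyc w hw) w.length i j m := by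
  obtain ⟨p, q, h⟩ := exists_maxFold hc hxy
  set j := y + p with hj
  set m := p + q with hm'
  have hn := hc.pos
  have h0 := Int.emod_nonneg (x - p - j) hn.ne'
  have h1 := Int.emod_lt_of_pos (x - p - j) hn
  have h2 : (w.length : ℤ) ∣ (x - p - j) - (x - p - j) % w.length := Int.dvd_self_sub_emod
  obtain ⟨i, hi⟩ : ∃ i, i = j + (x - p - j) % w.length := ⟨_, rfl⟩
  have h3 : (w.length : ℤ) ∣ i - (x - p) := by
    rw [← dvd_neg, show -(i - (x - p)) = (x - p - j) - (x - p - j) % w.length by rw [hi]; ring]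
    exact h2
  have h4 : S.MaxFold (cyc w hw) i j m := h.congr hc h3 (by simp)
  refine ⟨i, j, m, h4, ?_, ?_, ?_⟩
  · have : i ≠ j := by
      intro he
      have := h4.node_eq
      rw [he] at this
      exact opp_ne _ this.symm
    omega
  · by_contra hlt
    push Not at hlt
    -- If the two passes met, the reflection would have a centre on the arc from `i` to `j + n`: a
    -- vertex passed oppositely to itself, or a letter inverse to itself.
    rcases Int.even_or_odd' (j + w.length - i) with ⟨t, ht | ht⟩
    · have h5 := h4.node_add hc t (by omega) (by omega)
      rw [hc.congr (k := i + t) (l := j - t) ⟨1, by linarith⟩] at h5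
      exact opp_ne _ h5.symm
    · have h5 := h4.refl t (by omega) (by omega)
      rw [hc.congr (k := i + t) (l := j - 1 - t) ⟨1, by linarith⟩] at h5
      exact flip_ne _ h5.symm
  · intro x' y' hxy'
    obtain ⟨p', q', h'⟩ := exists_maxFold hc hxy'
    obtain ⟨e1, ⟨e2, e3⟩ | ⟨e2, e3⟩⟩ :=
      MaxFold.congr_of_isMaxCrissCrossed_unique hw hc hu hm h4 h'
    · refine ⟨p', by omega, by omega, Or.inl ⟨?_, ?_⟩⟩
      · rwa [show x' - (i + p') = x' - p' - i by ring]
      · rwa [show y' - (j - p') = y' + p' - j by ring]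
    · refine ⟨m - p', by omega, by omega, Or.inr ⟨?_, ?_⟩⟩
      · rwa [show x' - (j - (m - p')) = x' - p' - (j - m) by ring]
      · rwa [show y' - (i + (m - p')) = y' + p' - (i + m) by ring]

theorem elementaryWalk_of_isElementaryBand (S : Q.Sides) {w : List (SArrow E)} (hw : w ≠ [])
    (h : Q.IsElementaryBand w) : S.ElementaryWalk (cyc w hw) w.length := by
  have hc := isClosedWalk_cyc hw h.1.2.1
  have hu := S.unboosted_of_forall_not_isBoosted hw hc h.2.2.1
  refine ⟨hc, hu, balanced_of_selfCompatible hw hc h.2.1, ?_⟩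
  by_cases hs : ∀ x y, S.node (cyc w hw x) ≠ opp (S.node (cyc w hw y))
  · exact Or.inl hs
  · push Not at hs
    obtain ⟨x, y, hxy⟩ := hs
    exact Or.inr (exists_oneFold hw hc hu h.2.2.2 hxy)

/-- A fold that starts on the maximal one cannot outlast it because of `right_ne`. Its string is
therefore contained in that of the maximal fold, and equal to it if it is itself maximal. -/
theorem MaxFold.eq_of_isMaxCrissCrossed {w : List (SArrow E)} (hw : w ≠ [])
    (hc : Q.IsClosedWalk (cyc w hw) w.length) {i j k l t : ℤ} {m m' : ℕ}
    (h : S.MaxFold (cyc w hw) i j m) (hf : S.Fold (cyc w hw) k l m') (h0 : 0 ≤ t) (ht : t ≤ m)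
    (hk : (w.length : ℤ) ∣ k - (i + t)) (hl : (w.length : ℤ) ∣ l - (j - t))
    (hm : Q.IsMaxCrissCrossed w (Q.tail (cyc w hw k)) (seg (cyc w hw) k m')) :
    Q.tail (cyc w hw k) = Q.tail (cyc w hw i) ∧ seg (cyc w hw) k m' = seg (cyc w hw) i m := by
  have h1 : t + m' ≤ m := by
    by_contra hlt
    apply h.right_ne
    have := hf.refl (m - t) (by omega) (by omega)
    rw [hc.congr (k := k + (m - t)) (l := i + m) (by
      rwa [show k + (m - t) - (i + m) = k - (i + t) by ring]),
      hc.congr (k := l - 1 - (m - t)) (l := j - 1 - m) (by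
      rwa [show l - 1 - (m - t) - (j - 1 - m) = l - (j - t) by ring])] at this
    exact this
  have h2 := hm.2 (Q.tail (cyc w hw i)) (seg (cyc w hw) i m)
    ((S.isCrissCrossed_iff hw hc _ _).2 ⟨i, j, rfl, by simpa using h.toFold, by simp⟩) (by
      rcases Nat.eq_zero_or_pos m' with rfl | h3
      · refine Or.inl ⟨by simp [seg], ?_⟩
        rw [hc.congr hk]
        obtain ⟨t, rfl⟩ := Int.eq_ofNat_of_zero_le h0
        rcases t with _ | t
        · simp
        · refine List.mem_cons_of_mem _ (List.mem_map.2 ⟨cyc w hw (i + t), ?_, ?_⟩)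
          · exact List.mem_map.2 ⟨t, by simp; omega, rfl⟩
          · have := ((S.step_iff _ _).1 (hc.step (i + t))).1
            rw [this]
            push_cast
            rw [add_assoc]
      · refine Or.inr ⟨fun h4 => ?_, ?_⟩
        · have := congrArg List.length h4
          simp at this
          omega
        · rw [seg_congr_start hw hk]
          exact seg_infix (by omega) (by omega))
  exact ⟨h2.1.symm, h2.2.symm⟩

theorem OneFold.eq_or_eq_of_isMaxCrissCrossed {w : List (SArrow E)} (hw : w ≠ [])
    (hc : Q.IsClosedWalk (cyc w hw) w.length) {i j : ℤ} {m : ℕ}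
    (h : S.OneFold (cyc w hw) w.length i j m) {v : V} {σ : List (SArrow E)}
    (hm : Q.IsMaxCrissCrossed w v σ) :
    (v = Q.tail (cyc w hw i) ∧ σ = seg (cyc w hw) i m) ∨
      (v = Q.tail (cyc w hw (j - m)) ∧ σ = seg (cyc w hw) (j - m) m) := by
  obtain ⟨k, l, rfl, hf, hk⟩ := (S.isCrissCrossed_iff hw hc _ _).1 hm.1
  generalize σ.length = m' at hk hf
  subst hk
  obtain ⟨t, h0, ht, ⟨h1, h2⟩ | ⟨h1, h2⟩⟩ := h.cover _ _ hf.node_eq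
  · exact Or.inl (h.toMaxFold.eq_of_isMaxCrissCrossed hw hc hf h0 ht h1 h2 hm)
  · refine Or.inr ((h.toMaxFold.symm hc).eq_of_isMaxCrissCrossed hw hc hf (t := m - t) (by omega)
      (by omega) ?_ ?_ hm)
    · rwa [show j - m + (m - t) = j - t by ring]
    · rwa [show i + m - (m - t) = i + t by ring]

theorem Fold.inv_seg_eq {w : List (SArrow E)} {hw : w ≠ []} {i j : ℤ} {m : ℕ}
    (h : S.Fold (cyc w hw) i j m) : inv (seg (cyc w hw) i m) = seg (cyc w hw) (j - m) m := by
  refine eq_seg_of (by simp) fun t ht => ?_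
  rw [inv_seg]
  simp at ht
  have := h.refl (m - 1 - t) (by omega) (by omega)
  rw [show i + (m : ℤ) - 1 - t = i + (m - 1 - t) by ring, this, flip_flip]
  congr 1
  ring

theorem isString_append_self {w : List (SArrow E)} (hw : w ≠ [])
    (hc : Q.IsClosedWalk (cyc w hw) w.length) : Q.IsString (w ++ w) := by
  refine ⟨by simp [hw], ?_⟩
  have e1 : pow w 2 = w ++ w := by simp [pow, List.replicate_succ]
  rw [← e1, List.isChain_iff_getElem]
  intro t ht
  rw [getElem_pow w hw, getElem_pow w hw]
  exact_mod_cast hc.step t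

/-- By `cover`, a maximal criss-crossed string is one of the two passes of the only fold; these are
mutually inverse, and for `m = 0` they are the same lazy string. -/
theorem isElementaryBand_of_elementaryWalk {w : List (SArrow E)} (hw : w ≠ [])
    (h : S.ElementaryWalk (cyc w hw) w.length) : Q.IsElementaryBand w := by
  have hc := h.toIsClosedWalk
  refine ⟨isBand_of_unboosted hw (isString_append_self hw hc) h.unboosted,
    selfCompatible_of_balanced hw hc h.unboosted h.balanced, S.not_isBoosted hw h.unboosted, ?_⟩
  intro v σ u τ h1 h2
  rcases h.simple_or_oneFold with h3 | ⟨i, j, m, h3⟩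
  · obtain ⟨k, l, -, hf, -⟩ := (S.isCrissCrossed_iff hw hc _ _).1 h1.1
    exact absurd hf.node_eq (h3 k l)
  · have e1 := h3.toFold.inv_seg_eq
    have e2 : inv (seg (cyc w hw) (j - m) m) = seg (cyc w hw) i m := by rw [← e1, inv_inv]
    rcases Nat.eq_zero_or_pos m with rfl | h0
    · left
      have e3 : Q.tail (cyc w hw i) = Q.tail (cyc w hw j) := congrArg Prod.fst h3.node_eq
      rcases h3.eq_or_eq_of_isMaxCrissCrossed hw hc h1 with ⟨rfl, rfl⟩ | ⟨rfl, rfl⟩ <;>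
        rcases h3.eq_or_eq_of_isMaxCrissCrossed hw hc h2 with ⟨rfl, rfl⟩ | ⟨rfl, rfl⟩ <;>
        simp [seg, e3]
    · have ne : ∀ k, seg (cyc w hw) k m ≠ [] := fun k hk => by
        have := congrArg List.length hk
        simp at this
        omega
      rcases h3.eq_or_eq_of_isMaxCrissCrossed hw hc h1 with ⟨rfl, rfl⟩ | ⟨rfl, rfl⟩ <;>
        rcases h3.eq_or_eq_of_isMaxCrissCrossed hw hc h2 with ⟨rfl, rfl⟩ | ⟨rfl, rfl⟩
      · exact Or.inl ⟨rfl, rfl⟩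
      · exact Or.inr ⟨ne _, e1.symm⟩
      · exact Or.inr ⟨ne _, e2.symm⟩
      · exact Or.inl ⟨rfl, rfl⟩

end Sides
end BoundQuiver

namespace BoundQuiver

variable {V E : Type*} {Q : BoundQuiver V E}

namespace Sides

/-! ### Flows -/

section Flows

variable (S : Q.Sides) [Fintype E]

open Classical in
/-- The total value of `F` on the arrow ends on one side of a vertex. -/
noncomputable def nodeSum (F : E → ℝ) (ν : V × Bool) : ℝ :=
  ∑ l : SArrow E, if S.node l = ν then F l.1 else 0

/-- At each inner vertex, the total values on the two sides agree. -/
def Conserved (F : E → ℝ) : Prop :=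
  ∀ ν : V × Bool, ν.1 ∈ S.inner → S.nodeSum F ν = S.nodeSum F (opp ν)

variable {S} {F : E → ℝ}

theorem nodeSum_eq_add {x y : SArrow E} (hxy : x ≠ y) (h : S.node y = S.node x)
    (hl : ∀ l, S.node l = S.node x → F l.1 ≠ 0 → l = x ∨ l = y) :
    S.nodeSum F (S.node x) = F x.1 + F y.1 := by
  classical
  rw [nodeSum, Finset.sum_eq_add x y hxy]
  · simp [h]
  · intro l _ hl'
    split_ifs with h1
    · by_contra h2
      rcases hl l h1 h2 with h3 | h3
      · exact hl'.1 h3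
      · exact hl'.2 h3
    · rfl
  · simp
  · simp

theorem nodeSum_eq_single {x : SArrow E} (hl : ∀ l, S.node l = S.node x → F l.1 ≠ 0 → l = x) :
    S.nodeSum F (S.node x) = F x.1 := by
  classical
  rw [nodeSum, Finset.sum_eq_single x]
  · simp
  · intro l _ hl'
    split_ifs with h1
    · by_contra h2
      exact hl' (hl l h1 h2)
    · rfl
  · simp

/-- The two arrows of a relation at an inner vertex are precisely the arrow ends on one side, one
for each sign. -/
theorem conserved_iff : S.Conserved F ↔ ∀ v α₁ α₂ β₁ β₂, Q.RelationsAt v α₁ α₂ β₁ β₂ →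
    F α₁ + F α₂ = F β₁ + F β₂ := by
  have key : ∀ α₁ α₂, S.node (α₁, false) = S.node (α₂, true) →
      S.nodeSum F (S.node (α₁, false)) = F α₁ + F α₂ := by
    intro α₁ α₂ h
    refine nodeSum_eq_add (x := (α₁, false)) (y := (α₂, true)) (by simp) h.symm ?_
    rintro ⟨β, ε⟩ hl -
    cases ε
    · exact Or.inl (S.node_ext hl rfl)
    · exact Or.inr (S.node_ext (hl.trans h) rfl)
  constructor
  · intro h v α₁ α₂ β₁ β₂ hr
    obtain ⟨h1, h2, h3, h4⟩ := S.relationsAt_node hr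
    rw [← key _ _ h1, ← key _ _ h2, h3]
    apply h
    have := (S.step_iff_node (a := (α₁, true)) (b := (β₂, true))).2 (by
      rw [← h2, h3]
      rfl)
    have := S.tail_mem_inner_of_step this
    have h5 := congrArg Prod.fst (h2.symm.trans h3)
    simp only [node_fst, opp] at h5
    rwa [h5] at this
  · intro h ν hν
    obtain ⟨α₁, α₂, β₁, β₂, hr, rfl⟩ := S.exists_relationsAt hν
    obtain ⟨h1, h2, h3, h4⟩ := S.relationsAt_node hr
    rw [key _ _ h1, ← h3, key _ _ h2]
    exact h _ _ _ _ _ hr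

end Flows

/-! ### Letters on the support of a closed walk -/

section Support

variable {S : Q.Sides} {a : ℤ → SArrow E} {n i j : ℤ} {m : ℕ}

/-- An arrow of the walk is used at some position, forwards or backwards. Forwards, the position is
`x` by unboostedness; backwards, its use is an opposite passage, that is, a coincidence. -/
theorem eq_or_exists_fold_of_node_eq (hc : Q.IsClosedWalk a n) (hu : S.Unboosted a n) {l : SArrow E}
    (hl : ∃ k, (a k).1 = l.1) {x : ℤ} (h : S.node l = S.node (a x)) :
    l = a x ∨ ∃ y, S.node (a x) = opp (S.node (a y)) ∧ l = flip (a (y - 1)) := by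
  obtain ⟨k, hk⟩ := hl
  rcases fst_eq_iff.1 hk.symm with rfl | rfl
  · exact Or.inl (hc.congr (hu _ _ h))
  · refine Or.inr ⟨k + 1, ?_, by simp⟩
    rw [S.node_succ hc, opp_opp, h]

theorem eq_or_exists_fold_of_node_eq_opp (hc : Q.IsClosedWalk a n) (hu : S.Unboosted a n)
    {l : SArrow E} (hl : ∃ k, (a k).1 = l.1) {x : ℤ} (h : S.node l = opp (S.node (a x))) :
    l = flip (a (x - 1)) ∨ ∃ y, S.node (a x) = opp (S.node (a y)) ∧ l = a y := by
  obtain ⟨k, hk⟩ := hl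
  rcases fst_eq_iff.1 hk.symm with rfl | rfl
  · exact Or.inr ⟨k, opp_eq_comm.1 h, rfl⟩
  · have h1 := S.node_succ hc k
    rw [h, opp_opp] at h1
    have := hu _ _ h1
    exact Or.inl (by rw [hc.congr (k := k) (l := x - 1) (by
      rwa [show k - (x - 1) = k + 1 - x by ring])])

/-- In the interior of the fold the other pass uses the same arrows and offers nothing new. Only at
the positions `i + m` and `j`, where the walk enters a loop, is there a second letter: the one that
runs through the loop backwards. -/
theorem OneFold.eq_of_node_eq (hc : Q.IsClosedWalk a n) (hu : S.Unboosted a n)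
    (h : S.OneFold a n i j m) {l : SArrow E}
    (hl : ∃ k, (a k).1 = l.1) {x : ℤ} (hx : S.node l = S.node (a x)) :
    l = a x ∨ (n ∣ x - (i + m) ∧ l = flip (a (j - m - 1))) ∨ (n ∣ x - j ∧ l = flip (a (i - 1))) := by
  rcases eq_or_exists_fold_of_node_eq hc hu hl hx with h1 | ⟨y, hy, rfl⟩
  · exact Or.inl h1
  · obtain ⟨t, h0, ht, ⟨h1, h2⟩ | ⟨h1, h2⟩⟩ := h.cover _ _ hy
    · have e1 : a (y - 1) = a (j - 1 - t) := hc.congr (by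
        rwa [show y - 1 - (j - 1 - t) = y - (j - t) by ring])
      rcases ht.eq_or_lt with rfl | ht
      · exact Or.inr (Or.inl ⟨h1, by rw [e1, show j - 1 - (m : ℤ) = j - m - 1 by ring]⟩)
      · left
        rw [e1, ← h.refl t h0 ht, hc.congr h1]
    · have e1 : a (y - 1) = a (i + (t - 1)) := hc.congr (by
        rwa [show y - 1 - (i + (t - 1)) = y - (i + t) by ring])
      rcases h0.eq_or_lt with rfl | h0
      · exact Or.inr (Or.inr ⟨by simpa using h1, by rw [e1]; congr 2⟩)
      · left
        rw [e1, h.refl _ (by omega) (by omega), flip_flip, hc.congr h1]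
        congr 1
        ring

theorem OneFold.eq_of_node_eq_opp (hc : Q.IsClosedWalk a n) (hu : S.Unboosted a n)
    (h : S.OneFold a n i j m) {l : SArrow E}
    (hl : ∃ k, (a k).1 = l.1) {x : ℤ} (hx : S.node l = opp (S.node (a x))) :
    l = flip (a (x - 1)) ∨ (n ∣ x - i ∧ l = a j) ∨ (n ∣ x - (j - m) ∧ l = a (i + m)) := by
  rcases eq_or_exists_fold_of_node_eq_opp hc hu hl hx with h1 | ⟨y, hy, rfl⟩
  · exact Or.inl h1
  · obtain ⟨t, h0, ht, ⟨h1, h2⟩ | ⟨h1, h2⟩⟩ := h.cover _ _ hy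
    · rcases h0.eq_or_lt with rfl | h0
      · exact Or.inr (Or.inl ⟨by simpa using h1, hc.congr (by simpa using h2)⟩)
      · left
        have := h.refl (t - 1) (by omega) (by omega)
        rw [hc.congr (k := x - 1) (l := i + (t - 1)) (by
          rwa [show x - 1 - (i + (t - 1)) = x - (i + t) by ring]), this, flip_flip, hc.congr h2]
        congr 1
        ring
    · rcases ht.eq_or_lt with rfl | ht
      · exact Or.inr (Or.inr ⟨h1, hc.congr h2⟩)
      · left
        rw [hc.congr h2, h.refl t h0 ht]
        congr 1
        apply hc.congr
        rw [← dvd_neg]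
        rwa [show -(j - 1 - t - (x - 1)) = x - (j - t) by ring]

theorem tail_mem_inner (S : Q.Sides) (hc : Q.IsClosedWalk a n) (x : ℤ) :
    Q.tail (a x) ∈ S.inner := by
  have := S.tail_mem_inner_of_step (hc.step (x - 1))
  rwa [sub_add_cancel] at this

variable [Fintype E] {F : E → ℝ}

theorem conserved_node (S : Q.Sides) (hc : Q.IsClosedWalk a n) (hF : S.Conserved F) (x : ℤ) :
    S.nodeSum F (S.node (a x)) = S.nodeSum F (S.node (flip (a (x - 1)))) := by
  rw [S.node_flip_pred hc]
  exact hF _ (S.tail_mem_inner hc x)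

theorem OneFold.flow_eq_pred (hc : Q.IsClosedWalk a n) (hu : S.Unboosted a n)
    (h : S.OneFold a n i j m) (hF : S.Conserved F) (hs : ∀ α, F α ≠ 0 → ∃ k, (a k).1 = α) {x : ℤ}
    (h1 : ¬ n ∣ x - i) (h2 : ¬ n ∣ x - (i + m)) (h3 : ¬ n ∣ x - j) (h4 : ¬ n ∣ x - (j - m)) :
    F (a x).1 = F (a (x - 1)).1 := by
  have e1 : S.nodeSum F (S.node (a x)) = F (a x).1 := nodeSum_eq_single fun l hl hl' => by
    rcases h.eq_of_node_eq hc hu (hs _ hl') hl with h5 | h5 | h5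
    · exact h5
    · exact absurd h5.1 h2
    · exact absurd h5.1 h3
  have e2 : S.nodeSum F (S.node (flip (a (x - 1)))) = F (flip (a (x - 1))).1 :=
    nodeSum_eq_single fun l hl hl' => by
      rw [S.node_flip_pred hc] at hl
      rcases h.eq_of_node_eq_opp hc hu (hs _ hl') hl with h5 | h5 | h5
      · exact h5
      · exact absurd h5.1 h1
      · exact absurd h5.1 h4
  rw [← e1, S.conserved_node hc hF, e2, flip_fst]

theorem const_of_forall_pred {g : ℤ → ℝ} {k l : ℤ} (h : ∀ x, k < x → x < l → g x = g (x - 1)) :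
    ∀ x, k ≤ x → x < l → g x = g k := by
  intro x hk
  induction x, hk using Int.leInduction with
  | base => intros; rfl
  | succ x hx ih =>
    intro hl
    rw [h (x + 1) (by omega) hl, add_sub_cancel_right, ih (by omega)]

/-- A flow on the support of a closed walk with one fold is determined by one value. -/
theorem OneFold.flow_eq (hc : Q.IsClosedWalk a n) (hu : S.Unboosted a n)
    (h : S.OneFold a n i j m) (x : ℤ) : ∃ c : ℝ, ∀ F : E → ℝ, S.Conserved F →
      (∀ α, F α ≠ 0 → ∃ k, (a k).1 = α) → F (a x).1 = c * F (a j).1 := by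
  have hn := hc.pos
  have hlt := h.lt
  have hlt' := h.add_lt
  have nd : ∀ d : ℤ, -n < d → d < n → d ≠ 0 → ¬ n ∣ d := fun d h1 h2 h3 h4 =>
    h3 (eq_zero_of_dvd_of_lt h4 h1 h2)
  -- With one value on the first loop, conservation at `i` gives the bridge the sum of the values at
  -- both loop ends, hence twice this value. Conservation at `i + m` then gives the second loop the
  -- value of the first. For `m = 0` the two loops face each other directly.
  have main : ∀ F : E → ℝ, S.Conserved F → (∀ α, F α ≠ 0 → ∃ k, (a k).1 = α) →
      (∀ x, j ≤ x → x < i → F (a x).1 = F (a j).1) ∧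
      (∀ x, i ≤ x → x < i + m → F (a x).1 = 2 * F (a j).1) ∧
      (∀ x, i + m ≤ x → x < j + n - m → F (a x).1 = F (a j).1) := by
    intro F hF hs
    have c1 := const_of_forall_pred (g := fun x => F (a x).1) (k := j) (l := i) fun x h1 h2 =>
      h.flow_eq_pred hc hu hF hs (nd _ (by omega) (by omega) (by omega))
        (nd _ (by omega) (by omega) (by omega)) (nd _ (by omega) (by omega) (by omega))
        (nd _ (by omega) (by omega) (by omega))
    have c2 := const_of_forall_pred (g := fun x => F (a x).1) (k := i) (l := i + m) fun x h1 h2 =>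
      h.flow_eq_pred hc hu hF hs (nd _ (by omega) (by omega) (by omega))
        (nd _ (by omega) (by omega) (by omega)) (nd _ (by omega) (by omega) (by omega))
        (nd _ (by omega) (by omega) (by omega))
    have c3 := const_of_forall_pred (g := fun x => F (a x).1) (k := i + m) (l := j + n - m)
      fun x h1 h2 =>
      h.flow_eq_pred hc hu hF hs (nd _ (by omega) (by omega) (by omega))
        (nd _ (by omega) (by omega) (by omega)) (nd _ (by omega) (by omega) (by omega))
        (nd _ (by omega) (by omega) (by omega))
    have s1 : S.nodeSum F (S.node (flip (a (i - 1)))) = F (a (i - 1)).1 + F (a j).1 := by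
      refine nodeSum_eq_add (x := flip (a (i - 1))) (y := a j) (fun h' => h.left_ne ?_) ?_ ?_
      · rw [← h', flip_flip]
      · rw [S.node_flip_pred hc, h.node_eq, opp_opp]
      · intro l hl hl'
        rw [S.node_flip_pred hc] at hl
        rcases h.eq_of_node_eq_opp hc hu (hs _ hl') hl with h5 | h5 | h5
        · exact Or.inl h5
        · exact Or.inr h5.2
        · exact absurd h5.1 (nd _ (by omega) (by omega) (by omega))
    have s2 : S.nodeSum F (S.node (a (i + m))) = F (a (i + m)).1 + F (a (j - m - 1)).1 := by
      refine nodeSum_eq_add (x := a (i + m)) (y := flip (a (j - m - 1))) (fun h' => h.right_ne ?_) ?_ ?_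
      · rw [h']
        congr 2
        ring
      · rw [S.node_flip_pred hc, h.node_add hc m (by omega) le_rfl]
      · intro l hl hl'
        rcases h.eq_of_node_eq hc hu (hs _ hl') hl with h5 | h5 | h5
        · exact Or.inl h5
        · exact Or.inr h5.2
        · exact absurd h5.1 (nd _ (by omega) (by omega) (by omega))
    have p1 : F (a (i - 1)).1 = F (a j).1 := c1 _ (by omega) (by omega)
    have p2 : F (a (j - m - 1)).1 = F (a (i + m)).1 := by
      rw [← c3 (j + n - m - 1) (by omega) (by omega)]
      rw [hc.congr (k := j + n - m - 1) (l := j - m - 1) ⟨1, by ring⟩]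
    have q1 := S.conserved_node hc hF i
    have q2 := S.conserved_node hc hF (i + m)
    rcases Nat.eq_zero_or_pos m with rfl | hm
    · simp only [Nat.cast_zero, add_zero, sub_zero] at *
      have : F (a i).1 = F (a j).1 := by linarith
      refine ⟨c1, fun x h1 h2 => by omega, fun x h1 h2 => by rw [c3 x h1 h2, this]⟩
    · have t1 : S.nodeSum F (S.node (a i)) = F (a i).1 := nodeSum_eq_single fun l hl hl' => by
        rcases h.eq_of_node_eq hc hu (hs _ hl') hl with h5 | h5 | h5
        · exact h5
        · exact absurd h5.1 (nd _ (by omega) (by omega) (by omega))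
        · exact absurd h5.1 (nd _ (by omega) (by omega) (by omega))
      have t2 : S.nodeSum F (S.node (flip (a (i + m - 1)))) = F (flip (a (i + m - 1))).1 :=
        nodeSum_eq_single fun l hl hl' => by
          rw [S.node_flip_pred hc] at hl
          rcases h.eq_of_node_eq_opp hc hu (hs _ hl') hl with h5 | h5 | h5
          · exact h5
          · exact absurd h5.1 (nd _ (by omega) (by omega) (by omega))
          · exact absurd h5.1 (nd _ (by omega) (by omega) (by omega))
      rw [flip_fst, c2 _ (by omega) (by omega)] at t2
      have : F (a (i + m)).1 = F (a j).1 := by linarith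
      refine ⟨c1, fun x h1 h2 => by rw [c2 x h1 h2]; linarith, fun x h1 h2 => by rw [c3 x h1 h2, this]⟩
  have h0 := Int.emod_nonneg (x - j) hn.ne'
  have h1 := Int.emod_lt_of_pos (x - j) hn
  obtain ⟨y, hy⟩ : ∃ y, y = j + (x - j) % n := ⟨_, rfl⟩
  have h2 : a x = a y := hc.congr (by
    rw [hy, ← sub_sub]
    exact Int.dvd_self_sub_emod)
  rw [h2]
  rcases lt_or_ge y i with h3 | h3
  · exact ⟨1, fun F hF hs => by rw [(main F hF hs).1 y (by omega) h3, one_mul]⟩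
  rcases lt_or_ge y (i + m) with h4 | h4
  · exact ⟨2, fun F hF hs => (main F hF hs).2.1 y h3 h4⟩
  rcases lt_or_ge y (j + n - m) with h5 | h5
  · exact ⟨1, fun F hF hs => by rw [(main F hF hs).2.2 y h4 h5, one_mul]⟩
  -- The remaining positions are on the way back over the bridge and repeat the arrows of the way
  -- out.
  · have h6 := h.refl (j + n - 1 - y) (by omega) (by omega)
    rw [hc.congr (k := j - 1 - (j + n - 1 - y)) (l := y) ⟨-1, by ring⟩] at h6
    refine ⟨2, fun F hF hs => ?_⟩
    rw [← (main F hF hs).2.1 (i + (j + n - 1 - y)) (by omega) (by omega), h6, flip_fst]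

theorem flow_eq_of_simple (hc : Q.IsClosedWalk a n) (hu : S.Unboosted a n)
    (h : ∀ x y, S.node (a x) ≠ opp (S.node (a y))) (hF : S.Conserved F)
    (hs : ∀ α, F α ≠ 0 → ∃ k, (a k).1 = α) (x : ℤ) : F (a x).1 = F (a 0).1 := by
  have key : ∀ x, F (a x).1 = F (a (x - 1)).1 := by
    intro x
    have e1 : S.nodeSum F (S.node (a x)) = F (a x).1 := nodeSum_eq_single fun l hl hl' => by
      rcases eq_or_exists_fold_of_node_eq hc hu (hs _ hl') hl with h5 | ⟨y, h5, -⟩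
      · exact h5
      · exact absurd h5 (h _ _)
    have e2 : S.nodeSum F (S.node (flip (a (x - 1)))) = F (flip (a (x - 1))).1 :=
      nodeSum_eq_single fun l hl hl' => by
        rw [S.node_flip_pred hc] at hl
        rcases eq_or_exists_fold_of_node_eq_opp hc hu (hs _ hl') hl with h5 | ⟨y, h5, -⟩
        · exact h5
        · exact absurd h5 (h _ _)
    rw [← e1, S.conserved_node hc hF, e2, flip_fst]
  have h0 := Int.emod_nonneg x hc.pos.ne'
  rw [hc.congr (k := x) (l := x % n) Int.dvd_self_sub_emod]
  exact const_of_forall_pred (g := fun x => F (a x).1) (k := 0) (l := n) (fun x _ _ => key x) _ h0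
    (Int.emod_lt_of_pos x hc.pos)

/-- The flows on the support of an elementary band are proportional. -/
theorem ElementaryWalk.flow_eq (h : S.ElementaryWalk a n) : ∃ k : ℤ, ∀ x, ∃ c : ℝ, ∀ F : E → ℝ,
    S.Conserved F → (∀ α, F α ≠ 0 → ∃ k, (a k).1 = α) → F (a x).1 = c * F (a k).1 := by
  rcases h.simple_or_oneFold with h1 | ⟨i, j, m, h1⟩
  · exact ⟨0, fun x => ⟨1, fun F hF hs => by
      rw [one_mul, flow_eq_of_simple h.toIsClosedWalk h.unboosted h1 hF hs]⟩⟩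
  · exact ⟨j, fun x => h1.flow_eq h.toIsClosedWalk h.unboosted x⟩

end Support

end Sides
end BoundQuiver

namespace BoundQuiver

variable {V E : Type*} {Q : BoundQuiver V E}

namespace Sides

/-! ### Elementary bands with the same support -/

variable {S : Q.Sides} {a b : ℤ → SArrow E} {n n' i j : ℤ} {m : ℕ}

/-- After `n` steps `b` is again at its initial node, so `n'` divides `n`; a smaller `n'` would make
`a` repeat a letter within its period. -/
theorem eq_of_eq_on_period (hc : Q.IsClosedWalk a n) (hu : S.Unboosted a n)
    (hc' : Q.IsClosedWalk b n') (hu' : S.Unboosted b n') (j : ℤ)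
    (h : ∀ x, j ≤ x → x < j + n → b x = a x) : n' = n ∧ b = a := by
  have hn := hc.pos
  have h1 : S.node (b (j + n)) = S.node (b j) := by
    have e := S.node_succ hc' (j + n - 1)
    have e' := S.node_succ hc (j + n - 1)
    rw [sub_add_cancel] at e e'
    rw [e, h _ (by omega) (by omega), ← e', hc.per, h j le_rfl (by omega)]
  have h2 : n' ∣ n := by simpa using hu' _ _ h1
  have h3 : n' = n := by
    rcases (Int.le_of_dvd hn h2).eq_or_lt with h4 | h4
    · exact h4
    · have h5 := hc'.per j
      rw [h j le_rfl (by omega), h _ (by linarith [hc'.pos]) (by linarith)] at h5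
      have := eq_zero_of_dvd_of_lt (hu _ _ (congrArg S.node h5)) (by linarith [hc'.pos])
        (by linarith [hc'.pos])
      have := hc'.pos
      omega
  subst h3
  refine ⟨rfl, funext fun x => ?_⟩
  have h0 := Int.emod_nonneg (x - j) hn.ne'
  have h4 := Int.emod_lt_of_pos (x - j) hn
  have h5 : n' ∣ x - (j + (x - j) % n') := by
    rw [← sub_sub]
    exact Int.dvd_self_sub_emod
  rw [hc'.congr h5, hc.congr h5, h _ (by omega) (by omega)]

theorem eq_of_simple (hc : Q.IsClosedWalk a n) (hu : S.Unboosted a n)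
    (hs : ∀ x y, S.node (a x) ≠ opp (S.node (a y)))
    (hc' : Q.IsClosedWalk b n') (hu' : S.Unboosted b n')
    (hT : ∀ k, ∃ l, (a l).1 = (b k).1) (h0 : b 0 = a 0) : n' = n ∧ b = a := by
  refine eq_of_eq_on_period hc hu hc' hu' 0 fun x hx => ?_
  induction x, hx using Int.leInduction with
  | base => exact fun _ => h0
  | succ x hx ih =>
    intro hl
    have e : S.node (b (x + 1)) = S.node (a (x + 1)) := by
      rw [S.node_succ hc', S.node_succ hc, ih (by omega)]
    rcases eq_or_exists_fold_of_node_eq hc hu (hT _) e with h1 | ⟨y, h1, -⟩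
    · exact h1
    · exact absurd h1 (hs _ _)

/-- Starting with `a j`, the walk `b` is forced to follow `a` around the first loop and over the
bridge. Its only choice is the direction of the second loop, and the wrong one contradicts balance.
This is the point at which self-compatibility makes a barbell unique for its support. -/
theorem OneFold.eq_of_eq (hc : Q.IsClosedWalk a n) (hu : S.Unboosted a n)
    (h : S.OneFold a n i j m) (hb : S.Balanced a)
    (hc' : Q.IsClosedWalk b n') (hu' : S.Unboosted b n') (hb' : S.Balanced b)
    (hT : ∀ k, ∃ l, (a l).1 = (b k).1) (h0 : b j = a j) : n' = n ∧ b = a := by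
  have hn := hc.pos
  have hlt := h.lt
  have hlt' := h.add_lt
  have nd : ∀ d : ℤ, -n < d → d < n → d ≠ 0 → ¬ n ∣ d := fun d h1 h2 h3 h4 =>
    h3 (eq_zero_of_dvd_of_lt h4 h1 h2)
  have next : ∀ x, b x = a x → S.node (b (x + 1)) = S.node (a (x + 1)) := fun x hx => by
    rw [S.node_succ hc', S.node_succ hc, hx]
  have forced : ∀ x, S.node (b x) = S.node (a x) → ¬ n ∣ x - (i + m) → ¬ n ∣ x - j →
      b x = a x := by
    intro x hx h1 h2
    rcases h.eq_of_node_eq hc hu (hT x) hx with h3 | h3 | h3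
    · exact h3
    · exact absurd h3.1 h1
    · exact absurd h3.1 h2
  have c1 : ∀ x, j ≤ x → x < i + m → b x = a x := by
    intro x hx
    induction x, hx using Int.leInduction with
    | base => exact fun _ => h0
    | succ x hx ih =>
      intro hl
      exact forced _ (next x (ih (by omega))) (nd _ (by omega) (by omega) (by omega))
        (nd _ (by omega) (by omega) (by omega))
  have em : S.node (b (i + m)) = S.node (a (i + m)) := by
    have := next (i + m - 1) (c1 _ (by omega) (by omega))
    rwa [sub_add_cancel] at this
  rcases h.eq_of_node_eq hc hu (hT _) em with h1 | ⟨-, h1⟩ | ⟨h1, -⟩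
  · refine eq_of_eq_on_period hc hu hc' hu' j fun x hx hx' => ?_
    rcases lt_or_ge x (i + m) with h2 | h2
    · exact c1 x hx h2
    · clear hx
      induction x, h2 using Int.leInduction with
      | base => exact h1
      | succ x hx ih =>
        exact forced _ (next x (ih (by omega))) (nd _ (by omega) (by omega) (by omega))
          (nd _ (by omega) (by omega) (by omega))
  · exfalso
    obtain ⟨L, hL⟩ : ∃ L, L = j + n - m := ⟨_, rfl⟩
    -- Against the direction of `a`, `b` is forced all around the second loop, which ends at the
    -- position `L`.
    have c2 : ∀ t : ℕ, i + m + t < L → b (i + m + t) = flip (a (j - m - 1 - t)) := by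
      intro t
      induction t with
      | zero => intro _; simpa using h1
      | succ t ih =>
        intro ht
        push_cast at ht ⊢
        have e : S.node (b (i + m + (t + 1))) = opp (S.node (a (j - m - 1 - t))) := by
          rw [← add_assoc, S.node_succ hc', ih (by omega), flip_flip]
        rcases h.eq_of_node_eq_opp hc hu (hT _) e with h3 | h3 | h3
        · rw [h3]
          congr 2
          ring
        · exact absurd h3.1 fun h4 => nd (j - m - 1 - t - i + n) (by omega) (by omega) (by omega)
            (by simpa using h4)
        · exact absurd h3.1 (nd _ (by omega) (by omega) (by omega))
    have c3 : b (L - 1) = flip (a (i + m)) := by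
      have := c2 (L - 1 - (i + m)).toNat (by omega)
      rw [Int.toNat_of_nonneg (by omega)] at this
      rw [show L - 1 = i + m + (L - 1 - (i + m)) by ring, this]
      congr 1
      exact hc.congr ⟨-1, by rw [hL]; ring⟩
    have eL : S.node (b L) = S.node (a L) := by
      have e := S.node_succ hc' (L - 1)
      rw [sub_add_cancel, c3, flip_flip, h.node_add hc m (by omega) le_rfl, opp_opp] at e
      rw [e, hc.congr (k := L) (l := j - m) ⟨1, by rw [hL]; ring⟩]
    have c4 : ∀ x, L ≤ x → x < j + n → b x = a x := by
      intro x hx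
      induction x, hx using Int.leInduction with
      | base =>
        intro hl
        exact forced _ eL (nd _ (by omega) (by omega) (by omega))
          (nd _ (by omega) (by omega) (by omega))
      | succ x hx ih =>
        intro hl
        exact forced _ (next x (ih (by omega))) (nd _ (by omega) (by omega) (by omega))
          (nd _ (by omega) (by omega) (by omega))
    have e1 : S.node (b (j + n)) = S.node (b j) := by
      rcases Nat.eq_zero_or_pos m with rfl | hm
      · rw [show j + n = L by rw [hL]; simp, eL, h0, hL]
        simp [hc.per]
      · have := next (j + n - 1) (c4 _ (by omega) (by omega))
        rw [sub_add_cancel] at this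
        rw [this, hc.per, h0]
    have e2 : b (j + n) = b j := hc'.congr (hu' _ _ e1)
    have e3 : S.node (b i) = S.node (a i) := by
      rcases Nat.eq_zero_or_pos m with rfl | hm
      · simpa using em
      · rw [c1 i (by omega) (by omega)]
    have hf : S.MaxFold b i (j + n) m := by
      refine ⟨⟨?_, fun t h2 h3 => ?_⟩, ?_, ?_⟩
      · rw [e3, e2, h0, h.node_eq]
      · rw [c1 _ (by omega) (by omega), c4 _ (by omega) (by omega), h.refl t h2 h3]
        congr 1
        exact hc.congr ⟨-1, by ring⟩
      · rw [e2, h0, c1 _ (by omega) (by omega)]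
        exact h.left_ne
      · rw [h1, show j + n - 1 - (m : ℤ) = L - 1 by rw [hL]; ring, c3, flip_flip]
        intro h2
        apply h.right_ne
        rw [← h2]
        congr 2
        ring
    -- Both walks enter the bridge by the same letter, but `b` leaves it by `flip (a (j - m - 1))`,
    -- whose sign is opposite to that of `a (i + m)` by `right_snd`. They cannot both be balanced.
    have h2 := hb' _ _ _ hf
    rw [h1, c1 _ (by omega) (by omega), hb _ _ _ h.toMaxFold, h.toMaxFold.right_snd hc,
      show j - 1 - (m : ℤ) = j - m - 1 by ring] at h2
    simp at h2
  · exact absurd h1 (nd _ (by omega) (by omega) (by omega))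

theorem _root_.BoundQuiver.IsClosedWalk.shift (hc : Q.IsClosedWalk a n) (r : ℤ) :
    Q.IsClosedWalk (fun k => a (k + r)) n where
  pos := hc.pos
  per k := by
    rw [← hc.per (k + r)]
    congr 1
    ring
  step k := by
    rw [show k + 1 + r = k + r + 1 by ring]
    exact hc.step _

theorem Unboosted.shift (hu : S.Unboosted a n) (r : ℤ) : S.Unboosted (fun k => a (k + r)) n :=
  fun i j h => by simpa using hu _ _ h

theorem Balanced.shift (hb : S.Balanced a) (r : ℤ) : S.Balanced (fun k => a (k + r)) := by
  intro i j m h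
  have h' : S.MaxFold a (i + r) (j + r) m := by
    refine ⟨⟨h.node_eq, fun t h0 ht => ?_⟩, ?_, ?_⟩
    · have := h.refl t h0 ht
      rw [show i + r + t = i + t + r by ring, this]
      congr 2
      ring
    · have := h.left_ne
      rwa [show i + r - 1 = i - 1 + r by ring]
    · have := h.right_ne
      rwa [show i + r + (m : ℤ) = i + m + r by ring,
        show j + r - 1 - (m : ℤ) = j - 1 - m + r by ring]
  have := hb _ _ _ h'
  beta_reduce
  rwa [show i - 1 + r = i + r - 1 by ring, show i + (m : ℤ) + r = i + r + m by ring]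

theorem _root_.BoundQuiver.IsClosedWalk.reverse (S : Q.Sides) (hc : Q.IsClosedWalk a n) (r : ℤ) :
    Q.IsClosedWalk (fun k => flip (a (r - k))) n where
  pos := hc.pos
  per k := by
    rw [← hc.per (r - (k + n))]
    congr 2
    ring
  step k := by
    apply S.step_flip
    have := hc.step (r - (k + 1))
    rwa [show r - (k + 1) + 1 = r - k by ring] at this

theorem Unboosted.reverse (hc : Q.IsClosedWalk a n) (hu : S.Unboosted a n) (r : ℤ) :
    S.Unboosted (fun k => flip (a (r - k))) n := by
  intro i j h
  simp only at h
  have h1 := S.node_succ hc (r - i)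
  rw [h, ← S.node_succ hc (r - j)] at h1
  have := hu _ _ h1
  rw [← dvd_neg]
  rwa [show -(i - j) = r - i + 1 - (r - j + 1) by ring]

theorem Balanced.reverse (hc : Q.IsClosedWalk a n) (hb : S.Balanced a) (r : ℤ) :
    S.Balanced (fun k => flip (a (r - k))) := by
  intro i j m h
  have h' : S.MaxFold a (r - j + 1) (r - i + 1) m := by
    refine ⟨⟨?_, fun t h0 ht => ?_⟩, ?_, ?_⟩
    · rw [S.node_succ hc, S.node_succ hc, opp_opp, ← h.node_eq]
    · have := h.refl t h0 ht
      simp only [flip_flip] at this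
      rw [show r - j + 1 + t = r - (j - 1 - t) by ring, ← this]
      congr 2
      ring
    · have := h.left_ne
      simp only [flip_flip] at this
      intro h1
      apply this
      rw [show r - j + 1 - 1 = r - j by ring] at h1
      rw [h1]
      exact congrArg flip (congrArg a (by ring))
    · have := h.right_ne
      simp only [flip_flip] at this
      intro h1
      apply this
      rw [show r - (j - 1 - (m : ℤ)) = r - j + 1 + m by ring, h1]
      congr 2
      ring
  have h1 := hb _ _ _ (h'.symm hc)
  simp only [flip_snd]
  rw [show r - (i - 1) = r - i + 1 - (m : ℤ) + m by ring, ← h1,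
    show r - i + 1 - (m : ℤ) - 1 = r - (i + m) by ring]

/-- Some letter of `b` uses the arrow of the reference letter of `a`. Shifting `b`, or reversing it
when the sign differs, makes the two agree there, and the uniqueness results apply. -/
theorem ElementaryWalk.eq_of_support_eq (ha : S.ElementaryWalk a n) (hb : S.ElementaryWalk b n')
    (hT : ∀ k, ∃ l, (a l).1 = (b k).1) (hT' : ∀ k, ∃ l, (b l).1 = (a k).1) :
    n' = n ∧ ∃ r, (∀ k, b k = a (k + r)) ∨ ∀ k, b k = flip (a (r - k)) := by
  have core : ∃ j, ∀ (b' : ℤ → SArrow E), Q.IsClosedWalk b' n' → S.Unboosted b' n' →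
      S.Balanced b' → (∀ k, ∃ l, (a l).1 = (b' k).1) → b' j = a j → n' = n ∧ b' = a := by
    rcases ha.simple_or_oneFold with h | ⟨i, j, m, h⟩
    · exact ⟨0, fun b' h1 h2 h3 h4 h5 =>
        eq_of_simple ha.toIsClosedWalk ha.unboosted h h1 h2 h4 h5⟩
    · exact ⟨j, fun b' h1 h2 h3 h4 h5 =>
        h.eq_of_eq ha.toIsClosedWalk ha.unboosted ha.balanced h1 h2 h3 h4 h5⟩
  obtain ⟨j, core⟩ := core
  obtain ⟨l, hl⟩ := hT' j
  rcases fst_eq_iff.1 hl with h | h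
  · obtain ⟨h1, h2⟩ := core (fun k => b (k + (l - j))) (hb.toIsClosedWalk.shift _)
      (hb.unboosted.shift _) (hb.balanced.shift _) (fun k => hT _) (by simpa using h)
    refine ⟨h1, j - l, Or.inl fun k => ?_⟩
    rw [← h2]
    simp only
    congr 1
    ring
  · obtain ⟨h1, h2⟩ := core (fun k => flip (b (l + j - k))) (hb.toIsClosedWalk.reverse S _)
      (hb.unboosted.reverse hb.toIsClosedWalk _) (hb.balanced.reverse hb.toIsClosedWalk _)
      (fun k => hT _) (by simp [h, flip_flip])
    refine ⟨h1, l + j, Or.inr fun k => ?_⟩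
    rw [← h2]
    simp only [flip_flip]
    congr 1
    ring

end Sides
end BoundQuiver

namespace BoundQuiver

variable {V E : Type*} {Q : BoundQuiver V E}

namespace Sides

/-! ### Routes as walks -/

/-- Walks of length `N` between outer vertices; only the positions `0, …, N - 1` matter. -/
structure RouteWalk (S : Q.Sides) (a : ℤ → SArrow E) (N : ℤ) : Prop where
  pos : 0 < N
  step : ∀ k, 0 ≤ k → k + 1 < N → Q.Step (a k) (a (k + 1))
  first : Q.tail (a 0) ∉ S.inner
  last : Q.head (a (N - 1)) ∉ S.inner

/-- The walks of the elementary routes: the first `m` letters are repeated in the end, and there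
are no other repeated vertices. -/
structure ElementaryRouteWalk (S : Q.Sides) (a : ℤ → SArrow E) (N m : ℤ) : Prop extends
    S.RouteWalk a N where
  nonneg : 0 ≤ m
  lt : 2 * m < N
  refl : ∀ t, 0 ≤ t → t < m → a t = flip (a (N - 1 - t))
  eq_of_tail_eq : ∀ x y, 0 ≤ x → x < y → y < N → Q.tail (a x) = Q.tail (a y) → x + y = N ∧ x ≤ m

variable {S : Q.Sides} {a b : ℤ → SArrow E} {N N' m : ℤ}

theorem RouteWalk.node_eq (h : S.RouteWalk a N) {x : ℤ} (h0 : 0 < x) (hx : x < N) :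
    S.node (a x) = opp (S.node (flip (a (x - 1)))) := by
  have := S.step_iff_node.1 (h.step (x - 1) (by omega) (by omega))
  rwa [sub_add_cancel] at this

theorem RouteWalk.tail_mem_inner (h : S.RouteWalk a N) {x : ℤ} (h0 : 0 < x) (hx : x < N) :
    Q.tail (a x) ∈ S.inner := by
  have := S.tail_mem_inner_of_step (h.step (x - 1) (by omega) (by omega))
  rwa [sub_add_cancel] at this

namespace ElementaryRouteWalk

/-- A repeated vertex lies on the stick or is its junction with the loop, and by the mirroring of
the letter before it the second passage is opposite to the first. -/
theorem eq_of_node_eq (h : S.ElementaryRouteWalk a N m) {x y : ℤ} (hx : 0 ≤ x) (hxN : x < N)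
    (hy : 0 ≤ y) (hyN : y < N) (he : S.node (a x) = S.node (a y)) : x = y := by
  have key : ∀ x y, 0 ≤ x → x < y → y < N → S.node (a x) = S.node (a y) → False := by
    intro x y hx hxy hy he
    obtain ⟨h1, h2⟩ := h.eq_of_tail_eq x y hx hxy hy (congrArg Prod.fst he)
    rw [h.node_eq (by omega) (by omega), h.refl _ (by omega) (by omega), flip_flip,
      show N - 1 - (x - 1) = y by omega] at he
    exact opp_ne _ he
  rcases lt_trichotomy x y with h1 | h1 | h1
  · exact (key x y hx h1 hyN he).elim
  · exact h1
  · exact (key y x hy h1 hxN he.symm).elim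

theorem add_eq_of_node_eq_opp (h : S.ElementaryRouteWalk a N m) {x y : ℤ} (hx : 0 ≤ x)
    (hxN : x < N) (hy : 0 ≤ y) (hyN : y < N) (he : S.node (a x) = opp (S.node (a y))) :
    x + y = N ∧ (x ≤ m ∨ y ≤ m) := by
  rcases lt_trichotomy x y with h1 | h1 | h1
  · have := h.eq_of_tail_eq x y hx h1 hyN (congrArg Prod.fst he)
    exact ⟨this.1, Or.inl this.2⟩
  · rw [h1] at he
    exact absurd he.symm (opp_ne _)
  · have := h.eq_of_tail_eq y x hy h1 hxN (congrArg Prod.fst he).symm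
    exact ⟨by omega, Or.inr this.2⟩

/-- The junction `m` is the only place where a walk on the support has a choice, namely the
direction of the loop. -/
theorem letter_eq_of_node_eq (h : S.ElementaryRouteWalk a N m) {l : SArrow E}
    (hl : ∃ y, 0 ≤ y ∧ y < N ∧ (a y).1 = l.1) {x : ℤ} (hx : 0 ≤ x) (hxN : x < N)
    (he : S.node l = S.node (a x)) : l = a x ∨ (0 < m ∧ x = m ∧ l = flip (a (N - 1 - m))) := by
  obtain ⟨y, hy, hyN, hyl⟩ := hl
  rcases fst_eq_iff.1 hyl.symm with rfl | rfl
  · exact Or.inl (by rw [h.eq_of_node_eq hy hyN hx hxN he])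
  · by_cases h1 : y + 1 < N
    · have e := h.node_eq (x := y + 1) (by omega) h1
      rw [add_sub_cancel_right, he] at e
      obtain ⟨h2, h3⟩ := h.add_eq_of_node_eq_opp (by omega) h1 hx hxN e
      by_cases h4 : x ≤ m
      · rcases h4.eq_or_lt with rfl | h4
        · exact Or.inr ⟨by omega, rfl, by congr 2; omega⟩
        · left
          rw [h.refl x hx h4]
          congr 2
          omega
      · left
        rw [h.refl y hy (by omega), flip_flip]
        congr 1
        omega
    · left
      refine S.outer_unique _ _ ?_ (congrArg Prod.fst he)
      rw [tail_flip, show y = N - 1 by omega]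
      exact h.last

theorem letter_eq_of_node_eq_opp (h : S.ElementaryRouteWalk a N m) {l : SArrow E}
    (hl : ∃ y, 0 ≤ y ∧ y < N ∧ (a y).1 = l.1) {x : ℤ} (hx : 0 < x) (hxN : x < N)
    (he : S.node l = opp (S.node (a x))) : l = flip (a (x - 1)) ∨ x = N - m := by
  obtain ⟨y, hy, hyN, hyl⟩ := hl
  rcases fst_eq_iff.1 hyl.symm with rfl | rfl
  · obtain ⟨h2, h3⟩ := h.add_eq_of_node_eq_opp hy hyN hx.le hxN he
    by_cases h4 : y ≤ m
    · rcases h4.eq_or_lt with rfl | h4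
      · exact Or.inr (by omega)
      · left
        rw [h.refl y hy h4]
        congr 2
        omega
    · left
      rw [h.refl (x - 1) (by omega) (by omega), flip_flip]
      congr 1
      omega
  · by_cases h1 : y + 1 < N
    · have e := h.node_eq (x := y + 1) (by omega) h1
      rw [add_sub_cancel_right, he, opp_opp] at e
      have := h.eq_of_node_eq (by omega) h1 hx.le hxN e
      left
      congr 2
      omega
    · exfalso
      have h2 := h.tail_mem_inner hx hxN
      have h3 : Q.tail (flip (a y)) = Q.tail (a x) := congrArg Prod.fst he
      rw [← h3, tail_flip, show y = N - 1 by omega] at h2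
      exact h.last h2

theorem ne_flip (h : S.ElementaryRouteWalk a N m) : a m ≠ flip (a (N - 1 - m)) := by
  intro he
  have hm := h.nonneg
  have hlt := h.lt
  by_cases h1 : m = N - 1 - m
  · rw [← h1] at he
    exact flip_ne _ he.symm
  · have e := h.node_eq (x := m + 1) (by omega) (by omega)
    rw [add_sub_cancel_right, he, flip_flip] at e
    obtain ⟨h2, h3⟩ := h.add_eq_of_node_eq_opp (by omega) (by omega) (by omega) (by omega) e
    omega

variable [Fintype E]

/-- A flow on the support of an elementary route is determined by one value. -/
theorem flow_eq (h : S.ElementaryRouteWalk a N m) {x : ℤ} (hx : 0 ≤ x) (hxN : x < N) :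
    ∃ c : ℝ, ∀ F : E → ℝ, S.Conserved F → (∀ α, F α ≠ 0 → ∃ y, 0 ≤ y ∧ y < N ∧ (a y).1 = α) →
      F (a x).1 = c * F (a m).1 := by
  have hm := h.nonneg
  have hlt := h.lt
  -- The stick faces both ends of the loop at the junction, hence the factor two.
  have main : ∀ F : E → ℝ, S.Conserved F →
      (∀ α, F α ≠ 0 → ∃ y, 0 ≤ y ∧ y < N ∧ (a y).1 = α) →
      (∀ x, 0 ≤ x → x < m → F (a x).1 = 2 * F (a m).1) ∧
      (∀ x, m ≤ x → x < N - m → F (a x).1 = F (a m).1) := by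
    intro F hF hs
    have e2 : ∀ x, 0 < x → x < N - m → S.nodeSum F (S.node (a x)) = F (a (x - 1)).1 := by
      intro x h0 h1
      have : S.nodeSum F (S.node (flip (a (x - 1)))) = F (flip (a (x - 1))).1 :=
        nodeSum_eq_single fun l hl hl' => by
          rcases h.letter_eq_of_node_eq_opp (hs _ hl') h0 (by omega) (by
            rw [hl, h.node_eq h0 (by omega), opp_opp]) with h2 | h2
          · exact h2
          · omega
      rw [hF _ (h.tail_mem_inner h0 (by omega)), h.node_eq h0 (by omega), opp_opp, this, flip_fst]
    have e1 : ∀ x, 0 < x → x < N - m → x ≠ m → F (a x).1 = F (a (x - 1)).1 := by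
      intro x h0 h1 h2
      rw [← e2 x h0 h1]
      refine (nodeSum_eq_single fun l hl hl' => ?_).symm
      rcases h.letter_eq_of_node_eq (hs _ hl') h0.le (by omega) hl with h3 | h3
      · exact h3
      · exact absurd h3.2.1 h2
    have c1 := const_of_forall_pred (g := fun x => F (a x).1) (k := 0) (l := m) fun x h1 h2 =>
      e1 x h1 (by omega) (by omega)
    have c2 := const_of_forall_pred (g := fun x => F (a x).1) (k := m) (l := N - m) fun x h1 h2 =>
      e1 x (by omega) (by omega) (by omega)
    refine ⟨fun x h1 h2 => ?_, c2⟩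
    have s : S.nodeSum F (S.node (a m)) = F (a m).1 + F (a (N - 1 - m)).1 := by
      refine nodeSum_eq_add (x := a m) (y := flip (a (N - 1 - m))) h.ne_flip ?_ ?_
      · have e := h.node_eq (x := N - m) (by omega) (by omega)
        rw [show N - m - 1 = N - 1 - m by ring] at e
        rw [h.node_eq (x := m) (by omega) (by omega), h.refl (m - 1) (by omega) (by omega), flip_flip,
          show N - 1 - (m - 1) = N - m by ring, e, opp_opp]
      · intro l hl hl'
        rcases h.letter_eq_of_node_eq (hs _ hl') hm (by omega) hl with h3 | h3
        · exact Or.inl h3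
        · exact Or.inr h3.2.2
    rw [e2 m (by omega) (by omega)] at s
    have t := c2 (N - 1 - m) (by omega) (by omega)
    have t' := c1 (m - 1) (by omega) (by omega)
    beta_reduce at t t'
    rw [c1 x h1 h2]
    linarith
  rcases lt_or_ge x m with h1 | h1
  · exact ⟨2, fun F hF hs => (main F hF hs).1 x hx h1⟩
  rcases lt_or_ge x (N - m) with h2 | h2
  · exact ⟨1, fun F hF hs => by rw [(main F hF hs).2 x h1 h2, one_mul]⟩
  · refine ⟨2, fun F hF hs => ?_⟩
    have := h.refl (N - 1 - x) (by omega) (by omega)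
    rw [show N - 1 - (N - 1 - x) = x by ring] at this
    rw [← (main F hF hs).1 (N - 1 - x) (by omega) (by omega), this, flip_fst]

end ElementaryRouteWalk

theorem RouteWalk.reverse (h : S.RouteWalk a N) : S.RouteWalk (fun k => flip (a (N - 1 - k))) N where
  pos := h.pos
  step k h0 hk := by
    apply S.step_flip
    have := h.step (N - 1 - (k + 1)) (by omega) (by omega)
    rwa [show N - 1 - (k + 1) + 1 = N - 1 - k by ring] at this
  first := by simpa using h.last
  last := by simpa using h.first

theorem ElementaryRouteWalk.reverse (h : S.ElementaryRouteWalk a N m) :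
    S.ElementaryRouteWalk (fun k => flip (a (N - 1 - k))) N m where
  toRouteWalk := h.toRouteWalk.reverse
  nonneg := h.nonneg
  lt := h.lt
  refl t h0 ht := by
    rw [show N - 1 - (N - 1 - t) = t by ring, h.refl t h0 ht, flip_flip]
  eq_of_tail_eq x y hx hxy hy he := by
    have tl : ∀ z, 0 < z → z < N → Q.tail (flip (a (N - 1 - z))) = Q.tail (a (N - z)) := by
      intro z hz hzN
      have e := h.node_eq (x := N - z) (by omega) (by omega)
      rw [show N - z - 1 = N - 1 - z by ring] at e
      exact (congrArg Prod.fst e).symm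
    rw [tl y (by omega) hy] at he
    rcases hx.eq_or_lt with rfl | hx
    · exfalso
      have h1 := h.tail_mem_inner (x := N - y) (by omega) (by omega)
      rw [← he, tail_flip, sub_zero] at h1
      exact h.last h1
    · rw [tl x hx (by omega)] at he
      have := h.eq_of_tail_eq (N - y) (N - x) (by omega) (by omega) (by omega) he.symm
      omega

/-- Once the letters at `0` and at the junction are fixed, every further letter is forced. The
lengths agree because a walk stops at an outer vertex and passes only through inner ones. -/
theorem ElementaryRouteWalk.eq_of_eq (h : S.ElementaryRouteWalk a N m) (h' : S.RouteWalk b N')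
    (hT : ∀ k, 0 ≤ k → k < N' → ∃ l, 0 ≤ l ∧ l < N ∧ (a l).1 = (b k).1) (h0 : b 0 = a 0)
    (hm : m < N' → b m = a m) : N' = N ∧ ∀ k, 0 ≤ k → k < N → b k = a k := by
  have key : ∀ k, 0 ≤ k → k < N → k < N' → b k = a k := by
    intro k hk
    induction k, hk using Int.leInduction with
    | base => exact fun _ _ => h0
    | succ k hk ih =>
      intro h1 h2
      have e : S.node (b (k + 1)) = S.node (a (k + 1)) := by
        rw [h.node_eq (by omega) h1, h'.node_eq (by omega) h2, add_sub_cancel_right,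
          ih (by omega) (by omega)]
      rcases h.letter_eq_of_node_eq (hT _ (by omega) h2) (by omega) h1 e with h3 | ⟨-, h3, -⟩
      · exact h3
      · rw [h3]
        exact hm (by omega)
  have hN := h.pos
  have hN' := h'.pos
  have hNN : N' = N := by
    rcases lt_trichotomy N' N with h1 | h1 | h1
    · exfalso
      have h2 := h.tail_mem_inner hN' h1
      have h3 := congrArg Prod.fst (h.node_eq hN' h1)
      simp only [node_fst, opp, tail_flip] at h3
      rw [h3, ← key _ (by omega) (by omega) (by omega)] at h2
      exact h'.last h2
    · exact h1
    · exfalso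
      have h2 := h'.tail_mem_inner hN h1
      have h3 := congrArg Prod.fst (h'.node_eq hN h1)
      simp only [node_fst, opp, tail_flip] at h3
      rw [h3, key _ (by omega) (by omega) (by omega)] at h2
      exact h.last h2
  exact ⟨hNN, fun k h1 h2 => key k h1 h2 (by omega)⟩

/-- An elementary route is determined by its support, up to inversion. -/
theorem ElementaryRouteWalk.eq_or_eq_reverse (h : S.ElementaryRouteWalk a N m)
    (h' : S.RouteWalk b N')
    (hT : ∀ k, 0 ≤ k → k < N' → ∃ l, 0 ≤ l ∧ l < N ∧ (a l).1 = (b k).1) :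
    N' = N ∧ ((∀ k, 0 ≤ k → k < N → b k = a k) ∨
      ∀ k, 0 ≤ k → k < N → b k = flip (a (N - 1 - k))) := by
  have hN := h.pos
  have hm := h.nonneg
  have hlt := h.lt
  have hT' : ∀ k, 0 ≤ k → k < N' →
      ∃ l, 0 ≤ l ∧ l < N ∧ ((fun k => flip (a (N - 1 - k))) l).1 = (b k).1 := by
    intro k h1 h2
    obtain ⟨l, h3, h4, h5⟩ := hT k h1 h2
    exact ⟨N - 1 - l, by omega, by omega, by simpa using h5⟩
  -- A route starts at an outer vertex, and only the two ends of `a` are outer.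
  have hb0 : b 0 = a 0 ∨ b 0 = flip (a (N - 1)) := by
    obtain ⟨l, h1, h2, h3⟩ := hT 0 le_rfl h'.pos
    rcases fst_eq_iff.1 h3.symm with h4 | h4
    · left
      rcases h1.eq_or_lt with rfl | h1
      · exact h4
      · have := h.tail_mem_inner h1 h2
        rw [← h4] at this
        exact absurd this h'.first
    · right
      by_cases h5 : l = N - 1
      · rw [h4, h5]
      · have h6 := h.tail_mem_inner (x := l + 1) (by omega) (by omega)
        have h7 := congrArg Prod.fst (h.node_eq (x := l + 1) (by omega) (by omega))
        simp only [node_fst, opp, add_sub_cancel_right] at h7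
        rw [h7, ← h4] at h6
        exact absurd h6 h'.first
  rcases hm.eq_or_lt with rfl | hm
  · rcases hb0 with h1 | h1
    · obtain ⟨h2, h3⟩ := h.eq_of_eq h' hT h1 fun _ => h1
      exact ⟨h2, Or.inl h3⟩
    · obtain ⟨h2, h3⟩ := h.reverse.eq_of_eq h' hT' (by simpa using h1) fun _ => by simpa using h1
      exact ⟨h2, Or.inr h3⟩
  · have h1 : b 0 = a 0 := by
      rcases hb0 with h1 | h1
      · exact h1
      · rw [h1, h.refl 0 le_rfl hm, sub_zero]
    by_cases h2 : m < N' → b m = a m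
    · obtain ⟨h2, h3⟩ := h.eq_of_eq h' hT h1 h2
      exact ⟨h2, Or.inl h3⟩
    · push Not at h2
      obtain ⟨h2, h3⟩ := h2
      have e : ∀ k, 0 ≤ k → k < m → b k = a k := by
        intro k hk
        induction k, hk using Int.leInduction with
        | base => exact fun _ => h1
        | succ k hk ih =>
          intro h4
          have e : S.node (b (k + 1)) = S.node (a (k + 1)) := by
            rw [h.node_eq (by omega) (by omega), h'.node_eq (by omega) (by omega),
              add_sub_cancel_right, ih (by omega)]
          rcases h.letter_eq_of_node_eq (hT _ (by omega) (by omega)) (by omega) (by omega) e with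
            h5 | ⟨-, h5, -⟩
          · exact h5
          · omega
      have e' : S.node (b m) = S.node (a m) := by
        rw [h.node_eq (by omega) (by omega), h'.node_eq (by omega) (by omega),
          e _ (by omega) (by omega)]
      -- `b` takes the loop in the other direction; then it follows the inverse of `a`, which has
      -- the same first `m` letters.
      have h4 : b m = flip (a (N - 1 - m)) := by
        rcases h.letter_eq_of_node_eq (hT _ (by omega) (by omega)) (by omega) (by omega) e' with
          h5 | ⟨-, -, h5⟩
        · exact absurd h5 h3
        · exact h5
      obtain ⟨h5, h6⟩ := h.reverse.eq_of_eq h' hT' (by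
        rw [h1, h.refl 0 le_rfl hm]) fun _ => h4
      exact ⟨h5, Or.inr h6⟩

end Sides
end BoundQuiver

namespace BoundQuiver

variable {V E : Type*} {Q : BoundQuiver V E}

/-! ### Routes as words -/

theorem vertexSeq_eq {w : List (SArrow E)} (hw : w ≠ []) (hc : w.IsChain Q.Step) :
    Q.vertexSeq w = w.map Q.tail ++ [Q.head (w.getLast hw)] := by
  cases w with
  | nil => exact absurd rfl hw
  | cons x w =>
    simp only [vertexSeq]
    induction w generalizing x with
    | nil => simp
    | cons y w ih =>
      rw [List.isChain_cons_cons] at hc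
      have := ih y (by simp) hc.2
      rw [List.map_cons, hc.1.1, this]
      simp

theorem vertexSeq_closed_tail_perm {w : List (SArrow E)} (hw : w ≠ []) (hc : w.IsChain Q.Step)
    (h : Q.head (w.getLast hw) = Q.tail (w.head hw)) :
    (Q.vertexSeq w).tail.Perm (w.map Q.tail) := by
  have h1 := vertexSeq_eq hw hc
  cases w with
  | nil => exact absurd rfl hw
  | cons x w =>
    rw [h] at h1
    simp only [vertexSeq, List.head_cons] at h1 ⊢
    rw [List.tail_cons, ← List.perm_cons (Q.tail x), h1]
    exact List.perm_append_singleton _ _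

theorem isChain_iff_cyc {w : List (SArrow E)} (hw : w ≠ []) : w.IsChain Q.Step ↔
    ∀ k : ℤ, 0 ≤ k → k + 1 < w.length → Q.Step (cyc w hw k) (cyc w hw (k + 1)) := by
  rw [List.isChain_iff_getElem]
  constructor
  · intro h k h0 hk
    obtain ⟨k, rfl⟩ := Int.eq_ofNat_of_zero_le h0
    have := h k (by omega)
    rw [← cyc_natCast w hw, ← cyc_natCast w hw] at this
    exact_mod_cast this
  · intro h k hk
    rw [← cyc_natCast w hw, ← cyc_natCast w hw]
    exact_mod_cast h k (by omega) (by omega)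

theorem cyc_zero {w : List (SArrow E)} (hw : w ≠ []) : cyc w hw 0 = w.head hw := by
  have := cyc_natCast w hw 0 (List.length_pos_iff.2 hw)
  rw [List.head_eq_getElem]
  exact_mod_cast this

theorem cyc_length_sub_one {w : List (SArrow E)} (hw : w ≠ []) : cyc w hw (w.length - 1) = w.getLast hw := by
  have h0 := List.length_pos_iff.2 hw
  have := cyc_natCast w hw (w.length - 1) (by omega)
  rw [List.getLast_eq_getElem, ← this]
  congr 1
  omega

namespace Sides

variable (S : Q.Sides) {w : List (SArrow E)} (hw : w ≠ [])

/-- A string that ends at an inner vertex can be continued, and no step leads through an outer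
vertex; so maximality means that both ends are outer. -/
theorem isRoute_iff : Q.IsRoute w ↔ S.RouteWalk (cyc w hw) w.length := by
  have h0 := List.length_pos_iff.2 hw
  constructor
  · rintro ⟨⟨-, h1⟩, h2, h3⟩
    refine ⟨by exact_mod_cast h0, (isChain_iff_cyc hw).1 h1, fun hv => ?_, fun hv => ?_⟩
    · rw [cyc_zero hw] at hv
      obtain ⟨b, hb, -⟩ := S.exists_step (a := flip (w.head hw)) (by simpa using hv) true
      have hb' := S.step_flip hb
      rw [flip_flip] at hb'
      refine h2 (flip b) ⟨by simp, ?_⟩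
      rw [List.isChain_cons]
      refine ⟨fun y hy => ?_, h1⟩
      rw [List.head?_eq_some_head hw] at hy
      simp at hy
      rwa [← hy]
    · rw [cyc_length_sub_one hw] at hv
      obtain ⟨b, hb, -⟩ := S.exists_step hv true
      refine h3 b ⟨by simp, ?_⟩
      rw [List.isChain_append]
      refine ⟨h1, by simp, fun x hx y hy => ?_⟩
      rw [List.getLast?_eq_some_getLast hw] at hx
      simp at hx hy
      rwa [← hx, ← hy]
  · intro h
    refine ⟨⟨hw, (isChain_iff_cyc hw).2 h.step⟩, ?_, ?_⟩
    · rintro b ⟨-, hb⟩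
      rw [List.isChain_cons] at hb
      have := hb.1 (w.head hw) (by simp [List.head?_eq_some_head hw])
      apply h.first
      rw [cyc_zero hw]
      exact S.tail_mem_inner_of_step this
    · rintro b ⟨-, hb⟩
      rw [List.isChain_append] at hb
      have := hb.2.2 (w.getLast hw) (by simp [List.getLast?_eq_some_getLast hw]) b (by simp)
      apply h.last
      rw [cyc_length_sub_one hw, this.1]
      exact S.tail_mem_inner_of_step this

/-- A fold of the walk lies on the stick, whose letters are mirrored down to the outer vertex. The
passes never part in that direction, as they would have to for a kiss. -/
theorem ElementaryRouteWalk.selfCompatible {S : Q.Sides} {m : ℤ}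
    (h : S.ElementaryRouteWalk (cyc w hw) w.length m) : Q.SelfCompatible (routeFactors w) := by
  intro hk
  obtain ⟨i, j, k, hi, ⟨h1, h2, h3, h4, h5⟩ | ⟨hf, hj, h1, h2, h3, h4⟩⟩ :=
    exists_of_kiss S (a := cyc w hw) (dom := fun k => 0 ≤ k ∧ k < w.length) (fun f hf => by
      obtain ⟨k, h1, h2, h3⟩ := mem_routeFactors hw hf
      exact ⟨k, h3, fun t h4 h5 => by omega⟩) (fun k h1 h2 => h.step k h1.1 h2.2) hk
  · have hi1 := hi 1 (by omega) (by omega)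
    rw [sub_add_cancel] at hi1
    have := h.eq_of_node_eq hi1.1 hi1.2 h2.1 h2.2 h3
    subst this
    rw [h4] at h5
    simp at h5
  · have a1 := hi 0 le_rfl (by omega)
    have a2 := hi 1 (by omega) (by omega)
    have a3 := hi (k + 1) (by omega) (by omega)
    have b1 := hj 0 le_rfl (by omega)
    have b2 := hj (k + 1) (by omega) (by omega)
    have hm := h.lt
    obtain ⟨h5, h6⟩ := h.add_eq_of_node_eq_opp (x := i) (y := j) (by omega) (by omega) (by omega)
      (by omega) hf.node_eq
    rcases h6 with h6 | h6
    · have := h.refl (i - 1) (by omega) (by omega)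
      rw [show (w.length : ℤ) - 1 - (i - 1) = j by omega] at this
      rw [this] at h1
      simp [h3] at h1
    · have := h.refl (j - 1 - k) (by omega) (by omega)
      rw [show (w.length : ℤ) - 1 - (j - 1 - k) = i + k by omega] at this
      rw [this] at h4
      simp [h2] at h4

theorem elementaryRouteWalk_of_isSimple (h : Q.IsRoute w) (hs : Q.IsSimple w) :
    S.ElementaryRouteWalk (cyc w hw) w.length 0 where
  toRouteWalk := (S.isRoute_iff hw).1 h
  nonneg := le_rfl
  lt := by simpa using List.length_pos_iff.2 hw
  refl t h0 ht := by omega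
  eq_of_tail_eq x y hx hxy hy he := by
    exfalso
    obtain ⟨x, rfl⟩ := Int.eq_ofNat_of_zero_le hx
    obtain ⟨y, rfl⟩ := Int.eq_ofNat_of_zero_le (hx.trans hxy.le)
    have h1 : (w.map Q.tail).Nodup := by
      have : (Q.vertexSeq w).Nodup := hs
      rw [vertexSeq_eq hw h.1.2] at this
      exact this.of_append_left
    rw [cyc_natCast w hw x (by omega), cyc_natCast w hw y (by omega)] at he
    have := (h1.getElem_inj_iff (i := x) (hi := by simp; omega) (j := y)
      (hj := by simp; omega)).1 (by simpa using he)
    omega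

/-- The words of the form `R σ R⁻¹` without further repeated vertices. -/
theorem elementaryRouteWalk_of_nodup {R σ : List (SArrow E)} (hσ : σ ≠ [])
    (hw : R ++ σ ++ inv R ≠ []) (h : Q.IsRoute (R ++ σ ++ inv R))
    (hn : ((R ++ σ).map Q.tail).Nodup) :
    S.ElementaryRouteWalk (cyc (R ++ σ ++ inv R) hw) (R ++ σ ++ inv R).length R.length := by
  have hr := (S.isRoute_iff hw).1 h
  have h0 := List.length_pos_iff.2 hσ
  have hl : (R ++ σ ++ inv R).length = R.length + σ.length + R.length := by
    simp [add_assoc]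
  have t1 : ∀ (k : ℕ) (hk : k < (R ++ σ).length), Q.tail (cyc (R ++ σ ++ inv R) hw k) =
      ((R ++ σ).map Q.tail)[k]'(by simpa using hk) := by
    intro k hk
    rw [cyc_natCast _ hw k (by simp at hk ⊢; omega), List.getElem_append_left hk,
      List.getElem_map]
  have rf : ∀ t : ℕ, t < R.length → cyc (R ++ σ ++ inv R) hw t =
      flip (cyc (R ++ σ ++ inv R) hw (((R ++ σ ++ inv R).length - 1 - t : ℕ) : ℤ)) := by
    intro t ht
    have e1 : (R ++ σ ++ inv R)[t]'(by omega) = R[t] := by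
      rw [List.getElem_append_left (by simp; omega), List.getElem_append_left ht]
    have e2 : (R ++ σ ++ inv R)[(R ++ σ ++ inv R).length - 1 - t]'(by omega) = flip R[t] := by
      rw [List.getElem_append_right (by simp; omega), getElem_inv]
      congr 2
      simp
      omega
    rw [cyc_natCast _ hw t (by omega), cyc_natCast _ hw _ (by omega), e1, e2, flip_flip]
  -- On the way back along `inv R`, the vertex at `k` is the one that was passed at the total length
  -- minus `k`.
  have t2 : ∀ k : ℕ, R.length + σ.length ≤ k → k < (R ++ σ ++ inv R).length →
      Q.tail (cyc (R ++ σ ++ inv R) hw k) =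
        Q.tail (cyc (R ++ σ ++ inv R) hw ((R ++ σ ++ inv R).length - k : ℕ)) := by
    intro k h1 h2
    have e := rf ((R ++ σ ++ inv R).length - 1 - k) (by omega)
    rw [show (R ++ σ ++ inv R).length - 1 - ((R ++ σ ++ inv R).length - 1 - k) = k by omega] at e
    have e' := (hr.step ((R ++ σ ++ inv R).length - 1 - k : ℕ) (by omega) (by omega)).1
    rw [e, head_flip] at e'
    rw [e']
    congr 2
    omega
  refine ⟨hr, by omega, by omega, fun t h1 h2 => ?_, fun x y hx hxy hy he => ?_⟩
  · obtain ⟨t, rfl⟩ := Int.eq_ofNat_of_zero_le h1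
    rw [rf t (by omega)]
    congr 2
    omega
  · obtain ⟨x, rfl⟩ := Int.eq_ofNat_of_zero_le hx
    obtain ⟨y, rfl⟩ := Int.eq_ofNat_of_zero_le (hx.trans hxy.le)
    have inj : ∀ x y : ℕ, x < (R ++ σ).length → y < (R ++ σ).length →
        Q.tail (cyc (R ++ σ ++ inv R) hw x) = Q.tail (cyc (R ++ σ ++ inv R) hw y) → x = y := by
      intro x y h1 h2 h3
      rw [t1 x h1, t1 y h2] at h3
      exact (hn.getElem_inj_iff).1 h3
    simp only [List.length_append] at inj
    rcases Nat.lt_or_ge y (R.length + σ.length) with h1 | h1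
    · have := inj x y (by omega) h1 he
      omega
    · rw [t2 y h1 (by omega)] at he
      rcases Nat.lt_or_ge x (R.length + σ.length) with h2 | h2
      · have := inj _ _ h2 (by omega) he
        omega
      · rw [t2 x h2 (by omega)] at he
        have := inj _ _ (by omega) (by omega) he
        omega

theorem exists_elementaryRouteWalk (h : Q.IsRoute w) (hs : Q.IsSimple w ∨ Q.IsLollipop w) :
    ∃ m, S.ElementaryRouteWalk (cyc w hw) w.length m := by
  rcases hs with hs | ⟨R, σ, hR, hσ, rfl, h1, h2, h3, h4⟩
  · exact ⟨0, S.elementaryRouteWalk_of_isSimple hw h hs⟩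
  · refine ⟨R.length, S.elementaryRouteWalk_of_nodup hσ hw h ?_⟩
    have hc := h.1.2
    rw [List.isChain_append, List.isChain_append] at hc
    have e1 := vertexSeq_eq hR hc.1.1
    have e2 := vertexSeq_eq hσ hc.1.2.1
    have e3 : Q.head (σ.getLast hσ) = Q.tail (σ.head hσ) := by
      rw [List.head?_eq_some_head (by simp [e2]), List.getLast?_eq_some_getLast (by simp [e2])] at h2
      have h5 := Option.some.inj h2
      simp only [e2] at h5
      rw [List.getLast_append_singleton, List.head_append_of_ne_nil (by simpa using hσ)] at h5
      rw [← h5]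
      simp
    rw [e1] at h1
    rw [List.map_append, List.nodup_append']
    refine ⟨h1.of_append_left, (vertexSeq_closed_tail_perm hσ hc.1.2.1 e3).nodup_iff.1 h3, ?_⟩
    intro v hv hv'
    have h5 := h4 v (by rw [e1]; simp only [List.mem_append]; exact Or.inl hv)
      (by rw [e2]; simp only [List.mem_append]; exact Or.inl hv')
    rw [e1, List.getLast?_append_of_ne_nil _ (by simp)] at h5
    simp at h5
    rw [List.nodup_append'] at h1
    exact h1.2.2 hv (by simp [h5])

theorem isLollipop_of_nodup {R σ : List (SArrow E)} (hR : R ≠ []) (hσ : σ ≠ [])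
    (hc : (R ++ σ).IsChain Q.Step) (hn : ((R ++ σ).map Q.tail).Nodup)
    (he : Q.head (σ.getLast hσ) = Q.tail (σ.head hσ)) : Q.IsLollipop (R ++ σ ++ inv R) := by
  rw [List.isChain_append] at hc
  rw [List.map_append, List.nodup_append'] at hn
  have e1 := vertexSeq_eq hR hc.1
  have e2 := vertexSeq_eq hσ hc.2.1
  have e3 : Q.head (R.getLast hR) = Q.tail (σ.head hσ) :=
    (hc.2.2 _ (by simp [List.getLast?_eq_some_getLast hR]) _
      (by simp [List.head?_eq_some_head hσ])).1
  have e4 : Q.tail (σ.head hσ) ∈ σ.map Q.tail := List.mem_map.2 ⟨_, List.head_mem hσ, rfl⟩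
  refine ⟨R, σ, hR, hσ, rfl, ?_, ?_,
    (vertexSeq_closed_tail_perm hσ hc.2.1 he).nodup_iff.2 hn.2.1, ?_⟩
  · rw [e1, List.nodup_append']
    refine ⟨hn.1, by simp, fun v hv hv' => hn.2.2 hv ?_⟩
    simp at hv'
    rw [hv', e3]
    exact e4
  · rw [e2, he, List.getLast?_append_of_ne_nil _ (by simp), List.head?_append_of_ne_nil _ (by simpa using hσ),
      List.head?_map, List.head?_eq_some_head hσ]
    rfl
  · intro v hv hv'
    rw [e1, List.getLast?_append_of_ne_nil _ (by simp), e3]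
    have hv'' : v ∈ σ.map Q.tail := by
      rw [e2, he] at hv'
      simp only [List.mem_append, List.mem_singleton] at hv'
      rcases hv' with h | h
      · exact h
      · rw [h]
        exact e4
    rw [e1, e3] at hv
    simp only [List.mem_append, List.mem_singleton] at hv
    rcases hv with h | h
    · exact absurd hv'' (fun h' => hn.2.2 h h')
    · simp [h]

end Sides
end BoundQuiver

namespace BoundQuiver

variable {V E : Type*} {Q : BoundQuiver V E}

/-! ### Indicator vectors -/

open Classical in
theorem wordIndicator_cons (x : SArrow E) (w : List (SArrow E)) (α : E) :
    wordIndicator (x :: w) α = (if x.1 = α then 1 else 0) + wordIndicator w α := by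
  simp only [wordIndicator, List.map_cons, List.count_cons, beq_iff_eq]
  split_ifs <;> push_cast <;> ring

theorem wordIndicator_nonneg (w : List (SArrow E)) (α : E) : 0 ≤ wordIndicator w α := by
  simp [wordIndicator]

theorem wordIndicator_ne_zero_iff {w : List (SArrow E)} {α : E} :
    wordIndicator w α ≠ 0 ↔ ∃ l ∈ w, l.1 = α := by
  classical
  simp only [wordIndicator, ne_eq, Nat.cast_eq_zero, List.count_eq_zero, not_not, List.mem_map]

open Classical in
theorem sum_mul_wordIndicator [Fintype E] (g : E → ℝ) (w : List (SArrow E)) :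
    ∑ α, g α * wordIndicator w α = (w.map fun l => g l.1).sum := by
  induction w with
  | nil => simp [wordIndicator]
  | cons x w ih =>
    simp only [wordIndicator_cons, mul_add, Finset.sum_add_distrib, ih]
    simp

namespace Sides

variable {S : Q.Sides}

open Classical in
-- Inside a word each departure by the side `ν` follows an arrival by the opposite side; only the
-- first departure and the last arrival are unmatched.
theorem sum_node_add {w : List (SArrow E)} (hw : w ≠ []) (hc : w.IsChain Q.Step) (ν : V × Bool) :
    (w.map fun l => if S.node l = ν then (1 : ℝ) else 0).sum +
      (if S.node (flip (w.getLast hw)) = opp ν then 1 else 0) =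
    (w.map fun l => if S.node (flip l) = opp ν then (1 : ℝ) else 0).sum +
      (if S.node (w.head hw) = ν then 1 else 0) := by
  cases w with
  | nil => exact absurd rfl hw
  | cons x w =>
    induction w generalizing x with
    | nil =>
      simp only [List.map_cons, List.map_nil, List.sum_cons, List.sum_nil, add_zero,
        List.getLast_singleton, List.head_cons]
      exact add_comm _ _
    | cons y w ih =>
      rw [List.isChain_cons_cons] at hc
      have h1 := ih y (by simp) hc.2
      have h2 : S.node y = ν ↔ S.node (flip x) = opp ν := by
        rw [S.step_iff_node.1 hc.1]
        exact ⟨fun h => opp_eq_comm.1 h.symm, fun h => by rw [h, opp_opp]⟩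
      rw [List.map_cons, List.sum_cons, List.getLast_cons (by simp), List.head_cons,
        List.map_cons (l := y :: w), List.sum_cons, add_assoc, h1]
      simp only [List.head_cons, h2]
      ring

variable [Fintype E]

open Classical in
theorem nodeSum_wordIndicator (w : List (SArrow E)) (ν : V × Bool) :
    S.nodeSum (wordIndicator w) ν = (w.map fun l => if S.node l = ν then (1 : ℝ) else 0).sum +
      (w.map fun l => if S.node (flip l) = ν then (1 : ℝ) else 0).sum := by
  induction w with
  | nil => simp [nodeSum, wordIndicator]
  | cons x w ih =>
    have h1 : (∑ l : SArrow E, if S.node l = ν then (if x.1 = l.1 then (1 : ℝ) else 0) else 0) =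
        (if S.node x = ν then 1 else 0) + if S.node (flip x) = ν then 1 else 0 := by
      rw [Finset.sum_eq_add x (flip x) (flip_ne x).symm]
      · simp
      · intro l _ hl
        split_ifs with h2 h3
        · rcases fst_eq_iff.1 h3.symm with h4 | h4
          · exact absurd h4 hl.1
          · exact absurd h4 hl.2
        · rfl
        · rfl
      · simp
      · simp
    have h2 : S.nodeSum (wordIndicator (x :: w)) ν =
        (∑ l : SArrow E, if S.node l = ν then (if x.1 = l.1 then (1 : ℝ) else 0) else 0) +
          S.nodeSum (wordIndicator w) ν := by
      rw [nodeSum, nodeSum, ← Finset.sum_add_distrib]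
      refine Finset.sum_congr rfl fun l _ => ?_
      rw [wordIndicator_cons]
      split_ifs <;> simp
    rw [h2, h1, ih]
    simp only [List.map_cons, List.sum_cons]
    ring

/-- A letter contributes at both of its ends. Matching arrivals with departures for `ν` and for `opp
ν` gives both side totals, provided that the two ends of the word compensate each other or lie at
outer vertices. -/
theorem conserved_wordIndicator {w : List (SArrow E)} (hw : w ≠ []) (hc : w.IsChain Q.Step)
    (h : ∀ ν : V × Bool, ν.1 ∈ S.inner →
      (S.node (w.head hw) = ν ↔ S.node (flip (w.getLast hw)) = opp ν)) :
    S.Conserved (wordIndicator w) := by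
  classical
  intro ν hν
  rw [nodeSum_wordIndicator, nodeSum_wordIndicator]
  have h1 := sum_node_add (S := S) hw hc ν
  have h2 := sum_node_add (S := S) hw hc (opp ν)
  simp only [h ν hν] at h1
  simp only [h (opp ν) hν, opp_opp] at h2
  linarith

theorem conserved_wordIndicator_of_isClosedWalk {w : List (SArrow E)} (hw : w ≠ [])
    (hc : Q.IsClosedWalk (cyc w hw) w.length) : S.Conserved (wordIndicator w) := by
  refine conserved_wordIndicator hw ((isChain_iff_cyc hw).2 fun k _ _ => hc.step k) fun ν _ => ?_
  have := S.node_flip_pred hc 0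
  rw [hc.congr (k := 0 - 1) (l := w.length - 1) ⟨-1, by ring⟩, cyc_zero, cyc_length_sub_one] at this
  rw [this]
  exact ⟨fun h => by rw [h], fun h => by rw [← opp_opp (S.node _), h, opp_opp]⟩

theorem conserved_wordIndicator_of_isRoute {w : List (SArrow E)} (h : Q.IsRoute w) :
    S.Conserved (wordIndicator w) := by
  have hr := (S.isRoute_iff h.1.1).1 h
  refine conserved_wordIndicator h.1.1 h.1.2 fun ν hν => ?_
  have h1 := hr.first
  have h2 := hr.last
  rw [cyc_zero] at h1
  rw [cyc_length_sub_one] at h2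
  constructor
  · rintro rfl
    exact absurd hν h1
  · intro h3
    have h4 := congrArg Prod.fst h3
    simp only [node_fst, tail_flip, opp] at h4
    rw [h4] at h2
    exact absurd hν h2

end Sides

/-! ### Fringe arrows and the strength of routes and bands -/

namespace Fringing

variable {V' E' : Type*} {Q' : BoundQuiver V' E'}

theorem ends_mem_of_mem_range (h : Fringing Q Q') {x : SArrow E'} (hx : x.1 ∈ range h.arr) :
    Q'.tail x ∈ range h.vert ∧ Q'.head x ∈ range h.vert := by
  obtain ⟨α, hα⟩ := hx
  have h1 : Q'.src x.1 ∈ range h.vert := ⟨_, by rw [← hα, h.src_arr]⟩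
  have h2 : Q'.tgt x.1 ∈ range h.vert := ⟨_, by rw [← hα, h.tgt_arr]⟩
  obtain ⟨β, s⟩ := x
  cases s
  · exact ⟨h2, h1⟩
  · exact ⟨h1, h2⟩

theorem mem_range_iff (h : Fringing Q Q') {x : SArrow E'} :
    x.1 ∈ range h.arr ↔ Q'.tail x ∈ range h.vert ∧ Q'.head x ∈ range h.vert := by
  refine ⟨h.ends_mem_of_mem_range, fun hx => ?_⟩
  by_contra h1
  obtain ⟨β, s⟩ := x
  cases s <;> rcases h.fringe_arrow β h1 with h2 | h2
  · exact h2.2 hx.1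
  · exact h2.1 hx.2
  · exact h2.2 hx.2
  · exact h2.1 hx.1

theorem tail_or_head_mem (h : Fringing Q Q') (x : SArrow E') :
    Q'.tail x ∈ range h.vert ∨ Q'.head x ∈ range h.vert := by
  by_cases h1 : x.1 ∈ range h.arr
  · exact Or.inl (h.ends_mem_of_mem_range h1).1
  · obtain ⟨β, s⟩ := x
    cases s <;> rcases h.fringe_arrow β h1 with h2 | h2
    · exact Or.inr h2.1
    · exact Or.inl h2.2
    · exact Or.inl h2.1
    · exact Or.inr h2.2

variable [Fintype E']

open Classical in
theorem strength_wordIndicator (h : Fringing Q Q') (w : List (SArrow E')) :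
    h.strength (wordIndicator w) =
      1 / 2 * (w.map fun l => if l.1 ∈ range h.arr then (0 : ℝ) else 1).sum := by
  rw [strength, ← sum_mul_wordIndicator fun α => if α ∈ range h.arr then (0 : ℝ) else 1]
  congr 1
  refine Finset.sum_congr rfl fun α _ => ?_
  split_ifs <;> simp

theorem strength_wordIndicator_of_isClosedWalk (h : Fringing Q Q') (S : Q'.Sides)
    (hS : S.inner = range h.vert) {w : List (SArrow E')} (hw : w ≠ [])
    (hc : Q'.IsClosedWalk (cyc w hw) w.length) : h.strength (wordIndicator w) = 0 := by
  classical
  rw [h.strength_wordIndicator, mul_eq_zero]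
  right
  apply List.sum_eq_zero
  simp only [List.mem_map]
  rintro _ ⟨l, hl, rfl⟩
  obtain ⟨k, -, rfl⟩ := exists_cyc_eq hw hl
  have h1 := S.tail_mem_inner hc k
  have h2 := S.tail_mem_inner hc (k + 1)
  rw [← (hc.step k).1] at h2
  rw [hS] at h1 h2
  rw [if_pos (h.mem_range_iff.2 ⟨h1, h2⟩)]

/-- Only the first and the last letter touch fringe vertices, and each contributes one half. -/
theorem strength_wordIndicator_of_isRoute (h : Fringing Q Q') (S : Q'.Sides)
    (hS : S.inner = range h.vert) {w : List (SArrow E')} (hr : Q'.IsRoute w) :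
    h.strength (wordIndicator w) = 1 := by
  classical
  have hw := hr.1.1
  have hr' := (S.isRoute_iff hw).1 hr
  have h1 := hr'.first
  have h2 := hr'.last
  rw [cyc_zero, hS] at h1
  rw [cyc_length_sub_one, hS] at h2
  have hch := hr.1.2
  rw [h.strength_wordIndicator]
  obtain ⟨x, u, rfl⟩ := List.exists_cons_of_ne_nil hw
  rcases List.eq_nil_or_concat' u with rfl | ⟨u, y, rfl⟩
  -- A route has at least two letters, since no arrow joins two fringe vertices.
  · exact absurd (h.tail_or_head_mem x) (by simpa using ⟨by simpa using h1, by simpa using h2⟩)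
  · have hx : x.1 ∉ range h.arr := fun hx => h1 (h.ends_mem_of_mem_range hx).1
    have hy : y.1 ∉ range h.arr := fun hy => h2 (by simpa using (h.ends_mem_of_mem_range hy).2)
    have hu : (u.map fun l => if l.1 ∈ range h.arr then (0 : ℝ) else 1).sum = 0 := by
      apply List.sum_eq_zero
      simp only [List.mem_map]
      rintro _ ⟨l, hl, rfl⟩
      obtain ⟨s, t, rfl⟩ := List.append_of_mem hl
      rw [if_pos]
      rw [h.mem_range_iff, ← hS]
      have e1 : (x :: (s ++ l :: t ++ [y])) = (x :: s) ++ (l :: (t ++ [y])) := by simp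
      rw [e1, List.isChain_append] at hch
      constructor
      · exact S.tail_mem_inner_of_step (hch.2.2 _ (by
          rw [List.getLast?_eq_some_getLast (by simp : x :: s ≠ [])]; rfl) l (by simp))
      · have h3 := hch.2.1
        obtain ⟨z, r, hz⟩ := List.exists_cons_of_ne_nil (show t ++ [y] ≠ [] by simp)
        rw [hz, List.isChain_cons_cons] at h3
        rw [h3.1.1]
        exact S.tail_mem_inner_of_step h3.1
    rw [List.map_cons, List.sum_cons, List.map_append, List.sum_append, hu, if_neg hx]
    simp only [List.map_cons, List.map_nil, List.sum_cons, List.sum_nil, if_neg hy]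
    norm_num

end Fringing
end BoundQuiver

namespace BoundQuiver

variable {V E : Type*} {Q : BoundQuiver V E}

/-! ### Existence of elementary trails -/

theorem map_head_eq {w : List (SArrow E)} (hw : w ≠ []) (hc : w.IsChain Q.Step) :
    w.map Q.head = (w.map Q.tail ++ [Q.head (w.getLast hw)]).tail := by
  rw [← vertexSeq_eq hw hc]
  cases w with
  | nil => exact absurd rfl hw
  | cons x w => rfl

theorem map_tail_inv (w : List (SArrow E)) : (inv w).map Q.tail = (w.map Q.head).reverse := by
  simp [inv, List.map_reverse, Function.comp_def]

namespace Sides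

theorem isChain_inv (S : Q.Sides) {w : List (SArrow E)} (hc : w.IsChain Q.Step) :
    (inv w).IsChain Q.Step := by
  rw [inv, List.isChain_reverse, List.isChain_map]
  exact hc.imp fun x y h => S.step_flip h

/-- A path which starts with the letter `x`, uses arrows from `A` and does not return to `X`. -/
structure PathFrom (Q : BoundQuiver V E) (A : Set E) (X : Set V) (x : SArrow E)
    (P : List (SArrow E)) : Prop where
  chain : P.IsChain Q.Step
  head_eq : P.head? = some x
  mem : ∀ y ∈ P, y.1 ∈ A
  nodup : (P.map Q.tail).Nodup
  avoid : ∀ y ∈ P.tail, Q.tail y ∉ X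

/-- A closed path without repeated vertices. -/
structure SimpleCycle (Q : BoundQuiver V E) (A : Set E) (c : List (SArrow E)) : Prop where
  ne : c ≠ []
  chain : c.IsChain Q.Step
  closed : Q.Step (c.getLast ne) (c.head ne)
  mem : ∀ y ∈ c, y.1 ∈ A
  nodup : (c.map Q.tail).Nodup

/-- A closed path which leaves its start vertex by the same side by which it returns. -/
structure Hook (S : Q.Sides) (σ : List (SArrow E)) : Prop where
  ne : σ ≠ []
  node_eq : S.node (flip (σ.getLast ne)) = S.node (σ.head ne)

variable {S : Q.Sides} {A : Set E}

theorem Hook.head_getLast {σ : List (SArrow E)} (h : S.Hook σ) :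
    Q.head (σ.getLast h.ne) = Q.tail (σ.head h.ne) := by
  simpa using congrArg Prod.fst h.node_eq

/-- At an outer base the last letter would be the inverse of the first, which is impossible for one
letter, violates the string condition for two, and repeats a vertex for more. -/
theorem Hook.tail_mem_inner {σ : List (SArrow E)} (h : S.Hook σ) (hc : σ.IsChain Q.Step)
    (hn : (σ.map Q.tail).Nodup) : Q.tail (σ.head h.ne) ∈ S.inner := by
  by_contra ho
  have h1 : flip (σ.getLast h.ne) = σ.head h.ne :=
    (S.outer_unique _ _ ho (congrArg Prod.fst h.node_eq).symm).symm
  rcases σ with _ | ⟨x, _ | ⟨y, τ⟩⟩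
  · exact h.ne rfl
  · exact flip_ne _ h1
  · rw [List.isChain_cons_cons] at hc
    rw [List.getLast_cons (by simp)] at h1
    rcases τ with _ | ⟨z, τ⟩
    · exact hc.1.2.1 (by rw [← flip_flip y]; exact congrArg flip h1)
    · rw [List.getLast_cons (by simp)] at h1
      have h3 : (z :: τ).getLast (by simp) ∈ z :: τ := List.getLast_mem _
      have h4 : Q.tail ((z :: τ).getLast (by simp)) = Q.tail y := by
        rw [← hc.1.1, ← head_flip, h1]
        rfl
      simp only [List.map_cons, List.nodup_cons] at hn
      apply hn.2.1
      rw [← h4, ← List.map_cons]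
      exact List.mem_map_of_mem h3

theorem PathFrom.ne {X : Set V} {x : SArrow E} {P : List (SArrow E)} (h : PathFrom Q A X x P) :
    P ≠ [] := fun h' => by
  have := h.head_eq
  simp [h'] at this

theorem PathFrom.head_eq' {X : Set V} {x : SArrow E} {P : List (SArrow E)}
    (h : PathFrom Q A X x P) : P.head h.ne = x := by
  have := h.head_eq
  rw [List.head?_eq_some_head h.ne] at this
  exact Option.some.inj this

/-- Prolong the path by one letter at a time; its vertices stay distinct, so `k` bounds the number
of prolongations. On return to a vertex of the path, arrival by the side opposite to the departure
closes a cycle, and arrival by the same side gives a hook. Otherwise the path stops at an outer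
vertex or in `X`. -/
theorem PathFrom.extend [Finite V] (hA : ∀ x : SArrow E, x.1 ∈ A → Q.head x ∈ S.inner →
    ∃ y, y.1 ∈ A ∧ Q.Step x y) (X : Set V) (x : SArrow E) (k : ℕ) :
    ∀ P, PathFrom Q A X x P → Nat.card V - P.length ≤ k →
    (∃ c, SimpleCycle Q A c) ∨
    (∃ R σ, PathFrom Q A X x (R ++ σ) ∧ S.Hook σ) ∨
    (∃ P, ∃ h : PathFrom Q A X x P, Q.head (P.getLast h.ne) ∉ P.map Q.tail ∧
      (Q.head (P.getLast h.ne) ∉ S.inner ∨ Q.head (P.getLast h.ne) ∈ X)) := by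
  have len : ∀ P, PathFrom Q A X x P → P.length ≤ Nat.card V := by
    intro P hP
    have := Fintype.ofFinite V
    rw [Nat.card_eq_fintype_card]
    simpa using hP.nodup.length_le_card
  have step : ∀ P, ∀ hP : PathFrom Q A X x P,
      (∃ c, SimpleCycle Q A c) ∨
      (∃ R σ, PathFrom Q A X x (R ++ σ) ∧ S.Hook σ) ∨
      (∃ P, ∃ h : PathFrom Q A X x P, Q.head (P.getLast h.ne) ∉ P.map Q.tail ∧
        (Q.head (P.getLast h.ne) ∉ S.inner ∨ Q.head (P.getLast h.ne) ∈ X)) ∨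
      ∃ y, PathFrom Q A X x (P ++ [y]) := by
    intro P hP
    by_cases h1 : Q.head (P.getLast hP.ne) ∈ P.map Q.tail
    · obtain ⟨z, hz, hzt⟩ := List.mem_map.1 h1
      obtain ⟨R, s, rfl⟩ := List.append_of_mem hz
      have hl : (R ++ z :: s).getLast hP.ne = (z :: s).getLast (by simp) :=
        List.getLast_append_of_ne_nil _ (by simp)
      rw [hl] at hzt
      rcases eq_or_eq_opp (μ := S.node z) (ν := S.node (flip ((z :: s).getLast (by simp))))
        (by simpa using hzt) with h2 | h2
      · exact Or.inr (Or.inl ⟨R, z :: s, hP, by simp, h2.symm⟩)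
      · refine Or.inl ⟨z :: s, by simp, hP.chain.right_of_append, S.step_iff_node.2 h2, ?_, ?_⟩
        · exact fun y hy => hP.mem y (List.mem_append_right _ hy)
        · have := hP.nodup
          rw [List.map_append] at this
          exact this.of_append_right
    · by_cases h2 : Q.head (P.getLast hP.ne) ∉ S.inner ∨ Q.head (P.getLast hP.ne) ∈ X
      · exact Or.inr (Or.inr (Or.inl ⟨P, hP, h1, h2⟩))
      · push Not at h2
        obtain ⟨y, hy, hs⟩ := hA _ (hP.mem _ (List.getLast_mem hP.ne)) h2.1
        refine Or.inr (Or.inr (Or.inr ⟨y, ?_, ?_, ?_, ?_, ?_⟩))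
        · rw [List.isChain_append]
          refine ⟨hP.chain, by simp, fun u hu v hv => ?_⟩
          rw [List.getLast?_eq_some_getLast hP.ne] at hu
          simp at hu hv
          rwa [← hu, ← hv]
        · rw [List.head?_append_of_ne_nil _ hP.ne, hP.head_eq]
        · simp only [List.mem_append, List.mem_singleton]
          rintro u (hu | rfl)
          · exact hP.mem u hu
          · exact hy
        · rw [List.map_append, List.nodup_append']
          refine ⟨hP.nodup, by simp, fun v hv hv' => h1 ?_⟩
          simp at hv'
          rwa [hs.1, ← hv']
        · rw [List.tail_append_of_ne_nil hP.ne]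
          simp only [List.mem_append, List.mem_singleton]
          rintro u (hu | rfl)
          · exact hP.avoid u hu
          · rw [← hs.1]
            exact h2.2
  induction k with
  | zero =>
    intro P hP hk
    rcases step P hP with h | h | h | ⟨y, h⟩
    · exact Or.inl h
    · exact Or.inr (Or.inl h)
    · exact Or.inr (Or.inr h)
    · have := len _ h
      simp at this
      omega
  | succ k ih =>
    intro P hP hk
    rcases step P hP with h | h | h | ⟨y, h⟩
    · exact Or.inl h
    · exact Or.inr (Or.inl h)
    · exact Or.inr (Or.inr h)
    · exact ih _ h (by simp; omega)

theorem explore [Finite V] (hA : ∀ x : SArrow E, x.1 ∈ A → Q.head x ∈ S.inner →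
    ∃ y, y.1 ∈ A ∧ Q.Step x y) (X : Set V) {x : SArrow E} (hx : x.1 ∈ A) :
    (∃ c, SimpleCycle Q A c) ∨
    (∃ R σ, PathFrom Q A X x (R ++ σ) ∧ S.Hook σ) ∨
    (∃ P, ∃ h : PathFrom Q A X x P, Q.head (P.getLast h.ne) ∉ P.map Q.tail ∧
      (Q.head (P.getLast h.ne) ∉ S.inner ∨ Q.head (P.getLast h.ne) ∈ X)) :=
  PathFrom.extend hA X x _ [x] ⟨by simp, by simp, by simpa using hx, by simp, by simp⟩ le_rfl

/-- Two hooks with a connecting path. -/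
structure Barbell (S : Q.Sides) (A : Set E) (σ R τ : List (SArrow E)) : Prop where
  left : S.Hook σ
  right : S.Hook τ
  chain : (σ ++ (R ++ τ)).IsChain Q.Step
  mem : ∀ y ∈ σ ++ (R ++ τ), y.1 ∈ A
  -- The first vertex of `R ++ τ` is the base of `σ`, which is already listed. If `R` is empty, both
  -- hooks have this base.
  nodup : (σ.map Q.tail ++ ((R ++ τ).map Q.tail).tail).Nodup

/-- Explore from any arrow. A hook is kept as one loop, and exploration resumes from its base by the
free side; an outer end serves as the start of a second exploration. In each case the new path
completes a cycle, a simple route, a lollipop or a barbell. -/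
theorem exists_trail [Finite V] (hA : ∀ x : SArrow E, x.1 ∈ A → Q.head x ∈ S.inner →
    ∃ y, y.1 ∈ A ∧ Q.Step x y) (hne : A.Nonempty) :
    (∃ c, SimpleCycle Q A c) ∨
    (∃ P, ∃ h : P ≠ [], P.IsChain Q.Step ∧ Q.tail (P.head h) ∉ S.inner ∧
      Q.head (P.getLast h) ∉ S.inner ∧ (∀ y ∈ P, y.1 ∈ A) ∧ (P.map Q.tail).Nodup ∧
      Q.head (P.getLast h) ∉ P.map Q.tail) ∨
    (∃ R σ, ∃ h : R ≠ [], S.Hook σ ∧ (R ++ σ).IsChain Q.Step ∧ Q.tail (R.head h) ∉ S.inner ∧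
      (∀ y ∈ R ++ σ, y.1 ∈ A) ∧ ((R ++ σ).map Q.tail).Nodup) ∨
    ∃ σ R τ, S.Barbell A σ R τ := by
  obtain ⟨α, hα⟩ := hne
  rcases explore hA ∅ (x := (α, true)) hα with h | ⟨R, σ, h1, h2⟩ | ⟨P, h1, h2, h3⟩
  · exact Or.inl h
  · have hcσ : σ.IsChain Q.Step := h1.chain.right_of_append
    have hnσ : (σ.map Q.tail).Nodup := by
      have := h1.nodup
      rw [List.map_append] at this
      exact this.of_append_right
    have hmσ : ∀ y ∈ σ, y.1 ∈ A := fun y hy => h1.mem y (List.mem_append_right _ hy)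
    -- Both ends of the hook use the same side of its base; `b` leaves by the other one.
    obtain ⟨b, hb, hsb⟩ := hA (σ.getLast h2.ne) (hmσ _ (List.getLast_mem _)) (by
      rw [h2.head_getLast]
      exact h2.tail_mem_inner hcσ hnσ)
    have hnb : S.node b = opp (S.node (σ.head h2.ne)) := by
      rw [S.step_iff_node.1 hsb, h2.node_eq]
    have htb : Q.tail b = Q.tail (σ.head h2.ne) := congrArg Prod.fst hnb
    clear h1
    have hcons : σ.map Q.tail = Q.tail b :: (σ.map Q.tail).tail := by
      obtain ⟨s, t, rfl⟩ := List.exists_cons_of_ne_nil h2.ne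
      simp [htb]
    have hnσ' := hnσ
    rw [hcons, List.nodup_cons] at hnσ'
    have hXin : ∀ v ∈ (σ.map Q.tail).tail, v ∈ S.inner := by
      obtain ⟨s, t, rfl⟩ := List.exists_cons_of_ne_nil h2.ne
      simp only [List.map_cons, List.tail_cons, List.mem_map]
      rintro v ⟨z, hz, rfl⟩
      obtain ⟨u, v, rfl⟩ := List.append_of_mem hz
      rw [← List.cons_append, List.isChain_append] at hcσ
      exact S.tail_mem_inner_of_step (hcσ.2.2 _ (by
          rw [List.getLast?_eq_some_getLast (by simp : s :: u ≠ [])]; rfl) z (by simp))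
    -- The new path stops on meeting the hook. The base is left out of the forbidden set, since the
    -- path starts there and a return to it already counts as a repetition.
    rcases explore hA {v | v ∈ (σ.map Q.tail).tail} (x := b) hb with
      h | ⟨R, τ, h3, h4⟩ | ⟨P, h3, h4, h5⟩
    · exact Or.inl h
    · refine Or.inr (Or.inr (Or.inr ⟨σ, R, τ, h2, h4, ?_, ?_, ?_⟩))
      · rw [List.isChain_append]
        refine ⟨hcσ, h3.chain, fun x hx y hy => ?_⟩
        rw [List.getLast?_eq_some_getLast h2.ne] at hx
        rw [h3.head_eq] at hy
        simp at hx hy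
        rwa [← hx, ← hy]
      · intro y hy
        rcases List.mem_append.1 hy with hy | hy
        · exact hmσ y hy
        · exact h3.mem y hy
      · have h5 := h3.nodup
        have h6 : (R ++ τ).map Q.tail = Q.tail b :: ((R ++ τ).map Q.tail).tail := by
          obtain ⟨s, t, hst⟩ := List.exists_cons_of_ne_nil h3.ne
          have := h3.head_eq
          rw [hst] at this ⊢
          simp at this
          simp [this]
        rw [h6, List.nodup_cons] at h5
        rw [List.nodup_append']
        refine ⟨hnσ, h5.2, fun v hv hv' => ?_⟩
        rw [hcons, List.mem_cons] at hv
        rcases hv with rfl | hv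
        · exact h5.1 hv'
        · rw [← List.map_tail] at hv'
          obtain ⟨y, hy, rfl⟩ := List.mem_map.1 hv'
          exact h3.avoid y hy hv
    · have hPcons : P.map Q.tail = Q.tail b :: (P.tail).map Q.tail := by
        obtain ⟨s, t, hst⟩ := List.exists_cons_of_ne_nil h3.ne
        have := h3.head_eq
        rw [hst] at this ⊢
        simp at this
        simp [this]
      by_cases h6 : Q.head (P.getLast h3.ne) ∈ (σ.map Q.tail).tail
      -- The path meets the hook at `z`. One of the two arcs of `σ` from `z` to the base leaves by
      -- the side opposite to the arrival, and both arcs reach the base on the side opposite to `b`;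
      -- so the path and the right arc form a simple cycle.
      · left
        have hPX : ∀ v ∈ P.map Q.tail, v ∉ (σ.map Q.tail).tail := by
          intro v hv
          rw [hPcons, List.mem_cons] at hv
          rcases hv with rfl | hv
          · exact hnσ'.1
          · obtain ⟨y, hy, rfl⟩ := List.mem_map.1 hv
            exact h3.avoid y hy
        obtain ⟨s, σ', rfl⟩ := List.exists_cons_of_ne_nil h2.ne
        simp only [List.map_cons, List.tail_cons] at h6 hPX
        obtain ⟨z, hz, hzt⟩ := List.mem_map.1 h6
        obtain ⟨u, v, rfl⟩ := List.append_of_mem hz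
        have hc1 := hcσ
        rw [← List.cons_append, List.isChain_append] at hc1
        have hpz := hc1.2.2 _ (by
          rw [List.getLast?_eq_some_getLast (by simp : s :: u ≠ [])]; rfl) z (by simp)
        rcases eq_or_eq_opp (μ := S.node z) (ν := S.node (flip (P.getLast h3.ne)))
          (by simpa using hzt) with h7 | h7
        · have h8 : Q.Step (P.getLast h3.ne) (flip ((s :: u).getLast (by simp))) := by
            rw [S.step_iff_node, ← h7, S.step_iff_node.1 hpz, opp_opp]
          have hinv : inv (s :: u) ≠ [] := by simp
          have hhd : (inv (s :: u)).head hinv = flip ((s :: u).getLast (by simp)) := by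
            simp only [inv, List.head_reverse, List.getLast_map]
          have hlt : (inv (s :: u)).getLast hinv = flip s := by
            simp only [inv, List.getLast_reverse, List.head_map, List.head_cons]
          have hheads : (s :: u).map Q.head = u.map Q.tail ++ [Q.tail z] := by
            rw [map_head_eq (by simp) hc1.1, hpz.1]
            simp
          refine ⟨P ++ inv (s :: u), by simp [h3.ne], ?_, ?_, ?_, ?_⟩
          · rw [List.isChain_append]
            refine ⟨h3.chain, S.isChain_inv hc1.1, fun x hx y hy => ?_⟩
            rw [List.getLast?_eq_some_getLast h3.ne] at hx
            rw [List.head?_eq_some_head hinv, hhd] at hy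
            simp only [Option.mem_def, Option.some.injEq] at hx hy
            rwa [← hx, ← hy]
          · rw [List.getLast_append_of_ne_nil _ hinv, List.head_append_of_ne_nil h3.ne, hlt,
              h3.head_eq', S.step_iff_node, flip_flip, hnb]
            rfl
          · intro y hy
            rcases List.mem_append.1 hy with hy | hy
            · exact h3.mem y hy
            · simp only [inv, List.mem_reverse, List.mem_map] at hy
              obtain ⟨y', hy', rfl⟩ := hy
              exact hmσ y' (by
                rw [← List.cons_append]
                exact List.mem_append_left _ hy')
          · rw [List.map_append, map_tail_inv, hheads, List.nodup_append']
            have hn3 : (u.map Q.tail ++ [Q.tail z] ++ v.map Q.tail).Nodup := by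
              simpa using hnσ'.2
            refine ⟨h3.nodup, List.nodup_reverse.2 hn3.of_append_left, fun w hw hw' => hPX w hw ?_⟩
            simp only [List.mem_reverse, List.mem_append, List.mem_singleton] at hw'
            simp only [List.map_append, List.map_cons, List.mem_append, List.mem_cons]
            tauto
        · have hzv : z :: v ≠ [] := by simp
          refine ⟨P ++ z :: v, by simp, ?_, ?_, ?_, ?_⟩
          · rw [List.isChain_append]
            refine ⟨h3.chain, hc1.2.1, fun x hx y hy => ?_⟩
            rw [List.getLast?_eq_some_getLast h3.ne] at hx
            simp at hx hy
            rw [← hx, ← hy, S.step_iff_node]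
            exact h7
          · rw [List.getLast_append_of_ne_nil _ hzv, List.head_append_of_ne_nil h3.ne, h3.head_eq']
            have : (s :: (u ++ z :: v)).getLast h2.ne = (z :: v).getLast hzv := by
              simp only [← List.cons_append]
              exact List.getLast_append_of_ne_nil _ hzv
            rwa [this] at hsb
          · intro y hy
            rcases List.mem_append.1 hy with hy | hy
            · exact h3.mem y hy
            · exact hmσ y (by
                rw [← List.cons_append]
                exact List.mem_append_right _ hy)
          · rw [List.map_append, List.nodup_append']
            refine ⟨h3.nodup, ?_, fun w hw hw' => hPX w hw ?_⟩
            · have : (u.map Q.tail ++ (z :: v).map Q.tail).Nodup := by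
                simpa using hnσ'.2
              exact this.of_append_right
            · rw [List.map_append]
              exact List.mem_append_right _ hw'
      -- The path ends at an outer vertex; reversed, it is the stick of a lollipop with loop `σ`.
      · have h7 := h5.resolve_right h6
        refine Or.inr (Or.inr (Or.inl ⟨inv P, σ, by simpa using h3.ne, h2, ?_, ?_, ?_, ?_⟩))
        · rw [List.isChain_append]
          refine ⟨S.isChain_inv h3.chain, hcσ, fun x hx y hy => ?_⟩
          simp only [inv, List.getLast?_reverse, List.head?_map, h3.head_eq] at hx
          rw [List.head?_eq_some_head h2.ne] at hy
          simp at hx hy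
          rw [← hx, ← hy, S.step_iff_node, flip_flip, hnb, opp_opp]
        · have : (inv P).head (by simpa using h3.ne) = flip (P.getLast h3.ne) := by
            simp only [inv, List.head_reverse, List.getLast_map]
          rw [this, tail_flip]
          exact h7
        · intro y hy
          rcases List.mem_append.1 hy with hy | hy
          · simp only [inv, List.mem_reverse, List.mem_map] at hy
            obtain ⟨y', hy', rfl⟩ := hy
            exact h3.mem y' hy'
          · exact hmσ y hy
        · rw [List.map_append, map_tail_inv, map_head_eq h3.ne h3.chain, hPcons, List.cons_append,
            List.tail_cons]
          have hnP := h3.nodup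
          rw [hPcons, List.nodup_cons] at hnP
          rw [hPcons, List.mem_cons, not_or] at h4
          rw [List.nodup_append', List.nodup_reverse, List.nodup_append']
          refine ⟨⟨hnP.2, by simp, fun v hv hv' => ?_⟩, hnσ, fun v hv hv' => ?_⟩
          · simp at hv'
            exact h4.2 (hv' ▸ hv)
          · simp only [List.mem_reverse, List.mem_append, List.mem_singleton] at hv
            rw [hcons, List.mem_cons] at hv'
            rcases hv with hv | rfl
            · rcases hv' with rfl | hv'
              · exact hnP.1 hv
              · obtain ⟨y, hy, rfl⟩ := List.mem_map.1 hv
                exact h3.avoid y hy hv'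
            · rcases hv' with hv' | hv'
              · exact h4.1 hv'
              · exact h6 hv'
  · have ho : Q.head (P.getLast h1.ne) ∉ S.inner := by
      simpa using h3
    have ht : Q.tail (flip (P.getLast h1.ne)) ∉ S.inner := by simpa using ho
    -- Start again from the outer end, so that the new path is the beginning of a route.
    rcases explore hA ∅ (x := flip (P.getLast h1.ne)) (by
      exact h1.mem (P.getLast h1.ne) (List.getLast_mem h1.ne)) with
      h | ⟨R, σ, h4, h5⟩ | ⟨P', h4, h5, h6⟩
    · exact Or.inl h
    · have hR : R ≠ [] := by
        rintro rfl
        rw [List.nil_append] at h4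
        apply ht
        have := h5.tail_mem_inner h4.chain h4.nodup
        rwa [h4.head_eq'] at this
      refine Or.inr (Or.inr (Or.inl ⟨R, σ, hR, h5, h4.chain, ?_, h4.mem, h4.nodup⟩))
      have := h4.head_eq'
      rw [List.head_append_of_ne_nil hR] at this
      rwa [this]
    · refine Or.inr (Or.inl ⟨P', h4.ne, h4.chain, ?_, by simpa using h6, h4.mem, h4.nodup, h5⟩)
      rwa [h4.head_eq']

end Sides
end BoundQuiver

namespace BoundQuiver

variable {V E : Type*} {Q : BoundQuiver V E}

/-! ### Elementary trails from simple cycles, lollipops and barbells -/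

theorem head_inv {w : List (SArrow E)} (hw : w ≠ []) (hw' : inv w ≠ []) :
    (inv w).head hw' = flip (w.getLast hw) := by
  simp only [inv, List.head_reverse, List.getLast_map]

theorem getLast_inv {w : List (SArrow E)} (hw : w ≠ []) (hw' : inv w ≠ []) :
    (inv w).getLast hw' = flip (w.head hw) := by
  simp only [inv, List.getLast_reverse, List.head_map]

theorem isChain_append_iff {v w : List (SArrow E)} (hv : v ≠ []) (hw : w ≠ []) :
    (v ++ w).IsChain Q.Step ↔
      v.IsChain Q.Step ∧ w.IsChain Q.Step ∧ Q.Step (v.getLast hv) (w.head hw) := by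
  rw [List.isChain_append, List.getLast?_eq_some_getLast hv, List.head?_eq_some_head hw]
  simp

theorem isClosedWalk_of_isChain {w : List (SArrow E)} (hw : w ≠ []) (hc : w.IsChain Q.Step)
    (h : Q.Step (w.getLast hw) (w.head hw)) : Q.IsClosedWalk (cyc w hw) w.length :=
  isClosedWalk_cyc hw ⟨by simp [hw], (isChain_append_iff hw hw).2 ⟨hc, hc, h⟩⟩

namespace Sides

variable {S : Q.Sides} {A : Set E}

theorem SimpleCycle.elementaryWalk (S : Q.Sides) {c : List (SArrow E)} (h : SimpleCycle Q A c) :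
    S.ElementaryWalk (cyc c h.ne) c.length := by
  have hc := isClosedWalk_of_isChain h.ne h.chain h.closed
  have h0 := hc.pos
  have key : ∀ x y, Q.tail (cyc c h.ne x) = Q.tail (cyc c h.ne y) → (c.length : ℤ) ∣ x - y := by
    intro x y hxy
    have ex := Int.emod_nonneg x h0.ne'
    have ey := Int.emod_nonneg y h0.ne'
    have lx := Int.emod_lt_of_pos x h0
    have ly := Int.emod_lt_of_pos y h0
    have := (h.nodup.getElem_inj_iff (i := (x % c.length).toNat) (hi := by simp; omega)
      (j := (y % c.length).toNat) (hj := by simp; omega)).1 (by simpa [cyc] using hxy)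
    exact Int.dvd_of_emod_eq_zero (Int.emod_eq_emod_iff_emod_sub_eq_zero.1 (by omega))
  have hne : ∀ x y, S.node (cyc c h.ne x) ≠ opp (S.node (cyc c h.ne y)) := by
    intro x y hxy
    have h1 := hc.congr (key x y (congrArg Prod.fst hxy))
    rw [h1] at hxy
    exact opp_ne _ hxy.symm
  exact ⟨hc, fun x y hxy => key x y (congrArg Prod.fst hxy),
    fun i j m hm => absurd hm.node_eq (hne i j), Or.inl hne⟩

/-- Around a hook one returns by the side of departure, which is the side facing `R`; hence `R` can
be retraced. -/
theorem Hook.isChain_append_inv {R σ : List (SArrow E)} (h : S.Hook σ)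
    (hc : (R ++ σ).IsChain Q.Step) : (R ++ σ ++ inv R).IsChain Q.Step := by
  rcases eq_or_ne R [] with rfl | hR
  · simpa [inv] using hc
  · have hR' : inv R ≠ [] := by simpa using hR
    have hc' := (isChain_append_iff hR h.ne).1 hc
    rw [isChain_append_iff (by simp [hR]) hR']
    refine ⟨hc, S.isChain_inv hc'.1, ?_⟩
    rw [List.getLast_append_of_ne_nil _ h.ne, head_inv hR, S.step_iff_node, h.node_eq,
      S.step_iff_node.1 hc'.2.2, opp_opp]

theorem Hook.isRoute {R σ : List (SArrow E)} (hR : R ≠ []) (h : S.Hook σ)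
    (hc : (R ++ σ).IsChain Q.Step) (ho : Q.tail (R.head hR) ∉ S.inner) :
    Q.IsRoute (R ++ σ ++ inv R) := by
  have hw : R ++ σ ++ inv R ≠ [] := by simp [hR]
  rw [S.isRoute_iff hw]
  refine ⟨by exact_mod_cast List.length_pos_iff.2 hw,
    (isChain_iff_cyc hw).1 (h.isChain_append_inv hc), ?_, ?_⟩
  · rw [cyc_zero, List.head_append_of_ne_nil (by simp [hR]), List.head_append_of_ne_nil hR]
    exact ho
  · rw [cyc_length_sub_one, List.getLast_append_of_ne_nil _ (by simpa using hR), getLast_inv hR,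
      head_flip]
    exact ho

/-- The closed walks which run around a cycle, along a path of length `m`, around a second cycle,
and back along the path. -/
structure BarbellWalk (S : Q.Sides) (a : ℤ → SArrow E) (n p : ℤ) (m : ℕ) : Prop extends
    Q.IsClosedWalk a n where
  left_pos : 0 < p
  right_pos : p + 2 * m < n
  node_eq : S.node (a p) = opp (S.node (a 0))
  refl : ∀ t : ℤ, 0 ≤ t → t < m → a (p + t) = flip (a (n - 1 - t))
  eq_of_tail_eq : ∀ x y, 0 ≤ x → x < y → y < n → Q.tail (a x) = Q.tail (a y) →
    (x = 0 ∧ y = p) ∨ (x + y = p + n ∧ p < x ∧ x ≤ p + m)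

variable {a : ℤ → SArrow E} {n p i j k l t : ℤ} {m m' : ℕ}

theorem BarbellWalk.fold (h : S.BarbellWalk a n p m) : S.Fold a p 0 m where
  node_eq := h.node_eq
  refl t h0 ht := by
    rw [h.refl t h0 ht, h.congr (k := n - 1 - t) (l := 0 - 1 - t) (by simp)]

/-- All coincidences of vertices come from the base of the first loop or from the bridge, where the
two passages are opposite. -/
theorem BarbellWalk.unboosted (h : S.BarbellWalk a n p m) : S.Unboosted a n := by
  have hc := h.toIsClosedWalk
  have key : ∀ x y, 0 ≤ x → x < y → y < n → S.node (a x) ≠ S.node (a y) := by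
    intro x y h0 hxy hy he
    rcases h.eq_of_tail_eq x y h0 hxy hy (congrArg Prod.fst he) with ⟨rfl, rfl⟩ | ⟨h1, h2, h3⟩
    · rw [h.node_eq] at he
      exact opp_ne _ he.symm
    · have h4 := h.fold.node_add hc (x - p) (by omega) (by omega)
      rw [show p + (x - p) = x by ring, hc.congr (k := 0 - (x - p)) (l := y) ⟨-1, by linarith⟩,
        he] at h4
      exact opp_ne _ h4.symm
  intro x y he
  rw [hc.congr (k := x) (l := x % n) Int.dvd_self_sub_emod,
    hc.congr (k := y) (l := y % n) Int.dvd_self_sub_emod] at he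
  have ex := Int.emod_nonneg x hc.pos.ne'
  have ey := Int.emod_nonneg y hc.pos.ne'
  have lx := Int.emod_lt_of_pos x hc.pos
  have ly := Int.emod_lt_of_pos y hc.pos
  rcases lt_trichotomy (x % n) (y % n) with h1 | h1 | h1
  · exact absurd he (key _ _ ex h1 ly)
  · exact Int.dvd_of_emod_eq_zero (Int.emod_eq_emod_iff_emod_sub_eq_zero.1 h1)
  · exact absurd he.symm (key _ _ ey h1 lx)

theorem BarbellWalk.oneFold (h : S.BarbellWalk a n p m) : S.OneFold a n p 0 m := by
  have hc := h.toIsClosedWalk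
  have hp := h.left_pos
  have hn := h.right_pos
  -- If `a y` were inverse to `a x`, the vertices after `x` and before `y` would coincide, against
  -- `eq_of_tail_eq`. It is applied to the first and last letters of the two loops, to show that the
  -- bridge is a maximal fold.
  have ne : ∀ x y, 0 ≤ x → x ≤ y → y < n → (x = 0 → y < p) → (0 < x → x < p → y < p) →
      (0 < x → p + m ≤ x) ∨ y < p → a y ≠ flip (a x) := by
    intro x y h0 hxy hy h1 h2 h3 he
    rcases hxy.eq_or_lt with rfl | hxy
    · exact flip_ne _ he.symm
    rcases (show x + 1 ≤ y by omega).eq_or_lt with rfl | hxy'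
    · exact (hc.step x).2.1 he
    · have h4 := h.eq_of_tail_eq (x + 1) y (by omega) hxy' hy (by
        rw [he, tail_flip, (hc.step x).1])
      omega
  refine ⟨⟨h.fold, ?_, ?_⟩, hp, by omega, ?_⟩
  · exact ne 0 (p - 1) le_rfl (by omega) (by omega) (by omega) (by omega) (by omega)
  · intro he
    rw [hc.congr (k := 0 - 1 - (m : ℤ)) (l := n - 1 - m) ⟨-1, by ring⟩] at he
    exact ne (p + m) (n - 1 - m) (by omega) (by omega) (by omega) (by omega) (by omega)
      (by omega) (by rw [he, flip_flip])
  · intro x y he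
    rw [hc.congr (k := x) (l := x % n) Int.dvd_self_sub_emod,
      hc.congr (k := y) (l := y % n) Int.dvd_self_sub_emod] at he
    have ex := Int.emod_nonneg x hc.pos.ne'
    have ey := Int.emod_nonneg y hc.pos.ne'
    have lx := Int.emod_lt_of_pos x hc.pos
    have ly := Int.emod_lt_of_pos y hc.pos
    have dx : n ∣ x - x % n := Int.dvd_self_sub_emod
    have dy : n ∣ y - y % n := Int.dvd_self_sub_emod
    generalize x % n = x' at *
    generalize y % n = y' at *
    have dvd : ∀ {u v w : ℤ}, n ∣ u - v → n ∣ v - w → n ∣ u - w := fun h1 h2 => by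
      have := dvd_add h1 h2
      rwa [sub_add_sub_cancel] at this
    have het : Q.tail (a x') = Q.tail (a y') := congrArg Prod.fst he
    rcases lt_trichotomy x' y' with h1 | rfl | h1
    · rcases h.eq_of_tail_eq _ _ ex h1 ly het with ⟨rfl, rfl⟩ | ⟨h2, h3, h4⟩
      · exact ⟨0, le_rfl, by omega, Or.inr ⟨by simpa using dx, by simpa using dy⟩⟩
      · refine ⟨x' - p, by omega, by omega, Or.inl ⟨dvd dx ⟨0, by ring⟩, dvd dy ⟨1, by linarith⟩⟩⟩
    · exact absurd he.symm (opp_ne _)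
    · rcases h.eq_of_tail_eq _ _ ey h1 lx het.symm with ⟨rfl, rfl⟩ | ⟨h2, h3, h4⟩
      · exact ⟨0, le_rfl, by omega, Or.inl ⟨by simpa using dx, by simpa using dy⟩⟩
      · refine ⟨y' - p, by omega, by omega, Or.inr ⟨dvd dx ⟨1, by linarith⟩, dvd dy ⟨0, by ring⟩⟩⟩

/-- A maximal fold cannot start in the interior of another, by `left_ne`; with a common start,
`right_ne` makes their lengths equal. -/
theorem MaxFold.eq_of_congr (hc : Q.IsClosedWalk a n) (h : S.MaxFold a i j m)
    (h' : S.MaxFold a k l m') (h0 : 0 ≤ t) (ht : t ≤ m) (hk : n ∣ k - (i + t))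
    (hl : n ∣ l - (j - t)) : t = 0 ∧ m' = m := by
  have h1 : t = 0 := by
    by_contra h1
    apply h'.left_ne
    rw [hc.congr (k := k - 1) (l := i + (t - 1)) (by
      rwa [show k - 1 - (i + (t - 1)) = k - (i + t) by ring]), h.refl _ (by omega) (by omega),
      hc.congr (k := j - 1 - (t - 1)) (l := l) (by
        rw [← dvd_neg]
        rwa [show -(j - 1 - (t - 1) - l) = l - (j - t) by ring])]
  subst h1
  refine ⟨rfl, ?_⟩
  have h2 := h'.congr hc (i' := i) (j' := j) (by
    rw [← dvd_neg]
    simpa using hk) (by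
    rw [← dvd_neg]
    simpa using hl)
  rcases lt_trichotomy m' m with h3 | h3 | h3
  · exact absurd (h.refl m' (by omega) (by omega)) h2.right_ne
  · exact h3
  · exact absurd (h2.refl m (by omega) (by omega)) h.right_ne

/-- Up to periods and exchange of the passes there is one maximal fold, so one equation of signs
suffices; `left_snd` and `right_snd` transfer it to the other pass. -/
theorem OneFold.balanced (hc : Q.IsClosedWalk a n) (h : S.OneFold a n i j m)
    (hb : (a (i - 1)).2 = (a (i + m)).2) : S.Balanced a := by
  intro k l m' h'
  obtain ⟨t, h0, ht, ⟨h1, h2⟩ | ⟨h1, h2⟩⟩ := h.cover k l h'.node_eq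
  · obtain ⟨rfl, rfl⟩ := h.toMaxFold.eq_of_congr hc h' h0 ht h1 h2
    rw [hc.congr (k := k - 1) (l := i - 1) (by simpa using h1),
      hc.congr (k := k + m') (l := i + m') (by simpa using h1), hb]
  · obtain ⟨h3, rfl⟩ := (h.toMaxFold.symm hc).eq_of_congr hc h' (t := m - t) (by omega)
      (by omega) (by rwa [show j - (m : ℤ) + (m - t) = j - t by ring])
      (by rwa [show i + (m : ℤ) - (m - t) = i + t by ring])
    obtain rfl : t = m' := by omega
    rw [hc.congr (k := k - 1) (l := j - 1 - m') (by
        rwa [show k - 1 - (j - 1 - (m' : ℤ)) = k - (j - m') by ring]),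
      hc.congr (k := k + m') (l := j) (by
        rwa [show k + (m' : ℤ) - j = k - (j - m') by ring]), ← h.toMaxFold.right_snd hc,
      ← h.toMaxFold.left_snd hc, hb]

theorem BarbellWalk.elementaryWalk (h : S.BarbellWalk a n p m)
    (hb : (a (p - 1)).2 = (a (p + m)).2) : S.ElementaryWalk a n :=
  ⟨h.toIsClosedWalk, h.unboosted, h.oneFold.balanced h.toIsClosedWalk hb,
    Or.inr ⟨p, 0, m, h.oneFold⟩⟩

end Sides
end BoundQuiver

/-! ### Barbells as elementary bands, and extraction of an elementary trail -/

namespace BoundQuiver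

variable {V E : Type*} {Q : BoundQuiver V E}

namespace Sides

variable {S : Q.Sides} {A : Set E}

theorem Barbell.ne {σ R τ : List (SArrow E)} (h : S.Barbell A σ R τ) :
    σ ++ (R ++ τ) ++ inv R ≠ [] := by simp [h.left.ne]

theorem Barbell.isClosedWalk {σ R τ : List (SArrow E)} (h : S.Barbell A σ R τ) :
    Q.IsClosedWalk (cyc (σ ++ (R ++ τ) ++ inv R) h.ne) (σ ++ (R ++ τ) ++ inv R).length := by
  have hRτ : R ++ τ ≠ [] := by simp [h.right.ne]
  have hc := (isChain_append_iff h.left.ne hRτ).1 h.chain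
  refine isClosedWalk_of_isChain h.ne ?_ ?_
  · rw [List.append_assoc, isChain_append_iff h.left.ne (by simp [h.right.ne])]
    refine ⟨hc.1, h.right.isChain_append_inv hc.2.1, ?_⟩
    rw [List.head_append_of_ne_nil hRτ]
    exact hc.2.2
  · rw [S.step_iff_node]
    have h1 : (σ ++ (R ++ τ) ++ inv R).head h.ne = σ.head h.left.ne := by
      rw [List.head_append_of_ne_nil (by simp [h.left.ne]), List.head_append_of_ne_nil h.left.ne]
    have h2 := S.step_iff_node.1 hc.2.2
    rw [h1, ← h.left.node_eq, ← opp_opp (S.node (flip (σ.getLast _))), ← h2]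
    congr 1
    rcases eq_or_ne R [] with rfl | hR
    · simp only [List.nil_append, inv, List.map_nil, List.reverse_nil, List.append_nil]
      rw [List.getLast_append_of_ne_nil _ h.right.ne, h.right.node_eq]
    · rw [List.getLast_append_of_ne_nil _ (by simpa using hR), getLast_inv hR, flip_flip,
        List.head_append_of_ne_nil hR]

theorem Barbell.barbellWalk {σ R τ : List (SArrow E)} (h : S.Barbell A σ R τ) :
    S.BarbellWalk (cyc (σ ++ (R ++ τ) ++ inv R) h.ne) (σ ++ (R ++ τ) ++ inv R).length
      σ.length R.length := by
  have hRτ : R ++ τ ≠ [] := by simp [h.right.ne]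
  have hc := h.isClosedWalk
  have hs := ((isChain_append_iff h.left.ne hRτ).1 h.chain).2.2
  have hσ := List.length_pos_iff.2 h.left.ne
  have hτ := List.length_pos_iff.2 h.right.ne
  have hl : (σ ++ (R ++ τ) ++ inv R).length = σ.length + R.length + τ.length + R.length := by
    simp
    omega
  have hn := h.nodup
  have hw := h.ne
  set w := σ ++ (R ++ τ) ++ inv R with hwdef
  have rf : ∀ t : ℕ, t < R.length →
      cyc w hw (σ.length + t : ℕ) = flip (cyc w hw (w.length - 1 - t : ℕ)) := by
    intro t ht
    have e1 : w[σ.length + t]'(by omega) = R[t] := by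
      simp only [hwdef]
      rw [List.getElem_append_left (by simp; omega), List.getElem_append_right (by omega),
        List.getElem_append_left (by omega)]
      congr 1
      omega
    have e2 : w[w.length - 1 - t]'(by omega) = flip R[t] := by
      simp only [hwdef]
      rw [List.getElem_append_right (by simp; omega), getElem_inv]
      congr 2
      simp
      omega
    rw [cyc_natCast _ hw _ (by omega), cyc_natCast _ hw _ (by omega), e1, e2, flip_flip]
  have e0 : cyc w hw (σ.length : ℤ) = (R ++ τ).head hRτ := by
    rw [cyc_natCast _ hw _ (by omega), List.head_eq_getElem]
    simp only [hwdef]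
    rw [List.getElem_append_left (by simp; omega), List.getElem_append_right (by omega)]
    congr 1
    omega
  have node0 : S.node (cyc w hw σ.length) = opp (S.node (cyc w hw 0)) := by
    rw [e0, S.step_iff_node.1 hs, h.left.node_eq, cyc_zero]
    simp only [hwdef]
    rw [List.head_append_of_ne_nil (by simp [h.left.ne]), List.head_append_of_ne_nil h.left.ne]
  have t1 : ∀ k : ℕ, k < σ.length →
      (σ.map Q.tail ++ ((R ++ τ).map Q.tail).tail)[k]? = some (Q.tail (cyc w hw k)) := by
    intro k hk
    rw [cyc_natCast _ hw _ (by omega), List.getElem?_append_left (by simpa using hk)]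
    simp only [hwdef]
    rw [List.getElem_append_left (by simp; omega), List.getElem_append_left hk]
    simp [hk]
  have t2 : ∀ k : ℕ, σ.length < k → k < σ.length + R.length + τ.length →
      (σ.map Q.tail ++ ((R ++ τ).map Q.tail).tail)[k - 1]? = some (Q.tail (cyc w hw k)) := by
    intro k hk hk'
    rw [cyc_natCast _ hw _ (by omega), List.getElem?_append_right (by simp; omega),
      List.getElem?_tail, List.getElem?_map]
    simp only [hwdef]
    rw [List.getElem_append_left (by simp; omega), List.getElem_append_right (by omega),
      List.length_map, show k - 1 - σ.length + 1 = k - σ.length by omega,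
      List.getElem?_eq_getElem (by simp; omega)]
    rfl
  have t3 : ∀ k : ℕ, σ.length + R.length + τ.length ≤ k → k < w.length →
      Q.tail (cyc w hw k) = Q.tail (cyc w hw (σ.length + w.length - k : ℕ)) := by
    intro k hk hk'
    have e := rf (w.length - 1 - k) (by omega)
    rw [show w.length - 1 - (w.length - 1 - k) = k by omega] at e
    have e' := (hc.step (σ.length + (w.length - 1 - k) : ℕ)).1
    rw [e, head_flip] at e'
    rw [e']
    congr 2
    omega
  -- `g k` is the index of the vertex at position `k` in the duplicate-free list of the barbell: the
  -- return to the base has index `0`, later indices drop by one for the omitted base, and the way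
  -- back over `R` is reflected.
  let g : ℕ → ℕ := fun k => if k < σ.length then k else if k = σ.length then 0 else
    if k < σ.length + R.length + τ.length then k - 1 else σ.length + w.length - k - 1
  have hg : ∀ k : ℕ, k < w.length →
      (σ.map Q.tail ++ ((R ++ τ).map Q.tail).tail)[g k]? = some (Q.tail (cyc w hw k)) := by
    intro k hk
    simp only [g]
    split_ifs with h1 h2 h3
    · exact t1 k h1
    · rw [h2, t1 0 hσ]
      exact congrArg some (congrArg Prod.fst node0).symm
    · exact t2 k (by omega) h3
    · rw [t3 k (by omega) hk]
      exact t2 _ (by omega) (by omega)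
  have hlw : (σ ++ (R ++ τ) ++ inv R).length = w.length := rfl
  refine ⟨hc, by exact_mod_cast hσ, by omega, node0, ?_, ?_⟩
  · intro t h0 ht
    obtain ⟨t, rfl⟩ := Int.eq_ofNat_of_zero_le h0
    have := rf t (by omega)
    push_cast at this
    rw [this]
    congr 2
    omega
  · intro x y hx hxy hy he
    obtain ⟨x, rfl⟩ := Int.eq_ofNat_of_zero_le hx
    obtain ⟨y, rfl⟩ := Int.eq_ofNat_of_zero_le (hx.trans hxy.le)
    have h1 := hg x (by omega)
    have h2 := hg y (by omega)
    rw [he, ← h2] at h1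
    have hlt : g x < (σ.map Q.tail ++ ((R ++ τ).map Q.tail).tail).length := by
      by_contra hlt
      rw [List.getElem?_eq_none (by omega)] at h1
      rw [← h1] at h2
      simp at h2
    have h3 := (List.getElem?_inj hlt hn).1 h1
    simp only [g] at h3
    split_ifs at h3 <;> omega

/-- A hook leaves and re-enters its base by one side, so it can be run in either direction; its
vertices are only permuted. -/
theorem Barbell.inv_right {σ R τ : List (SArrow E)} (h : S.Barbell A σ R τ) :
    S.Barbell A σ R (inv τ) := by
  have hτ := h.right.ne
  have hτ' : inv τ ≠ [] := by simpa using hτ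
  have hσR : σ ++ R ≠ [] := by simp [h.left.ne]
  have hc := h.chain
  rw [← List.append_assoc, isChain_append_iff hσR hτ] at hc
  refine ⟨h.left, ⟨hτ', ?_⟩, ?_, ?_, ?_⟩
  · rw [getLast_inv hτ, head_inv hτ, flip_flip, h.right.node_eq]
  · rw [← List.append_assoc, isChain_append_iff hσR hτ']
    refine ⟨hc.1, S.isChain_inv hc.2.1, ?_⟩
    rw [S.step_iff_node, head_inv hτ, h.right.node_eq]
    exact S.step_iff_node.1 hc.2.2
  · intro y hy
    have hm := h.mem
    simp only [List.mem_append, inv, List.mem_reverse, List.mem_map] at hy hm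
    rcases hy with hy | hy | ⟨z, hz, rfl⟩
    · exact hm y (Or.inl hy)
    · exact hm y (Or.inr (Or.inl hy))
    · exact hm z (Or.inr (Or.inr hz))
  · refine (List.Perm.nodup_iff ?_).1 h.nodup
    apply List.Perm.append_left
    have h1 : (inv τ).map Q.tail = Q.tail (τ.head hτ) :: (τ.map Q.tail).tail.reverse := by
      rw [map_tail_inv, map_head_eq hτ hc.2.1, h.right.head_getLast,
        List.tail_append_of_ne_nil (by simpa using hτ)]
      simp
    have h2 : τ.map Q.tail = Q.tail (τ.head hτ) :: (τ.map Q.tail).tail := by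
      conv_lhs => rw [← List.cons_head_tail hτ]
      rw [List.map_cons, List.map_tail]
    rcases R with _ | ⟨r, R⟩
    · rw [List.nil_append, List.nil_append, h1]
      exact (List.reverse_perm _).symm
    · simp only [List.cons_append, List.map_cons, List.tail_cons, List.map_append]
      apply List.Perm.append_left
      rw [h1]
      conv_lhs => rw [h2]
      exact (List.reverse_perm _).symm.cons _

theorem Barbell.elementaryWalk {σ R τ : List (SArrow E)} (h : S.Barbell A σ R τ)
    (hb : (σ.getLast h.left.ne).2 = (τ.head h.right.ne).2) :
    S.ElementaryWalk (cyc (σ ++ (R ++ τ) ++ inv R) h.ne) (σ ++ (R ++ τ) ++ inv R).length := by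
  have hσ := List.length_pos_iff.2 h.left.ne
  have hτ := List.length_pos_iff.2 h.right.ne
  refine h.barbellWalk.elementaryWalk ?_
  rw [show (σ.length : ℤ) - 1 = (σ.length - 1 : ℕ) by omega,
    show (σ.length : ℤ) + R.length = (σ.length + R.length : ℕ) by omega,
    cyc_natCast _ _ _ (by simp; omega), cyc_natCast _ _ _ (by simp; omega)]
  convert hb using 2
  · rw [List.getElem_append_left (by simp; omega), List.getElem_append_left (by omega),
      List.getLast_eq_getElem]
  · rw [List.getElem_append_left (by simp; omega), List.getElem_append_right (by omega),
      List.getElem_append_right (by omega), List.head_eq_getElem]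
    congr 1
    omega

theorem Barbell.mem_of_mem {σ R τ : List (SArrow E)} (h : S.Barbell A σ R τ) :
    ∀ y ∈ σ ++ (R ++ τ) ++ inv R, y.1 ∈ A := by
  intro y hy
  rcases List.mem_append.1 hy with hy | hy
  · exact h.mem y hy
  · simp only [inv, List.mem_reverse, List.mem_map] at hy
    obtain ⟨z, hz, rfl⟩ := hy
    exact h.mem z (by simp [hz])

/-- The first letter of `τ` and the inverse of its last one are distinct letters of one node, hence
of opposite sign. Reversing `τ` exchanges them, so one of the two orientations has the sign required
for balance. -/
theorem Barbell.exists_elementaryWalk {σ R τ : List (SArrow E)} (h : S.Barbell A σ R τ) :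
    ∃ w, ∃ hw : w ≠ [], S.ElementaryWalk (cyc w hw) w.length ∧ ∀ y ∈ w, y.1 ∈ A := by
  by_cases hb : (σ.getLast h.left.ne).2 = (τ.head h.right.ne).2
  · exact ⟨_, h.ne, h.elementaryWalk hb, h.mem_of_mem⟩
  · refine ⟨_, h.inv_right.ne, h.inv_right.elementaryWalk ?_, h.inv_right.mem_of_mem⟩
    have hne : τ.head h.right.ne ≠ flip (τ.getLast h.right.ne) := by
      have h1 := h.barbellWalk.oneFold.right_ne
      have hσ := List.length_pos_iff.2 h.left.ne
      have hτ := List.length_pos_iff.2 h.right.ne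
      rw [h.isClosedWalk.congr (k := 0 - 1 - (R.length : ℤ))
        (l := (σ.length + R.length + τ.length - 1 : ℕ)) ⟨-1, by simp; omega⟩,
        show (σ.length : ℤ) + R.length = (σ.length + R.length : ℕ) by omega,
        cyc_natCast _ _ _ (by simp; omega), cyc_natCast _ _ _ (by simp; omega)] at h1
      intro he
      apply h1
      rw [List.getElem_append_left (by simp; omega), List.getElem_append_right (by omega),
        List.getElem_append_right (by omega), List.getElem_append_left (by simp; omega),
        List.getElem_append_right (by omega), List.getElem_append_right (by omega)]
      rw [List.head_eq_getElem, List.getLast_eq_getElem] at he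
      convert he using 2
      · omega
      · congr 1
        omega
    have h2 := snd_eq_of_node_eq (S := S) h.right.node_eq.symm hne
    rw [head_inv h.right.ne, flip_snd, ← h2]
    revert hb
    cases (σ.getLast h.left.ne).2 <;> cases (τ.head h.right.ne).2 <;> simp

/-- A set of arrows which can always be continued contains an elementary band or route. -/
theorem exists_elementary_trail [Finite V] (hA : ∀ x : SArrow E, x.1 ∈ A → Q.head x ∈ S.inner →
    ∃ y, y.1 ∈ A ∧ Q.Step x y) (hne : A.Nonempty) :
    (∃ w, Q.IsElementaryBand w ∧ ∀ y ∈ w, y.1 ∈ A) ∨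
      ∃ w, Q.IsElementaryRoute w ∧ ∀ y ∈ w, y.1 ∈ A := by
  rcases exists_trail hA hne with ⟨c, h⟩ | ⟨P, hP, h1, h2, h3, h4, h5, h6⟩ |
    ⟨R, σ, hR, h1, h2, h3, h4, h5⟩ | ⟨σ, R, τ, h⟩
  · exact Or.inl ⟨c, isElementaryBand_of_elementaryWalk h.ne (SimpleCycle.elementaryWalk S h), h.mem⟩
  · right
    have hr : Q.IsRoute P := by
      rw [S.isRoute_iff hP]
      exact ⟨by exact_mod_cast List.length_pos_iff.2 hP, (isChain_iff_cyc hP).1 h1,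
        by rwa [cyc_zero], by rwa [cyc_length_sub_one]⟩
    have hs : Q.IsSimple P := by
      rw [IsSimple, vertexSeq_eq hP h1, List.nodup_append']
      exact ⟨h5, by simp, fun v hv hv' => h6 (by simp at hv'; rwa [← hv'])⟩
    obtain ⟨m, hm⟩ := S.exists_elementaryRouteWalk hP hr (Or.inl hs)
    exact ⟨P, ⟨hr, hm.selfCompatible, Or.inl hs⟩, h4⟩
  · right
    have hr := h1.isRoute hR h2 h3
    have hs := isLollipop_of_nodup hR h1.ne h2 h5 h1.head_getLast
    obtain ⟨m, hm⟩ := S.exists_elementaryRouteWalk (by simp [hR]) hr (Or.inr hs)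
    refine ⟨_, ⟨hr, hm.selfCompatible, Or.inr hs⟩, fun y hy => ?_⟩
    rcases List.mem_append.1 hy with hy | hy
    · exact h4 y hy
    · simp only [inv, List.mem_reverse, List.mem_map] at hy
      obtain ⟨z, hz, rfl⟩ := hy
      exact h4 z (by simp [hz])
  · obtain ⟨w, hw, h1, h2⟩ := h.exists_elementaryWalk
    exact Or.inl ⟨w, isElementaryBand_of_elementaryWalk hw h1, h2⟩

end Sides
end BoundQuiver

namespace BoundQuiver

variable {V E : Type*} {Q : BoundQuiver V E}

/-! ### Rigidity of elementary trails -/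

/-- `F` and `I` are obtained from their values at one common arrow with the same coefficients, so
their quotient there is the factor everywhere. -/
theorem eq_smul_of_apply_eq {a : ℤ → SArrow E} {dom : ℤ → Prop} {m : ℤ} {I F : E → ℝ}
    (hI : ∀ α, I α ≠ 0 ↔ ∃ k, dom k ∧ (a k).1 = α) (hm : dom m)
    (hF : ∀ α, F α ≠ 0 → I α ≠ 0)
    (h : ∀ x, dom x → ∃ c : ℝ, F (a x).1 = c * F (a m).1 ∧ I (a x).1 = c * I (a m).1) :
    ∃ c : ℝ, F = c • I := by
  refine ⟨F (a m).1 / I (a m).1, funext fun α => ?_⟩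
  have h0 : I (a m).1 ≠ 0 := (hI _).2 ⟨m, hm, rfl⟩
  rw [Pi.smul_apply, smul_eq_mul]
  by_cases hα : I α = 0
  · rw [hα, mul_zero]
    by_contra hne
    exact hF α hne hα
  · obtain ⟨k, hk, rfl⟩ := (hI α).1 hα
    obtain ⟨c, h1, h2⟩ := h k hk
    rw [h1, h2]
    field_simp

theorem wordIndicator_ne_zero_iff_cyc {w : List (SArrow E)} (hw : w ≠ []) {α : E} :
    wordIndicator w α ≠ 0 ↔ ∃ k : ℤ, 0 ≤ k ∧ k < w.length ∧ (cyc w hw k).1 = α := by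
  rw [wordIndicator_ne_zero_iff]
  constructor
  · rintro ⟨l, hl, rfl⟩
    obtain ⟨k, hk, rfl⟩ := exists_cyc_eq hw hl
    exact ⟨k, by omega, by omega, rfl⟩
  · rintro ⟨k, -, -, rfl⟩
    exact ⟨_, cyc_mem w hw k, rfl⟩

theorem wordIndicator_ne_zero {w : List (SArrow E)} (hw : w ≠ []) : wordIndicator w ≠ 0 := by
  intro h
  exact wordIndicator_ne_zero_iff.2 ⟨_, List.head_mem hw, rfl⟩ (congrFun h (w.head hw).1)

namespace Sides

variable {S : Q.Sides}

section Flows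

variable [Fintype E]

theorem nodeSum_add (F G : E → ℝ) (ν : V × Bool) :
    S.nodeSum (F + G) ν = S.nodeSum F ν + S.nodeSum G ν := by
  simp only [nodeSum, Pi.add_apply, ← Finset.sum_add_distrib]
  refine Finset.sum_congr rfl fun l _ => ?_
  split_ifs <;> simp

theorem nodeSum_smul (c : ℝ) (F : E → ℝ) (ν : V × Bool) :
    S.nodeSum (c • F) ν = c * S.nodeSum F ν := by
  simp only [nodeSum, Pi.smul_apply, smul_eq_mul, Finset.mul_sum]
  refine Finset.sum_congr rfl fun l _ => ?_
  split_ifs <;> simp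

theorem Conserved.add {F G : E → ℝ} (hF : S.Conserved F) (hG : S.Conserved G) :
    S.Conserved (F + G) := fun ν hν => by
  rw [nodeSum_add, nodeSum_add, hF ν hν, hG ν hν]

theorem Conserved.smul {F : E → ℝ} (hF : S.Conserved F) (c : ℝ) : S.Conserved (c • F) :=
  fun ν hν => by rw [nodeSum_smul, nodeSum_smul, hF ν hν]

/-- The side by which `x` arrives has a positive total, hence so does the opposite side. -/
theorem Conserved.exists_step {F : E → ℝ} (hF : S.Conserved F) (h0 : ∀ α, 0 ≤ F α)
    (x : SArrow E) (hx : F x.1 ≠ 0) (hi : Q.head x ∈ S.inner) :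
    ∃ y : SArrow E, F y.1 ≠ 0 ∧ Q.Step x y := by
  classical
  have h1 := hF (S.node (flip x)) (by simpa using hi)
  have h2 : 0 < S.nodeSum F (S.node (flip x)) := by
    refine Finset.sum_pos' (fun l _ => ?_) ⟨flip x, Finset.mem_univ _, ?_⟩
    · split_ifs
      · exact h0 _
      · exact le_rfl
    · rw [if_pos rfl]
      exact lt_of_le_of_ne (h0 _) hx.symm
  rw [h1] at h2
  obtain ⟨y, -, hy⟩ := Finset.exists_ne_zero_of_sum_ne_zero h2.ne'
  rw [ite_ne_right_iff] at hy
  exact ⟨y, hy.2, S.step_iff_node.2 hy.1⟩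

theorem eq_smul_of_isElementaryBand (S : Q.Sides) {w : List (SArrow E)}
    (hw : Q.IsElementaryBand w) {F : E → ℝ} (hF : S.Conserved F)
    (hs : ∀ α, F α ≠ 0 → wordIndicator w α ≠ 0) : ∃ c : ℝ, F = c • wordIndicator w := by
  have hne := hw.1.1.1
  have hW := S.elementaryWalk_of_isElementaryBand hne hw
  have hI : ∀ α, wordIndicator w α ≠ 0 ↔ ∃ k, True ∧ (cyc w hne k).1 = α := by
    intro α
    rw [wordIndicator_ne_zero_iff_cyc hne]
    constructor
    · rintro ⟨k, -, -, h⟩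
      exact ⟨k, trivial, h⟩
    · rintro ⟨k, -, rfl⟩
      rw [← wordIndicator_ne_zero_iff_cyc hne, wordIndicator_ne_zero_iff]
      exact ⟨_, cyc_mem _ _ _, rfl⟩
  obtain ⟨m, hm⟩ := hW.flow_eq
  refine eq_smul_of_apply_eq (dom := fun _ => True) hI (m := m) trivial hs fun x _ => ?_
  obtain ⟨c, hc⟩ := hm x
  refine ⟨c, hc F hF fun α hα => ?_, hc _ ?_ fun α hα => ?_⟩
  · simpa using (hI α).1 (hs α hα)
  · exact conserved_wordIndicator_of_isClosedWalk hne hW.toIsClosedWalk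
  · simpa using (hI α).1 hα

theorem eq_smul_of_isElementaryRoute (S : Q.Sides) {w : List (SArrow E)}
    (hw : Q.IsElementaryRoute w) {F : E → ℝ} (hF : S.Conserved F)
    (hs : ∀ α, F α ≠ 0 → wordIndicator w α ≠ 0) : ∃ c : ℝ, F = c • wordIndicator w := by
  have hne := hw.1.1.1
  obtain ⟨m, hW⟩ := S.exists_elementaryRouteWalk hne hw.1 hw.2.2
  have hI : ∀ α, wordIndicator w α ≠ 0 ↔
      ∃ k : ℤ, (0 ≤ k ∧ k < w.length) ∧ (cyc w hne k).1 = α := by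
    intro α
    rw [wordIndicator_ne_zero_iff_cyc hne]
    simp only [and_assoc]
  have hm := hW.nonneg
  have hm' := hW.lt
  refine eq_smul_of_apply_eq (dom := fun k => 0 ≤ k ∧ k < w.length) hI (m := m)
    ⟨hm, by omega⟩ hs fun x hx => ?_
  obtain ⟨c, hc⟩ := hW.flow_eq hx.1 hx.2
  refine ⟨c, hc F hF fun α hα => ?_, hc _ ?_ fun α hα => ?_⟩
  · simpa [and_assoc] using (hI α).1 (hs α hα)
  · exact conserved_wordIndicator_of_isRoute hw.1
  · simpa [and_assoc] using (hI α).1 hα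

end Flows

/-- For routes an inclusion of supports suffices, because a route within the support of an
elementary route is forced to run through all of it. -/
theorem eq_or_eq_inv_of_isElementaryRoute (S : Q.Sides) {v w : List (SArrow E)}
    (hv : Q.IsElementaryRoute v) (hw : Q.IsElementaryRoute w)
    (hs : ∀ α, wordIndicator w α ≠ 0 → wordIndicator v α ≠ 0) : w = v ∨ w = inv v := by
  have hv0 := hv.1.1.1
  have hw0 := hw.1.1.1
  have hiv : inv v ≠ [] := by simpa using hv0
  obtain ⟨m, hV⟩ := S.exists_elementaryRouteWalk hv0 hv.1 hv.2.2
  obtain ⟨h1, h2⟩ := hV.eq_or_eq_reverse ((S.isRoute_iff hw0).1 hw.1) fun k _ _ =>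
    (wordIndicator_ne_zero_iff_cyc hv0).1 (hs _ (wordIndicator_ne_zero_iff.2
      ⟨_, cyc_mem w hw0 k, rfl⟩))
  refine h2.imp (fun h2 => ?_) fun h2 => ?_
  · refine List.ext_getElem (by omega) fun k h3 h4 => ?_
    rw [← cyc_natCast w hw0, ← cyc_natCast v hv0]
    exact h2 k (by omega) (by omega)
  · refine List.ext_getElem (by simp; omega) fun k h3 h4 => ?_
    rw [← cyc_natCast w hw0, ← cyc_natCast (inv v) hiv, h2 k (by omega) (by omega), cyc_inv v hv0]
    congr 1
    exact cyc_congr v hv0 ⟨1, by ring⟩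

theorem isRotated_or_isRotated_inv_of_isElementaryBand (S : Q.Sides) {v w : List (SArrow E)}
    (hv : Q.IsElementaryBand v) (hw : Q.IsElementaryBand w)
    (hs : ∀ α, wordIndicator w α ≠ 0 ↔ wordIndicator v α ≠ 0) : w ~r v ∨ w ~r inv v := by
  have hv0 := hv.1.1.1
  have hw0 := hw.1.1.1
  have hiv : inv v ≠ [] := by simpa using hv0
  have key : ∀ {v w : List (SArrow E)} (hv : v ≠ []) (hw : w ≠ []),
      (∀ α, wordIndicator w α ≠ 0 → wordIndicator v α ≠ 0) →
      ∀ k, ∃ l, (cyc v hv l).1 = (cyc w hw k).1 := by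
    intro v w hv hw hs k
    obtain ⟨l, -, -, hl⟩ := (wordIndicator_ne_zero_iff_cyc hv).1 (hs _ (wordIndicator_ne_zero_iff.2
      ⟨_, cyc_mem w hw k, rfl⟩))
    exact ⟨l, hl⟩
  obtain ⟨h1, r, h2⟩ := (S.elementaryWalk_of_isElementaryBand hv0 hv).eq_of_support_eq
    (S.elementaryWalk_of_isElementaryBand hw0 hw) (key hv0 hw0 fun α => (hs α).1)
    (key hw0 hv0 fun α => (hs α).2)
  refine h2.imp (fun h2 => isRotated_of_cyc hv0 hw0 (by omega) r h2) fun h2 => ?_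
  refine isRotated_of_cyc hiv hw0 (by simp; omega) (-1 - r) fun k => ?_
  rw [h2, cyc_inv v hv0]
  congr 2
  ring

end Sides

namespace Fringing

variable {V' E' : Type*} {Q' : BoundQuiver V' E'} {h : Fringing Q Q'} {S : Q'.Sides}

/-! ### Flows on the fringed quiver -/

theorem IsFlow.add {F G : E' → ℝ} (hF : h.IsFlow F) (hG : h.IsFlow G) : h.IsFlow (F + G) where
  nonneg α := add_nonneg (hF.nonneg α) (hG.nonneg α)
  conservation v α₁ α₂ β₁ β₂ hr := by
    have h1 := hF.conservation v α₁ α₂ β₁ β₂ hr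
    have h2 := hG.conservation v α₁ α₂ β₁ β₂ hr
    simp only [Pi.add_apply]
    linarith

theorem IsFlow.smul {F : E' → ℝ} (hF : h.IsFlow F) {c : ℝ} (hc : 0 ≤ c) : h.IsFlow (c • F) where
  nonneg α := mul_nonneg hc (hF.nonneg α)
  conservation v α₁ α₂ β₁ β₂ hr := by
    have h1 := hF.conservation v α₁ α₂ β₁ β₂ hr
    simp only [Pi.smul_apply, smul_eq_mul, ← mul_add, h1]

variable [Fintype E']

theorem isFlow_iff (S : Q'.Sides) {F : E' → ℝ} :
    h.IsFlow F ↔ (∀ α, 0 ≤ F α) ∧ S.Conserved F :=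
  ⟨fun hF => ⟨hF.nonneg, Sides.conserved_iff.2 hF.conservation⟩,
    fun hF => ⟨hF.1, Sides.conserved_iff.1 hF.2⟩⟩

theorem strength_add (F G : E' → ℝ) : h.strength (F + G) = h.strength F + h.strength G := by
  classical
  simp only [strength, ← mul_add, ← Finset.sum_add_distrib]
  congr 1
  refine Finset.sum_congr rfl fun l _ => ?_
  split_ifs <;> simp

theorem strength_smul (c : ℝ) (F : E' → ℝ) : h.strength (c • F) = c * h.strength F := by
  classical
  simp only [strength, Pi.smul_apply, smul_eq_mul, Finset.mul_sum]
  refine Finset.sum_congr rfl fun l _ => ?_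
  split_ifs <;> simp
  ring

theorem strength_nonneg {F : E' → ℝ} (hF : ∀ α, 0 ≤ F α) : 0 ≤ h.strength F := by
  classical
  refine mul_nonneg (by norm_num) (Finset.sum_nonneg fun α _ => ?_)
  split_ifs
  · exact le_rfl
  · exact hF α

theorem isFlow_wordIndicator_of_isElementaryBand (h : Fringing Q Q') (S : Q'.Sides)
    {w : List (SArrow E')} (hw : Q'.IsElementaryBand w) : h.IsFlow (wordIndicator w) :=
  (isFlow_iff S).2 ⟨wordIndicator_nonneg w, Sides.conserved_wordIndicator_of_isClosedWalk hw.1.1.1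
    (isClosedWalk_cyc _ hw.1.2.1)⟩

theorem isFlow_wordIndicator_of_isRoute (h : Fringing Q Q') (S : Q'.Sides)
    {w : List (SArrow E')} (hw : Q'.IsRoute w) : h.IsFlow (wordIndicator w) :=
  (isFlow_iff S).2 ⟨wordIndicator_nonneg w, Sides.conserved_wordIndicator_of_isRoute hw⟩

theorem IsFlow.exists_trail [Finite V'] (S : Q'.Sides) {F : E' → ℝ} (hF : h.IsFlow F)
    (h0 : F ≠ 0) : ∃ w, (Q'.IsElementaryBand w ∨ Q'.IsElementaryRoute w) ∧
      ∀ α, wordIndicator w α ≠ 0 → F α ≠ 0 := by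
  have hc := ((isFlow_iff S).1 hF).2
  obtain ⟨α, hα⟩ := Function.ne_iff.1 h0
  rcases Sides.exists_elementary_trail (S := S) (A := {α | F α ≠ 0})
    (fun x hx hi => hc.exists_step hF.nonneg x hx hi) ⟨α, hα⟩ with ⟨w, h1, h2⟩ | ⟨w, h1, h2⟩
  · refine ⟨w, Or.inl h1, fun α hα => ?_⟩
    obtain ⟨l, hl, rfl⟩ := wordIndicator_ne_zero_iff.1 hα
    exact h2 l hl
  · refine ⟨w, Or.inr h1, fun α hα => ?_⟩
    obtain ⟨l, hl, rfl⟩ := wordIndicator_ne_zero_iff.1 hα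
    exact h2 l hl

/-- Take for `ε` the smallest quotient `F α / I α` on the support of `I`: the difference stays
nonnegative and vanishes at the arrow where the minimum is attained. -/
theorem IsFlow.exists_sub (S : Q'.Sides) {F I : E' → ℝ} (hF : h.IsFlow F)
    (hI : h.IsFlow I) (hI0 : I ≠ 0) (hs : ∀ α, I α ≠ 0 → F α ≠ 0) :
    ∃ ε : ℝ, 0 < ε ∧ ∃ G, h.IsFlow G ∧ F = G + ε • I ∧
      ∃ α, F α ≠ 0 ∧ G α = 0 := by
  classical
  obtain ⟨β, hβ⟩ := Function.ne_iff.1 hI0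
  obtain ⟨α, hα, hmin⟩ := Finset.exists_min_image (Finset.univ.filter fun α => I α ≠ 0)
    (fun α => F α / I α) ⟨β, by simpa using hβ⟩
  simp only [Finset.mem_filter, Finset.mem_univ, true_and] at hα hmin
  have hIpos : ∀ α, I α ≠ 0 → 0 < I α := fun α hα => lt_of_le_of_ne (hI.nonneg α) hα.symm
  have hFpos : ∀ α, I α ≠ 0 → 0 < F α := fun α hα =>
    lt_of_le_of_ne (hF.nonneg α) (hs α hα).symm
  refine ⟨F α / I α, div_pos (hFpos α hα) (hIpos α hα), F + (-(F α / I α)) • I, ?_, ?_, α,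
    hs α hα, ?_⟩
  · refine (isFlow_iff S).2 ⟨fun γ => ?_, (((isFlow_iff S).1 hF).2).add
      ((((isFlow_iff S).1 hI).2).smul _)⟩
    simp only [Pi.add_apply, Pi.smul_apply, smul_eq_mul, neg_mul]
    by_cases hγ : I γ = 0
    · rw [hγ]
      simpa using hF.nonneg γ
    · have := hmin γ hγ
      rw [le_div_iff₀ (hIpos γ hγ)] at this
      linarith
  · ext γ
    simp
  · simp [hα]

/-- Induction on the size of the support: split off a band found in it, which leaves the strength
zero and removes an arrow from the support. -/
theorem mem_span_of_strength_eq_zero [Finite V'] (S : Q'.Sides) (hS : S.inner = range h.vert)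
    (k : ℕ) : ∀ F : E' → ℝ, h.IsFlow F → h.strength F = 0 → {α | F α ≠ 0}.ncard ≤ k →
      F ∈ Submodule.span {c : ℝ // 0 ≤ c} {I | ∃ w, Q'.IsElementaryBand w ∧ wordIndicator w = I} := by
  induction k with
  | zero =>
    intro F hF _ hk
    have : F = 0 := by
      ext α
      by_contra hα
      have := (Set.ncard_eq_zero (Set.toFinite _)).1 (Nat.le_zero.1 hk)
      exact (this ▸ (show α ∈ {α | F α ≠ 0} from hα) : α ∈ (∅ : Set E'))
    rw [this]
    exact Submodule.zero_mem _
  | succ k ih =>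
    intro F hF h0 hk
    by_cases hF0 : F = 0
    · rw [hF0]
      exact Submodule.zero_mem _
    obtain ⟨w, hw, hs⟩ := hF.exists_trail S hF0
    have hne : wordIndicator w ≠ 0 := by
      rcases hw with hw | hw
      · exact wordIndicator_ne_zero hw.1.1.1
      · exact wordIndicator_ne_zero hw.1.1.1
    have hI : h.IsFlow (wordIndicator w) := by
      rcases hw with hw | hw
      · exact isFlow_wordIndicator_of_isElementaryBand h S hw
      · exact isFlow_wordIndicator_of_isRoute h S hw.1
    obtain ⟨ε, hε, G, hG, rfl, α, hα, hα'⟩ := hF.exists_sub S hI hne hs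
    rw [strength_add, strength_smul] at h0
    have hG0 := strength_nonneg (h := h) hG.nonneg
    rcases hw with hw | hw
    · have hz := h.strength_wordIndicator_of_isClosedWalk S hS hw.1.1.1
        (isClosedWalk_cyc _ hw.1.2.1)
      rw [hz, mul_zero, add_zero] at h0
      refine Submodule.add_mem _ (ih G hG h0 ?_)
        (Submodule.smul_mem _ (⟨ε, hε.le⟩ : {c : ℝ // 0 ≤ c}) (Submodule.subset_span ⟨w, hw, rfl⟩))
      refine Nat.le_of_lt_succ (lt_of_lt_of_le (Set.ncard_lt_ncard ?_ (Set.toFinite _)) hk)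
      refine ⟨fun γ hγ => ?_, fun hsub => hsub hα hα'⟩
      have h1 : 0 < G γ := lt_of_le_of_ne (hG.nonneg γ) (Ne.symm hγ)
      have h2 := (hI.smul hε.le).nonneg γ
      exact (add_pos_of_pos_of_nonneg h1 h2).ne'
    -- A route in the support would contribute strength `ε > 0`.
    · rw [h.strength_wordIndicator_of_isRoute S hS hw.1] at h0
      linarith

theorem mem_conicalHull_iff [Finite V'] (S : Q'.Sides) (hS : S.inner = range h.vert)
    {F : E' → ℝ} : F ∈ conicalHull {I | ∃ w, Q'.IsElementaryBand w ∧ wordIndicator w = I} ↔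
      h.IsFlow F ∧ h.strength F = 0 := by
  refine ⟨fun hF => ?_, fun hF => mem_span_of_strength_eq_zero S hS _ F hF.1 hF.2 le_rfl⟩
  refine Submodule.span_induction (p := fun F _ => h.IsFlow F ∧ h.strength F = 0) ?_ ?_ ?_ ?_ hF
  · rintro _ ⟨w, hw, rfl⟩
    exact ⟨isFlow_wordIndicator_of_isElementaryBand h S hw,
      h.strength_wordIndicator_of_isClosedWalk S hS hw.1.1.1 (isClosedWalk_cyc _ hw.1.2.1)⟩
  · exact ⟨⟨fun _ => le_rfl, fun _ _ _ _ _ _ => rfl⟩, by simp [strength]⟩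
  · rintro x y - - ⟨h1, h2⟩ ⟨h3, h4⟩
    exact ⟨h1.add h3, by rw [strength_add, h2, h4, add_zero]⟩
  · rintro c x - ⟨h1, h2⟩
    exact ⟨h1.smul c.2, (strength_smul c.1 x).trans (by rw [h2, mul_zero])⟩

end Fringing
end BoundQuiver

/-! ### Extreme points and recession cone -/

namespace BoundQuiver

namespace Fringing

variable {V E V' E' : Type*} {Q : BoundQuiver V E} {Q' : BoundQuiver V' E'}
  {h : Fringing Q Q'} {S : Q'.Sides}

/-- Without fringe arrows every arrow would end at an internal vertex and could be continued by an
arrow without forming a relation, which gives arbitrarily long nonzero paths. -/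
theorem exists_not_mem_range (h : Fringing Q Q') [Nonempty E'] : ∃ α, α ∉ range h.arr := by
  by_contra hall
  push Not at hall
  obtain ⟨S, hS⟩ := h.exists_sides
  obtain ⟨N, hN⟩ := h.gentle.finite_dim
  have key : ∀ n : ℕ, ∀ α : E', ∃ w : List E', w.length = n ∧
      (α :: w).IsChain (fun α β => Q'.tgt α = Q'.src β ∧ ¬ Q'.rel α β) := by
    intro n
    induction n with
    | zero => exact fun α => ⟨[], rfl, by simp⟩
    | succ n ih =>
      intro α
      have hi : Q'.head (α, true) ∈ S.inner := by
        rw [hS]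
        exact (h.ends_mem_of_mem_range (x := (α, true)) (hall α)).2
      obtain ⟨⟨β, s⟩, hb, rfl⟩ := S.exists_step hi true
      obtain ⟨w, hw, hc⟩ := ih β
      refine ⟨β :: w, by simp [hw], ?_⟩
      rw [List.isChain_cons_cons]
      exact ⟨⟨hb.1, fun hr => hb.2.2.1 ⟨rfl, rfl, hr⟩⟩, hc⟩
  obtain ⟨w, hw, hc⟩ := key N (Classical.arbitrary E')
  have := hN _ hc
  simp [hw] at this

theorem image_elementaryBands (Q' : BoundQuiver V' E') :
    Q'.bandIndicator '' Q'.elementaryBands =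
      {I | ∃ w, Q'.IsElementaryBand w ∧ wordIndicator w = I} := by
  ext I
  constructor
  · rintro ⟨_, ⟨p, hp, rfl⟩, rfl⟩
    exact ⟨p.1, hp, rfl⟩
  · rintro ⟨w, hw, rfl⟩
    exact ⟨_, ⟨⟨w, hw.1⟩, hw, rfl⟩, rfl⟩

theorem injOn_bandIndicator (h : Fringing Q Q') :
    Set.InjOn Q'.bandIndicator Q'.elementaryBands := by
  obtain ⟨S, -⟩ := h.exists_sides
  rintro _ ⟨p, hp, rfl⟩ _ ⟨q, hq, rfl⟩ he
  have he' : wordIndicator p.1 = wordIndicator q.1 := he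
  exact Quotient.sound
    (S.isRotated_or_isRotated_inv_of_isElementaryBand hq hp fun α => by rw [he'])

theorem injOn_routeIndicator (h : Fringing Q Q') :
    Set.InjOn Q'.routeIndicator Q'.elementaryRoutes := by
  obtain ⟨S, -⟩ := h.exists_sides
  rintro _ ⟨p, hp, rfl⟩ _ ⟨q, hq, rfl⟩ he
  have he' : wordIndicator p.1 = wordIndicator q.1 := he
  exact Quotient.sound (S.eq_or_eq_inv_of_isElementaryRoute hq hp fun α hα => by rwa [← he'])

variable [Fintype E']

theorem turbulencePolyhedron_nonempty (h : Fringing Q Q') [Nonempty E'] :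
    h.turbulencePolyhedron.Nonempty := by
  classical
  have h1 : h.IsFlow fun _ => 1 := ⟨fun _ => zero_le_one, fun _ _ _ _ _ _ => rfl⟩
  have h2 : 0 < h.strength fun _ => 1 := by
    obtain ⟨α, hα⟩ := h.exists_not_mem_range
    refine mul_pos (by norm_num) (Finset.sum_pos' (fun β _ => ?_) ⟨α, Finset.mem_univ _, ?_⟩)
    · split_ifs <;> norm_num
    · rw [if_neg (by simpa using hα)]
      norm_num
  refine ⟨(h.strength fun _ => 1)⁻¹ • fun _ => 1, h1.smul (inv_nonneg.2 h2.le), ?_⟩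
  rw [strength_smul, inv_mul_cancel₀ h2.ne']

/-- Repeated translation of one point forces the coordinates of `x` to be nonnegative, and one
translation gives the linear equations. A point is needed, as every vector is a recession vector of
the empty set. -/
theorem mem_recessionCone_iff (h : Fringing Q Q') {x : E' → ℝ} :
    x ∈ recessionCone h.turbulencePolyhedron ↔ h.IsFlow x ∧ h.strength x = 0 := by
  constructor
  · intro hx
    -- Without arrows the polyhedron is empty, but the zero vector is then the whole space.
    rcases isEmpty_or_nonempty E' with he | he
    · exact ⟨⟨fun α => he.elim α, fun _ α _ _ _ _ => he.elim α⟩, by simp [strength]⟩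
    obtain ⟨y, hy⟩ := h.turbulencePolyhedron_nonempty
    have key : ∀ n : ℕ, y + (n : ℝ) • x ∈ h.turbulencePolyhedron := by
      intro n
      induction n with
      | zero => simpa using hy
      | succ n ih =>
        have := hx _ ih
        rw [add_assoc] at this
        convert this using 2
        push_cast
        rw [add_smul, one_smul]
    refine ⟨⟨fun α => ?_, fun v α₁ α₂ β₁ β₂ hr => ?_⟩, ?_⟩
    · by_contra hα
      push Not at hα
      obtain ⟨n, hn⟩ := exists_nat_gt (y α / -x α)
      rw [div_lt_iff₀ (by linarith)] at hn
      have := (key n).1.nonneg α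
      simp only [Pi.add_apply, Pi.smul_apply, smul_eq_mul] at this
      linarith
    · have h1 := hy.1.conservation v α₁ α₂ β₁ β₂ hr
      have h2 := (hx y hy).1.conservation v α₁ α₂ β₁ β₂ hr
      simp only [Pi.add_apply] at h2
      linarith
    · have h1 := (hx y hy).2
      rw [strength_add, hy.2] at h1
      linarith
  · rintro ⟨h1, h2⟩ y ⟨h3, h4⟩
    exact ⟨h3.add h1, by rw [strength_add, h2, h4, add_zero]⟩

/-- Nonnegative combinations do not cancel: any generator used with positive coefficient has its
support inside that of the sum. -/
theorem exists_mem_of_mem_conicalHull {G : Set (E' → ℝ)} (hG : ∀ g ∈ G, ∀ α, 0 ≤ g α)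
    {x : E' → ℝ} (hx : x ∈ conicalHull G) (h0 : x ≠ 0) :
    ∃ g ∈ G, ∀ α, g α ≠ 0 → x α ≠ 0 := by
  have key : (∀ α, 0 ≤ x α) ∧ (x ≠ 0 → ∃ g ∈ G, ∀ α, g α ≠ 0 → x α ≠ 0) := by
    refine Submodule.span_induction (p := fun x _ => (∀ α, 0 ≤ x α) ∧
      (x ≠ 0 → ∃ g ∈ G, ∀ α, g α ≠ 0 → x α ≠ 0)) ?_ ?_ ?_ ?_ hx
    · exact fun g hg => ⟨hG g hg, fun _ => ⟨g, hg, fun _ => id⟩⟩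
    · exact ⟨fun _ => le_rfl, fun h => absurd rfl h⟩
    · rintro x y - - ⟨h1, h2⟩ ⟨h3, h4⟩
      refine ⟨fun α => add_nonneg (h1 α) (h3 α), fun hxy => ?_⟩
      have hp : ∀ {u : ℝ}, 0 ≤ u → u ≠ 0 → 0 < u := fun h h' => lt_of_le_of_ne h h'.symm
      by_cases hx : x = 0
      · have hy : y ≠ 0 := by
          rintro rfl
          simp [hx] at hxy
        obtain ⟨g, hg, hs⟩ := h4 hy
        exact ⟨g, hg, fun α hα => (add_pos_of_nonneg_of_pos (h1 α) (hp (h3 α) (hs α hα))).ne'⟩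
      · obtain ⟨g, hg, hs⟩ := h2 hx
        exact ⟨g, hg, fun α hα => (add_pos_of_pos_of_nonneg (hp (h1 α) (hs α hα)) (h3 α)).ne'⟩
    · rintro c x - ⟨h1, h2⟩
      refine ⟨fun α => mul_nonneg c.2 (h1 α), fun hcx => ?_⟩
      have hc : c.1 ≠ 0 := fun hc => hcx (funext fun α => by
        change c.1 * x α = 0
        rw [hc, zero_mul])
      have hx : x ≠ 0 := by
        rintro rfl
        exact hcx (smul_zero c)
      obtain ⟨g, hg, hs⟩ := h2 hx
      exact ⟨g, hg, fun α hα => mul_ne_zero hc (hs α hα)⟩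
  exact key.2 h0

/-- Rigidity makes the two indicators proportional, so the supports agree and the bands are
equivalent; in particular the factor is one. -/
theorem wordIndicator_eq_of_support_subset (h : Fringing Q Q') {v w : List (SArrow E')}
    (hv : Q'.IsElementaryBand v) (hw : Q'.IsElementaryBand w)
    (hs : ∀ α, wordIndicator w α ≠ 0 → wordIndicator v α ≠ 0) :
    wordIndicator w = wordIndicator v := by
  obtain ⟨S, -⟩ := h.exists_sides
  obtain ⟨c, hc⟩ := S.eq_smul_of_isElementaryBand hv
    ((isFlow_iff S).1 (isFlow_wordIndicator_of_isElementaryBand h S hw)).2 hs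
  have hc0 : c ≠ 0 := by
    rintro rfl
    exact wordIndicator_ne_zero hw.1.1.1 (by rw [hc, zero_smul])
  have hs' : ∀ α, wordIndicator w α ≠ 0 ↔ wordIndicator v α ≠ 0 :=
    fun α => ⟨hs α, fun hα => by
      rw [hc]
      exact mul_ne_zero hc0 hα⟩
  rcases S.isRotated_or_isRotated_inv_of_isElementaryBand hv hw hs' with h1 | h1
  · exact wordIndicator_isRotated h1
  · rw [wordIndicator_isRotated h1, wordIndicator_inv]

/-- A generating subset must contain a band supported inside any given band `w`, and by rigidity
that band has the indicator of `w`. -/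
theorem isMinimalGeneratingSet_elementaryBands [Finite V'] (h : Fringing Q Q') :
    IsMinimalGeneratingSet (Q'.bandIndicator '' Q'.elementaryBands)
      (recessionCone h.turbulencePolyhedron) := by
  obtain ⟨S, hS⟩ := h.exists_sides
  rw [image_elementaryBands]
  refine ⟨Set.ext fun x => by rw [mem_conicalHull_iff S hS, h.mem_recessionCone_iff], ?_⟩
  refine fun H hH hgen => hH.antisymm ?_
  rintro _ ⟨w, hw, rfl⟩
  have hmem : wordIndicator w ∈ conicalHull H := by
    rw [hgen, h.mem_recessionCone_iff]
    exact ⟨isFlow_wordIndicator_of_isElementaryBand h S hw,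
      h.strength_wordIndicator_of_isClosedWalk S hS hw.1.1.1 (isClosedWalk_cyc _ hw.1.2.1)⟩
  obtain ⟨g, hg, hs⟩ := exists_mem_of_mem_conicalHull (fun g hg α => by
    obtain ⟨u, -, rfl⟩ := hH hg
    exact wordIndicator_nonneg u α) hmem (wordIndicator_ne_zero hw.1.1.1)
  obtain ⟨u, hu, rfl⟩ := hH hg
  rwa [h.wordIndicator_eq_of_support_subset hw hu hs] at hg

/-- The ends of a segment through the indicator are supported inside the route, hence are multiples
of it, and strength one fixes the factor. -/
theorem wordIndicator_mem_extremePoints (h : Fringing Q Q') {w : List (SArrow E')}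
    (hw : Q'.IsElementaryRoute w) :
    wordIndicator w ∈ Set.extremePoints ℝ h.turbulencePolyhedron := by
  obtain ⟨S, hS⟩ := h.exists_sides
  have hst := h.strength_wordIndicator_of_isRoute S hS hw.1
  have key : ∀ X ∈ h.turbulencePolyhedron, (∀ α, X α ≠ 0 → wordIndicator w α ≠ 0) →
      X = wordIndicator w := by
    intro X hX hs
    obtain ⟨c, rfl⟩ := S.eq_smul_of_isElementaryRoute hw ((isFlow_iff S).1 hX.1).2 hs
    have := hX.2
    rw [strength_smul, hst, mul_one] at this
    rw [this, one_smul]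
  rw [mem_extremePoints]
  refine ⟨⟨isFlow_wordIndicator_of_isRoute h S hw.1, hst⟩, ?_⟩
  rintro X hX Y hY ⟨a, b, ha, hb, -, he⟩
  have hp : ∀ {u : ℝ}, 0 ≤ u → u ≠ 0 → 0 < u := fun h h' => lt_of_le_of_ne h h'.symm
  refine ⟨key X hX fun α hα => ?_, key Y hY fun α hα => ?_⟩
  · rw [← he]
    exact (add_pos_of_pos_of_nonneg (mul_pos ha (hp (hX.1.nonneg α) hα))
      (mul_nonneg hb.le (hY.1.nonneg α))).ne'
  · rw [← he]
    exact (add_pos_of_nonneg_of_pos (mul_nonneg ha.le (hX.1.nonneg α))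
      (mul_pos hb (hp (hY.1.nonneg α) hα))).ne'

theorem exists_isElementaryRoute_of_mem_extremePoints [Finite V'] (h : Fringing Q Q')
    {F : E' → ℝ} (hF : F ∈ Set.extremePoints ℝ h.turbulencePolyhedron) :
    ∃ w, Q'.IsElementaryRoute w ∧ wordIndicator w = F := by
  obtain ⟨S, hS⟩ := h.exists_sides
  rw [mem_extremePoints] at hF
  obtain ⟨⟨hf, h1⟩, hext⟩ := hF
  have hF0 : F ≠ 0 := by
    rintro rfl
    simp [strength] at h1
  obtain ⟨w, hw | hw, hs⟩ := hf.exists_trail S hF0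
  · exfalso
    have hI := isFlow_wordIndicator_of_isElementaryBand h S hw
    have hz := h.strength_wordIndicator_of_isClosedWalk S hS hw.1.1.1
      (isClosedWalk_cyc _ hw.1.2.1)
    have hne := wordIndicator_ne_zero hw.1.1.1
    obtain ⟨ε, hε, G, hG, rfl, -⟩ := hf.exists_sub S hI hne hs
    rw [strength_add, strength_smul, hz, mul_zero, add_zero] at h1
    -- The given point is the midpoint of `G` and `G` plus `2 * ε` times the band, both of strength
    -- one.
    have h2 := (hext G ⟨hG, h1⟩ (G + (2 * ε) • wordIndicator w)
      ⟨hG.add (hI.smul (by linarith)), by rw [strength_add, strength_smul, hz, h1]; simp⟩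
      ⟨1 / 2, 1 / 2, by norm_num, by norm_num, by norm_num, by
        ext α
        simp only [Pi.add_apply, Pi.smul_apply, smul_eq_mul]
        ring⟩).1
    have h3 : ε • wordIndicator w = 0 := by
      have h4 : G + 0 = G + ε • wordIndicator w := by rwa [add_zero]
      exact (add_left_cancel h4).symm
    exact (smul_ne_zero hε.ne' hne) h3
  · refine ⟨w, hw, ?_⟩
    have hI := isFlow_wordIndicator_of_isRoute h S hw.1
    have hz := h.strength_wordIndicator_of_isRoute S hS hw.1
    obtain ⟨ε, hε, G, hG, rfl, -⟩ := hf.exists_sub S hI (wordIndicator_ne_zero hw.1.1.1) hs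
    have hG0 := strength_nonneg (h := h) hG.nonneg
    rw [strength_add, strength_smul, hz, mul_one] at h1
    -- Strength gives `ε ≤ 1`. Splitting off only `ε / 2` keeps the remaining weight positive even
    -- for `ε = 1`, when `G` has strength zero and cannot be normalised.
    have hδ : 0 < 1 - ε / 2 := by linarith
    refine (hext (wordIndicator w) ⟨hI, hz⟩
      ((1 - ε / 2)⁻¹ • (G + (ε / 2) • wordIndicator w))
      ⟨(hG.add (hI.smul (by linarith))).smul (inv_nonneg.2 hδ.le), ?_⟩
      ⟨ε / 2, 1 - ε / 2, by linarith, hδ, by ring, ?_⟩).1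
    · rw [strength_smul, strength_add, strength_smul, hz,
        show h.strength G + ε / 2 * 1 = 1 - ε / 2 by linarith, inv_mul_cancel₀ hδ.ne']
    · rw [smul_inv_smul₀ hδ.ne']
      ext α
      simp only [Pi.add_apply, Pi.smul_apply, smul_eq_mul]
      ring

theorem bijOn_routeIndicator [Finite V'] (h : Fringing Q Q') :
    Set.BijOn Q'.routeIndicator Q'.elementaryRoutes
      (Set.extremePoints ℝ h.turbulencePolyhedron) := by
  refine ⟨?_, h.injOn_routeIndicator, fun F hF => ?_⟩
  · rintro _ ⟨p, hp, rfl⟩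
    exact h.wordIndicator_mem_extremePoints hp
  · obtain ⟨w, hw, rfl⟩ := h.exists_isElementaryRoute_of_mem_extremePoints hF
    exact ⟨_, ⟨⟨w, hw.1⟩, hw, rfl⟩, rfl⟩

end Fringing
end BoundQuiver

theorem mainTheorem4 {V E V' E' : Type*} [Finite V] [Finite E] [Finite V'] [Fintype E']
    (Q : BoundQuiver V E) (hQ : Q.IsGentle) (Q' : BoundQuiver V' E')
    (h : BoundQuiver.Fringing Q Q') :
    Set.BijOn Q'.routeIndicator Q'.elementaryRoutes
        (Set.extremePoints ℝ h.turbulencePolyhedron) ∧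
      Set.InjOn Q'.bandIndicator Q'.elementaryBands ∧
      IsMinimalGeneratingSet (Q'.bandIndicator '' Q'.elementaryBands)
        (recessionCone h.turbulencePolyhedron) :=
  ⟨h.bijOn_routeIndicator, h.injOn_bandIndicator, h.isMinimalGeneratingSet_elementaryBands⟩
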